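/- Let $(r(m))_{m\ge 0}$ be integers with $r(0)=1$ and $r(m)\le r(m+1)\le r(m)+1$ for all $m\ge 0$. Candidates $1,2,\dots$ with i.i.d. $\mathrm{Exp}(1)$ values $X_1,X_2,\dots$ are examined one by one. If $m\ge 0$ candidates have been accepted so far, the next candidate is accepted if and only if her value exceeds the threshold $Y_m$, the $r(m)$-th largest of the $m$ accepted values ($Y_m:=0$ if $r(m)=m+1$). Let $M_n$ be the number of accepted candidates among the first $n$, let $N_m$ be the index of the $m$-th accepted candidate ($N_0:=0$), let $P_n$ be the conditional probability, given $X_1,\dots,X_{n-1}$, that candidate $n$ is accepted, and let $L_n:=n-N_{M_n}$ be the number of candidates among the first $n$ examined after the last accepted one. Let $\alpha\in(0,1)$ and assume that $\sum_{m\ge 1}\left|\frac{1}{r(m)}-\frac{1}{\alpha m}\right|<\infty$. Put $\rho:=\sum_{m\ge 1}\left(\frac{1}{r(m)}-\frac{1}{\alpha m}\right)$, let $\gamma$ be Euler's constant, and for $k\ge 1$ let $\delta_k:=1$ if $r(k)=r(k-1)$, $\delta_k:=0$ otherwise, and $E_k:=r(k)(Y_k-Y_{k-1})$. Then the $E_k$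 with $\delta_k=1$ are i.i.d. $\mathrm{Exp}(1)$; the series $$Z:=\sum_{k=1}^\infty \frac{\delta_k}{r(k)}\,(E_k-1)$$ converges almost surely; and with $$W:=e^{(\alpha-1)\gamma-\alpha\rho-\alpha}\,e^{-\alpha Z}>0$$ we have $M_n/n^\alpha\to W$ almost surely. Moreover, as $n\to\infty$: 1. almost surely, $P_n\sim \alpha M_n/n\sim \alpha W n^{\alpha-1}$, where $a_n\sim b_n$ means $a_n/b_n\to 1$; 2. $L_n/n^{1-\alpha}\to \alpha^{-1}W^{-1}E$ in distribution, where $E\sim\mathrm{Exp}(1)$ is independent of $W$. -/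

import Mathlib

open MeasureTheory ProbabilityTheory Filter Topology

noncomputable section

namespace Hiring

/-- The sequences `r(m)`, `m ≥ 0`, that define a rank-based hiring strategy:
`r(0) = 1` and `r(m) ≤ r(m+1) ≤ r(m) + 1`. -/
def IsRankSequence (r : ℕ → ℕ) : Prop :=
  r 0 = 1 ∧ ∀ m, r m ≤ r (m + 1) ∧ r (m + 1) ≤ r m + 1

/-- `kthLargest x A k` is the `k`-th largest (`k ≥ 1`) of the values `x i`, `i ∈ A`; it is `0` if
there are fewer than `k` of them. -/
def kthLargest (x : ℕ → ℝ) (A : Finset ℕ) (k : ℕ) : ℝ :=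
  ((A.val.map x).sort (· ≥ ·)).getD (k - 1) 0

/-- The threshold for the next candidate when `A` is the set of (indices of) the candidates
accepted so far: with `m = #A`, the `r(m)`-th largest accepted value, or `0` if `r(m) = m + 1`. -/
def threshold (r : ℕ → ℕ) (x : ℕ → ℝ) (A : Finset ℕ) : ℝ :=
  kthLargest x A (r A.card)

/-- `x n` is the value of candidate `n`, `n ≥ 1` (the number `x 0` is never used).
`hired r x n` is the set of the accepted candidates among the candidates `1, …, n`. -/
def hired (r : ℕ → ℕ) (x : ℕ → ℝ) : ℕ → Finset ℕ
  | 0 => ∅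
  | n + 1 =>
    if threshold r x (hired r x n) < x (n + 1) then insert (n + 1) (hired r x n) else hired r x n

/-- `M_n`: the number of accepted candidates among `1, …, n`. -/
def M (r : ℕ → ℕ) (x : ℕ → ℝ) (n : ℕ) : ℕ := (hired r x n).card

/-- `N_m`: the index of the `m`-th accepted candidate (`N_0 = 0`). -/
def N (r : ℕ → ℕ) (x : ℕ → ℝ) (m : ℕ) : ℕ := sInf {n | m ≤ M r x n}

/-- `Y_m`: the threshold when `m` candidates have been accepted. -/
def Y (r : ℕ → ℕ) (x : ℕ → ℝ) (m : ℕ) : ℝ := threshold r x (hired r x (N r x m))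

/-- `L_n = n - N_{M_n}`: the number of candidates among `1, …, n` examined after the last accepted
one. -/
def L (r : ℕ → ℕ) (x : ℕ → ℝ) (n : ℕ) : ℝ := (n : ℝ) - (N r x (M r x n) : ℝ)

/-- `P_n`, `n ≥ 1`: the conditional probability, given `X_1, …, X_{n-1}`, that candidate `n` is
accepted. -/
def P {Ω : Type*} [MeasurableSpace Ω] (μ : Measure Ω) (r : ℕ → ℕ) (X : ℕ → Ω → ℝ) (n : ℕ) :
    Ω → ℝ :=
  μ[Set.indicator {ω | n ∈ hired r (fun k => X k ω) n} (fun _ => (1 : ℝ)) |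
    ⨆ k ∈ Finset.Ico 1 n, MeasurableSpace.comap (X k) inferInstance]

/-- `δ_k`, `k ≥ 1`: the indicator of `r(k) = r(k-1)`. -/
def delta (r : ℕ → ℕ) (k : ℕ) : ℝ := if r k = r (k - 1) then 1 else 0

/-- `E_k = r(k) (Y_k - Y_{k-1})`, `k ≥ 1`. -/
def E (r : ℕ → ℕ) (x : ℕ → ℝ) (k : ℕ) : ℝ := (r k : ℝ) * (Y r x k - Y r x (k - 1))

/-- `ρ = ∑_{m ≥ 1} (1 / r(m) - 1 / (α m))`. -/
def rho (r : ℕ → ℕ) (α : ℝ) : ℝ :=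
  ∑' m : ℕ, (1 / (r (m + 1) : ℝ) - 1 / (α * ((m + 1 : ℕ) : ℝ)))

/-- The value `e^{(α - 1) γ - α ρ - α} e^{-α z}` of `W` when `Z = z`, with Euler's constant `γ`. -/
def W (r : ℕ → ℕ) (α z : ℝ) : ℝ :=
  Real.exp ((α - 1) * Real.eulerMascheroniConstant - α * rho r α - α) * Real.exp (-α * z)

instance isProbabilityMeasure_exp_one : IsProbabilityMeasure (expMeasure 1) :=
  isProbabilityMeasure_expMeasure one_pos

end Hiring

end

/-! The proof follows the threshold as a function of the number `m` of accepted candidates. When the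
count passes from `m` to `m + 1`, exactly `r m` accepted values, the new one included, exceed `Y_m`.
If the rank increases, the threshold stays; otherwise it moves to the smallest of these values. By
lack of memory their excesses over `Y_m` act as i.i.d. Exp(1) variables independent of the past, so
`E_{m+1}`, which is `r m` times the smallest excess, is Exp(1) and independent of the earlier jumps.
In rigorous form: lowering the coordinates in the set of high values by `s` preserves the history
and costs a factor `e^{-s r m}` (`infinitePi_expMeasure_shift`, `acceptedAbove_sub_iff`,
`measure_forall_lt_E_and_lt_E_succ`).

Consequently `Y_m` is the deterministic sum of `δ_k / r k` plus a partial sum of `Z`. The latter is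
a martingale bounded in L², since `∑ 1 / r²` converges. The former is a combination of harmonic
numbers; as `r m / m → α`, it is `(1/α - 1) log m` plus a convergent sequence. So `e^{Y_m} ∼ C
m^{1/α - 1}` almost surely (`tendsto_exp_div_rpow`).

To return from `m` to the time `n`: given the past, candidate `n + 1` is accepted with probability
`e^{-Y_{M_n}}`. The martingale with differences `(M_{n+1} - M_n - e^{-Y_{M_n}}) / (M_n + 1)`
converges, and Kronecker's lemma with weights `(M_n + 1) e^{Y_{M_n}}` gives `n ∼ ∑_{k < M_n} e^{Y_k}
∼ α C M_n^{1/α}` (`tendsto_div_rpow_of_sum_tendsto`). Inverting yields `M_n / n^α → (α C)^{-α} = W`,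
and the asymptotics of `P_n` follow.

Finally, `L_n ≥ j` means that nobody was accepted at the last `j` steps. This has probability equal
to the mean of `(1 - e^{-Y})^j`, with `Y` the threshold `j` steps before; for `j ∼ t n^{1-α}`
dominated convergence gives the limit, the mean of `e^{-t α W}`. -/

namespace Hiring

/-! ### Order statistics of a finite set of values -/

/-- In a decreasing list an upward closed property holds exactly on an initial segment, whose length
is the count. -/
theorem sorted_getElem_iff_lt_countP (p : ℝ → Prop) [DecidablePred p]
    (hp : ∀ a b, p a → a ≤ b → p b) (l : List ℝ) (hl : l.Pairwise (· ≥ ·)) (k : ℕ)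
    (hk : k < l.length) : p l[k] ↔ k < l.countP (fun a => decide (p a)) := by
  induction l generalizing k with
  | nil => simp at hk
  | cons a l ih =>
    rw [List.pairwise_cons] at hl
    rw [List.countP_cons]
    by_cases ha : p a
    · cases k with
      | zero => simp [ha]
      | succ k =>
        simp only [List.getElem_cons_succ, ha, decide_true, if_true]
        rw [ih hl.2 k (by simpa using hk)]
        omega
    · have h0 : ∀ b ∈ l, ¬ p b := fun b hb h => ha (hp b a h (hl.1 b hb))
      have hc : l.countP (fun a => decide (p a)) = 0 := by
        rw [List.countP_eq_zero]; simpa using h0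
      rw [hc]
      cases k with
      | zero => simp [ha]
      | succ k =>
        simp only [List.getElem_cons_succ, ha]
        have := h0 _ (List.getElem_mem (l := l) (n := k) (by simpa using hk))
        simp [this]

/-- The property is arbitrary because both strict and weak lower bounds on the order statistic are
needed. -/
theorem kthLargest_iff (p : ℝ → Prop) [DecidablePred p] (hp : ∀ a b, p a → a ≤ b → p b)
    (x : ℕ → ℝ) (A : Finset ℕ) {k : ℕ} (hk : 1 ≤ k) (hkA : k ≤ A.card) :
    p (kthLargest x A k) ↔ k ≤ (A.filter fun i => p (x i)).card := by
  have hlen : ((A.val.map x).sort (· ≥ ·)).length = A.card := by simp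
  have hlt : k - 1 < ((A.val.map x).sort (· ≥ ·)).length := by omega
  have hcount : ((A.val.map x).sort (· ≥ ·)).countP (fun a => decide (p a)) =
      (A.filter fun i => p (x i)).card := by
    rw [← Multiset.coe_countP, Multiset.sort_eq, Multiset.countP_map]
    rfl
  rw [kthLargest, List.getD_eq_getElem _ _ hlt,
    sorted_getElem_iff_lt_countP p hp _ (Multiset.pairwise_sort _ _) _ hlt, hcount]
  omega

theorem kthLargest_eq_zero (x : ℕ → ℝ) (A : Finset ℕ) {k : ℕ} (hkA : A.card < k) :
    kthLargest x A k = 0 := by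
  rw [kthLargest, List.getD_eq_default]
  simp; omega

/-- For `c ≥ 0` the default value `0` is consistent with the count, so `k` may exceed the size of
`A`. -/
theorem lt_kthLargest_iff (x : ℕ → ℝ) (A : Finset ℕ) {k : ℕ} (hk : 1 ≤ k) {c : ℝ} (hc : 0 ≤ c) :
    c < kthLargest x A k ↔ k ≤ (A.filter fun i => c < x i).card := by
  rcases le_or_gt k A.card with h | h
  · exact kthLargest_iff (fun a => c < a) (fun a b => lt_of_lt_of_le) x A hk h
  · rw [kthLargest_eq_zero x A h]
    have := Finset.card_filter_le A fun i => c < x i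
    constructor
    · intro h; linarith
    · intro h; omega

theorem kthLargest_nonneg {x : ℕ → ℝ} {A : Finset ℕ} (hx : ∀ i ∈ A, 0 ≤ x i) {k : ℕ}
    (hk : 1 ≤ k) : 0 ≤ kthLargest x A k := by
  rcases le_or_gt k A.card with h | h
  · rw [kthLargest_iff (fun a => 0 ≤ a) (fun a b => le_trans) x A hk h,
      Finset.filter_true_of_mem hx]
    exact h
  · rw [kthLargest_eq_zero x A h]

/-! ### Rank sequences and the pathwise dynamics of the accepted set -/

section rank

variable {r : ℕ → ℕ}

theorem IsRankSequence.pos (hr : IsRankSequence r) (m : ℕ) : 1 ≤ r m := by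
  induction m with
  | zero => exact hr.1.ge
  | succ m ih => exact ih.trans (hr.2 m).1

theorem IsRankSequence.le_succ (hr : IsRankSequence r) (m : ℕ) : r m ≤ m + 1 := by
  induction m with
  | zero => exact hr.1.le
  | succ m ih => have := (hr.2 m).2; omega

theorem IsRankSequence.monotone (hr : IsRankSequence r) : Monotone r :=
  monotone_nat_of_le_succ fun m => (hr.2 m).1

end rank

/-- The threshold for candidate `n + 1`. -/
noncomputable def thr (r : ℕ → ℕ) (x : ℕ → ℝ) (n : ℕ) : ℝ := threshold r x (hired r x n)

variable {r : ℕ → ℕ} {x : ℕ → ℝ}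

theorem hired_succ_of_lt {n : ℕ} (h : thr r x n < x (n + 1)) :
    hired r x (n + 1) = insert (n + 1) (hired r x n) := if_pos h

theorem hired_succ_of_le {n : ℕ} (h : x (n + 1) ≤ thr r x n) :
    hired r x (n + 1) = hired r x n := if_neg (not_lt.2 h)

theorem hired_subset_Icc (r : ℕ → ℕ) (x : ℕ → ℝ) (n : ℕ) : hired r x n ⊆ Finset.Icc 1 n := by
  induction n with
  | zero => simp [hired]
  | succ n ih =>
    have h1 : Finset.Icc 1 n ⊆ Finset.Icc 1 (n + 1) := Finset.Icc_subset_Icc le_rfl (by omega)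
    rcases lt_or_ge (thr r x n) (x (n + 1)) with h | h
    · rw [hired_succ_of_lt h]
      exact Finset.insert_subset (by simp) (ih.trans h1)
    · rw [hired_succ_of_le h]
      exact ih.trans h1

theorem one_le_of_mem_hired {n i : ℕ} (hi : i ∈ hired r x n) : 1 ≤ i :=
  (Finset.mem_Icc.1 (hired_subset_Icc r x n hi)).1

theorem succ_notMem_hired (r : ℕ → ℕ) (x : ℕ → ℝ) (n : ℕ) : n + 1 ∉ hired r x n := fun h => by
  have := (Finset.mem_Icc.1 (hired_subset_Icc r x n h)).2
  omega

theorem mem_hired_succ_iff (r : ℕ → ℕ) (x : ℕ → ℝ) (n : ℕ) :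
    n + 1 ∈ hired r x (n + 1) ↔ thr r x n < x (n + 1) := by
  rcases lt_or_ge (thr r x n) (x (n + 1)) with h | h
  · simp [hired_succ_of_lt h, h]
  · simp [hired_succ_of_le h, succ_notMem_hired, h]

theorem hired_mono (r : ℕ → ℕ) (x : ℕ → ℝ) : Monotone (hired r x) := by
  refine monotone_nat_of_le_succ fun n => ?_
  rcases lt_or_ge (thr r x n) (x (n + 1)) with h | h
  · rw [hired_succ_of_lt h]; exact Finset.subset_insert _ _
  · rw [hired_succ_of_le h]

theorem M_succ_of_lt {n : ℕ} (h : thr r x n < x (n + 1)) : M r x (n + 1) = M r x n + 1 := by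
  rw [M, hired_succ_of_lt h, Finset.card_insert_of_notMem (succ_notMem_hired r x n), M]

theorem M_succ_of_le {n : ℕ} (h : x (n + 1) ≤ thr r x n) : M r x (n + 1) = M r x n := by
  rw [M, hired_succ_of_le h, M]

theorem M_succ_eq (r : ℕ → ℕ) (x : ℕ → ℝ) (n : ℕ) :
    M r x (n + 1) = M r x n + if thr r x n < x (n + 1) then 1 else 0 := by
  split_ifs with h
  · exact M_succ_of_lt h
  · exact M_succ_of_le (not_lt.1 h)

theorem M_mono (r : ℕ → ℕ) (x : ℕ → ℝ) : Monotone (M r x) :=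
  fun _ _ h => Finset.card_le_card (hired_mono r x h)

theorem N_le {m n : ℕ} (h : m ≤ M r x n) : N r x m ≤ n := Nat.sInf_le h

theorem le_M_N {m n : ℕ} (h : m ≤ M r x n) : m ≤ M r x (N r x m) :=
  Nat.sInf_mem (s := {n | m ≤ M r x n}) ⟨n, h⟩

theorem hired_N_M (r : ℕ → ℕ) (x : ℕ → ℝ) (n : ℕ) :
    hired r x (N r x (M r x n)) = hired r x n :=
  Finset.eq_of_subset_of_card_le (hired_mono r x (N_le le_rfl)) (le_M_N le_rfl)

theorem Y_M (r : ℕ → ℕ) (x : ℕ → ℝ) (n : ℕ) : Y r x (M r x n) = thr r x n := by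
  rw [Y, hired_N_M, thr]

theorem Y_zero (hr : IsRankSequence r) (x : ℕ → ℝ) : Y r x 0 = 0 := by
  have h : thr r x 0 = 0 := by
    rw [thr, threshold]
    exact kthLargest_eq_zero _ _ (by simp [hired, hr.1])
  rw [← h, ← Y_M]; rfl

theorem hired_congr {x' : ℕ → ℝ} (h : ∀ i, 1 ≤ i → x i = x' i) (n : ℕ) :
    hired r x n = hired r x' n ∧ thr r x n = thr r x' n := by
  have key : ∀ n, hired r x n = hired r x' n → thr r x n = thr r x' n := by
    intro n hn
    rw [thr, thr, threshold, threshold, kthLargest, kthLargest, hn]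
    congr 2
    refine Multiset.map_congr rfl fun i hi => h i (one_le_of_mem_hired (r := r) (x := x') hi)
  induction n with
  | zero => exact ⟨rfl, key 0 rfl⟩
  | succ n ih =>
    suffices hh : hired r x (n + 1) = hired r x' (n + 1) from ⟨hh, key _ hh⟩
    have h1 : x (n + 1) = x' (n + 1) := h _ (by omega)
    have h2 := ih.2
    rw [thr, thr] at h2
    rw [hired, hired, h2, h1, ih.1]

/-- Thresholds of levels already reached by time `n` depend on the history up to `n` only; this
makes the earlier `E_k` part of the past. -/
theorem Y_congr_of_hired {x' : ℕ → ℝ} {n : ℕ} (h : ∀ k ≤ n, hired r x k = hired r x' k)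
    (h' : ∀ k ≤ n, thr r x k = thr r x' k) {j : ℕ} (hj : j ≤ M r x n) : Y r x j = Y r x' j := by
  have hM : ∀ k ≤ n, M r x k = M r x' k := fun k hk => by rw [M, M, h k hk]
  have hj' : j ≤ M r x' n := hM n le_rfl ▸ hj
  have hN : N r x j = N r x' j := by
    apply le_antisymm
    · exact N_le (by rw [hM _ (N_le hj')]; exact le_M_N hj')
    · exact N_le (by rw [← hM _ (N_le hj)]; exact le_M_N hj)
  change thr r x (N r x j) = thr r x' (N r x' j)
  rw [← hN]
  exact h' _ (N_le hj)

theorem thr_nonneg (hr : IsRankSequence r) (hx : ∀ i, 1 ≤ i → 0 < x i) (n : ℕ) :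
    0 ≤ thr r x n :=
  kthLargest_nonneg (fun i hi => (hx i (one_le_of_mem_hired hi)).le) (hr.pos _)

theorem lt_thr_iff (hr : IsRankSequence r) {c : ℝ} (hc : 0 ≤ c) (n : ℕ) :
    c < thr r x n ↔ r (M r x n) ≤ ((hired r x n).filter fun i => c < x i).card :=
  lt_kthLargest_iff x _ (hr.pos _) hc

/-- After an acceptance the number of values above any level below the threshold grows by one, and
the rank by at most one. -/
theorem thr_le_succ (hr : IsRankSequence r) (hx : ∀ i, 1 ≤ i → 0 < x i) (n : ℕ) :
    thr r x n ≤ thr r x (n + 1) := by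
  rcases lt_or_ge (thr r x n) (x (n + 1)) with h | h
  · refine le_of_forall_lt fun c hc => ?_
    rcases lt_or_ge c 0 with h0 | h0
    · exact h0.trans_le (thr_nonneg hr hx _)
    · rw [lt_thr_iff hr h0] at hc ⊢
      rw [M_succ_of_lt h, hired_succ_of_lt h, Finset.filter_insert, if_pos (by
        rw [← lt_thr_iff hr h0] at hc; exact hc.trans h), Finset.card_insert_of_notMem]
      · exact (hr.2 _).2.trans (by omega)
      · simp [succ_notMem_hired]
  · rw [thr, thr, hired_succ_of_le h]

theorem thr_mono (hr : IsRankSequence r) (hx : ∀ i, 1 ≤ i → 0 < x i) : Monotone (thr r x) :=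
  monotone_nat_of_le_succ (thr_le_succ hr hx)

/-- The accepted candidates, candidate `n + 1` included, with values above the threshold for
candidate `n + 1`. -/
noncomputable def above (r : ℕ → ℕ) (x : ℕ → ℝ) (n : ℕ) : Finset ℕ :=
  (hired r x (n + 1)).filter fun i => thr r x n < x i

/-- As the values are distinct, at most one of them sits at the threshold. If the threshold is the
default `0`, all accepted values exceed it, and `r m ≤ m + 1` forces `r m = m + 1`. -/
theorem card_filter_thr_lt (hr : IsRankSequence r) (hx : ∀ i, 1 ≤ i → 0 < x i)
    (hinj : ∀ i j, 1 ≤ i → 1 ≤ j → x i = x j → i = j) (n : ℕ) :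
    ((hired r x n).filter fun i => thr r x n < x i).card + 1 = r (M r x n) := by
  have hlt : ((hired r x n).filter fun i => thr r x n < x i).card < r (M r x n) := by
    rw [← not_le, ← lt_thr_iff hr (thr_nonneg hr hx n)]
    exact lt_irrefl _
  rcases le_or_gt (r (M r x n)) (hired r x n).card with h | h
  · have h1 := (kthLargest_iff (fun a => thr r x n ≤ a) (fun a b => le_trans) x (hired r x n)
      (hr.pos (M r x n)) h).1 le_rfl
    have h2 : ((hired r x n).filter fun i => thr r x n ≤ x i) =
        ((hired r x n).filter fun i => thr r x n < x i) ∪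
        ((hired r x n).filter fun i => thr r x n = x i) := by
      rw [← Finset.filter_or]
      exact Finset.filter_congr fun i _ => le_iff_lt_or_eq
    have h3 : ((hired r x n).filter fun i => thr r x n = x i).card ≤ 1 := by
      rw [Finset.card_le_one]
      intro i hi j hj
      rw [Finset.mem_filter] at hi hj
      exact hinj i j (one_le_of_mem_hired hi.1) (one_le_of_mem_hired hj.1) (hi.2.symm.trans hj.2)
    rw [h2] at h1
    have := Finset.card_union_le ((hired r x n).filter fun i => thr r x n < x i)
      ((hired r x n).filter fun i => thr r x n = x i)
    omega
  · have h0 : thr r x n = 0 := kthLargest_eq_zero _ _ h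
    rw [Finset.filter_true_of_mem fun i hi => by rw [h0]; exact hx i (one_le_of_mem_hired hi)]
    have := hr.le_succ (M r x n)
    rw [M] at this h ⊢
    omega

theorem card_above (hr : IsRankSequence r) (hx : ∀ i, 1 ≤ i → 0 < x i)
    (hinj : ∀ i j, 1 ≤ i → 1 ≤ j → x i = x j → i = j) {n : ℕ} (h : thr r x n < x (n + 1)) :
    (above r x n).card = r (M r x n) := by
  rw [above, hired_succ_of_lt h, Finset.filter_insert, if_pos h, Finset.card_insert_of_notMem,
    card_filter_thr_lt hr hx hinj]
  simp [succ_notMem_hired]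

/-- Exactly `r m` values exceed the old threshold, so if the rank stays, the new threshold is the
smallest of them. -/
theorem lt_thr_succ_iff (hr : IsRankSequence r) (hx : ∀ i, 1 ≤ i → 0 < x i)
    (hinj : ∀ i j, 1 ≤ i → 1 ≤ j → x i = x j → i = j) {n : ℕ} (h : thr r x n < x (n + 1))
    (hrm : r (M r x n + 1) = r (M r x n)) {c : ℝ} (hc : thr r x n ≤ c) :
    c < thr r x (n + 1) ↔ ∀ i ∈ above r x n, c < x i := by
  rw [lt_thr_iff hr ((thr_nonneg hr hx n).trans hc), M_succ_of_lt h, hrm,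
    ← card_above hr hx hinj h]
  have hsub : ((hired r x (n + 1)).filter fun i => c < x i) ⊆ above r x n :=
    Finset.monotone_filter_right _ fun i _ hi => hc.trans_lt hi
  constructor
  · intro hcard i hi
    rw [← Finset.eq_of_subset_of_card_le hsub hcard, Finset.mem_filter] at hi
    exact hi.2
  · intro hall
    refine Finset.card_le_card fun i hi => Finset.mem_filter.2 ⟨(Finset.mem_filter.1 hi).1, hall i hi⟩

/-- The values above the old threshold are one too few for the increased rank. -/
theorem thr_succ_eq (hr : IsRankSequence r) (hx : ∀ i, 1 ≤ i → 0 < x i)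
    (hinj : ∀ i j, 1 ≤ i → 1 ≤ j → x i = x j → i = j) {n : ℕ} (h : thr r x n < x (n + 1))
    (hrm : r (M r x n + 1) = r (M r x n) + 1) : thr r x (n + 1) = thr r x n := by
  refine le_antisymm (not_lt.1 fun hlt => ?_) (thr_le_succ hr hx n)
  rw [lt_thr_iff hr (thr_nonneg hr hx n), M_succ_of_lt h, hrm, ← card_above hr hx hinj h] at hlt
  exact absurd hlt (by rw [above]; omega)

/-- Thresholds increase, so a value above `thr r x n` beats every threshold up to time `n`, and it
is counted above every level that matters. Moving such values without crossing `thr r x n` is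
therefore invisible to the history. -/
theorem hired_thr_eq_of_eq_off (hr : IsRankSequence r) {x' : ℕ → ℝ} (hx : ∀ i, 1 ≤ i → 0 < x i)
    (hx' : ∀ i, 1 ≤ i → 0 < x' i) {S : Finset ℕ} {n : ℕ} (hoff : ∀ i, 1 ≤ i → i ∉ S → x' i = x i)
    (hS : ∀ i ∈ S, thr r x n < x i) (hS' : ∀ i ∈ S, thr r x n < x' i) :
    ∀ k ≤ n, hired r x k = hired r x' k ∧ thr r x k = thr r x' k := by
  have key : ∀ k ≤ n, hired r x k = hired r x' k → thr r x k = thr r x' k := by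
    intro k hk hh
    have hf : ∀ c ≤ thr r x n, ((hired r x k).filter fun i => c < x i) =
        ((hired r x' k).filter fun i => c < x' i) := by
      intro c hc
      rw [← hh]
      refine Finset.filter_congr fun i hi => ?_
      by_cases hiS : i ∈ S
      · simp [hc.trans_lt (hS i hiS), hc.trans_lt (hS' i hiS)]
      · rw [hoff i (one_le_of_mem_hired hi) hiS]
    have hM : M r x k = M r x' k := by rw [M, M, hh]
    have hc : ∀ c, 0 ≤ c → c ≤ thr r x n → (c < thr r x k ↔ c < thr r x' k) := by
      intro c h0 hc
      rw [lt_thr_iff hr h0, lt_thr_iff hr h0, hf c hc, hM]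
    have hle : thr r x k ≤ thr r x n := thr_mono hr hx hk
    -- The thresholds can be compared only at levels up to `thr r x n`; testing this level itself
    -- puts `thr r x' k` in that range.
    have hle' : thr r x' k ≤ thr r x n := by
      rw [← not_lt, ← hc _ (thr_nonneg hr hx n) le_rfl, not_lt]
      exact hle
    apply le_antisymm
    · rw [← not_lt, hc _ (thr_nonneg hr hx' k) hle']
      exact lt_irrefl _
    · rw [← not_lt, ← hc _ (thr_nonneg hr hx k) hle]
      exact lt_irrefl _
  intro k
  induction k with
  | zero => exact fun h => ⟨rfl, key 0 h rfl⟩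
  | succ k ih =>
    intro hk
    obtain ⟨h1, h2⟩ := ih (by omega)
    suffices hh : hired r x (k + 1) = hired r x' (k + 1) from ⟨hh, key _ hk hh⟩
    have hiff : thr r x k < x (k + 1) ↔ thr r x' k < x' (k + 1) := by
      rw [← h2]
      by_cases hiS : k + 1 ∈ S
      · have hle : thr r x k ≤ thr r x n := thr_mono hr hx (by omega)
        simp [hle.trans_lt (hS _ hiS), hle.trans_lt (hS' _ hiS)]
      · rw [hoff _ (by omega) hiS]
    rcases lt_or_ge (thr r x k) (x (k + 1)) with h | h
    · rw [hired_succ_of_lt h, hired_succ_of_lt (hiff.1 h), h1]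
    · rw [hired_succ_of_le h, hired_succ_of_le (not_lt.1 (mt hiff.2 (not_lt.2 h))), h1]

theorem above_eq_of_eq_off (hr : IsRankSequence r) {x' : ℕ → ℝ} (hx : ∀ i, 1 ≤ i → 0 < x i)
    (hx' : ∀ i, 1 ≤ i → 0 < x' i) {n : ℕ} (hn : thr r x n < x (n + 1))
    (hoff : ∀ i, 1 ≤ i → i ∉ above r x n → x' i = x i)
    (hS' : ∀ i ∈ above r x n, thr r x n < x' i) :
    (∀ k ≤ n, hired r x k = hired r x' k ∧ thr r x k = thr r x' k) ∧
      thr r x' n < x' (n + 1) ∧ above r x' n = above r x n := by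
  have h := hired_thr_eq_of_eq_off hr hx hx' hoff (fun i hi => (Finset.mem_filter.1 hi).2) hS'
  have hmem : n + 1 ∈ above r x n := by simp [above, hired_succ_of_lt hn, hn]
  have hlt : thr r x' n < x' (n + 1) := by rw [← (h n le_rfl).2]; exact hS' _ hmem
  refine ⟨h, hlt, ?_⟩
  have hh : hired r x' (n + 1) = hired r x (n + 1) := by
    rw [hired_succ_of_lt hn, hired_succ_of_lt hlt, (h n le_rfl).1]
  ext i
  by_cases hi : i ∈ above r x n
  · have h1 := (Finset.mem_filter.1 hi).1
    simp only [hi, iff_true]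
    rw [above, Finset.mem_filter, hh, ← (h n le_rfl).2]
    exact ⟨h1, hS' i hi⟩
  · simp only [hi, iff_false]
    intro hi'
    rw [above, Finset.mem_filter, hh, ← (h n le_rfl).2] at hi'
    rw [hoff i (one_le_of_mem_hired hi'.1) hi] at hi'
    exact hi (Finset.mem_filter.2 hi')

theorem L_ge_iff (r : ℕ → ℕ) (x : ℕ → ℝ) {n j : ℕ} (hj : j ≤ n) :
    (j : ℝ) ≤ L r x n ↔ M r x n = M r x (n - j) := by
  have h1 : (j : ℝ) ≤ L r x n ↔ N r x (M r x n) ≤ n - j := by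
    rw [L, le_sub_comm, ← Nat.cast_sub hj, Nat.cast_le]
  rw [h1]
  constructor
  · intro h
    apply le_antisymm _ (M_mono r x (Nat.sub_le n j))
    exact (le_M_N le_rfl).trans (M_mono r x h)
  · intro h
    exact N_le h.le

/-- While nobody is accepted the threshold is frozen, so the whole run of rejections is decided by
the threshold at time `n`. -/
theorem M_add_eq_iff (r : ℕ → ℕ) (x : ℕ → ℝ) (n j : ℕ) :
    M r x (n + j) = M r x n ↔ ∀ i ∈ Finset.range j, x (n + i + 1) ≤ thr r x n := by
  induction j with
  | zero => simp
  | succ j ih =>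
    rw [Finset.range_add_one, Finset.forall_mem_insert, ← ih]
    constructor
    · intro h
      have h1 : M r x (n + j) = M r x n := le_antisymm
        ((M_mono r x (by omega : n + j ≤ n + (j + 1))).trans h.le) (M_mono r x (by omega))
      have h2 : thr r x (n + j) = thr r x n := by rw [← Y_M, ← Y_M, h1]
      refine ⟨not_lt.1 fun hlt => ?_, h1⟩
      rw [← h2] at hlt
      have := M_succ_of_lt hlt
      rw [add_assoc, h, h1] at this
      omega
    · rintro ⟨h, h1⟩
      have h2 : thr r x (n + j) = thr r x n := by rw [← Y_M, ← Y_M, h1]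
      rw [← h2] at h
      rw [← add_assoc, M_succ_of_le h, h1]

/-! ### Weighted means, Kronecker's lemma and a Tauberian lemma -/

theorem tendsto_weighted_mean {f g : ℕ → ℝ} {c : ℝ} (hg : ∀ k, 0 < g k)
    (hG : Tendsto (fun n => ∑ k ∈ Finset.range n, g k) atTop atTop)
    (h : Tendsto (fun k => f k / g k) atTop (𝓝 c)) :
    Tendsto (fun n => (∑ k ∈ Finset.range n, f k) / ∑ k ∈ Finset.range n, g k) atTop (𝓝 c) := by
  have h1 : (fun k => f k - c * g k) =o[atTop] g := by
    rw [Asymptotics.isLittleO_iff_tendsto fun k hk => absurd hk (hg k).ne']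
    have := h.sub_const c
    rw [sub_self] at this
    refine this.congr fun k => ?_
    have := (hg k).ne'
    field_simp
  have h2 := h1.sum_range (fun k => (hg k).le) hG
  have h3 := h2.tendsto_div_nhds_zero.add_const c
  rw [zero_add] at h3
  refine h3.congr' ?_
  filter_upwards [hG.eventually_gt_atTop 0] with n hn
  rw [Finset.sum_sub_distrib, ← Finset.mul_sum]
  field_simp
  ring

/-- **Kronecker's lemma**. -/
theorem tendsto_kronecker {b ξ : ℕ → ℝ} {s : ℝ} (hb : Monotone b) (hb0 : 0 < b 0)
    (hbt : Tendsto b atTop atTop)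
    (h : Tendsto (fun n => ∑ i ∈ Finset.range n, ξ i) atTop (𝓝 s)) :
    Tendsto (fun n => (∑ i ∈ Finset.range n, b i * ξ i) / b n) atTop (𝓝 0) := by
  set S : ℕ → ℝ := fun n => ∑ i ∈ Finset.range n, ξ i with hS
  have hpos : ∀ n, 0 < b n := fun n => hb0.trans_le (hb (Nat.zero_le n))
  have hsum : ∀ n, ∑ i ∈ Finset.range n, (b (i + 1) - b i) = b n - b 0 := fun n =>
    Finset.sum_range_sub b n
  -- Summation by parts, with the partial sums centred at their limit: the last sum has total weight
  -- `b n - b 0` and terms tending to zero, hence is `o(b n)`.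
  have habel : ∀ n, ∑ i ∈ Finset.range n, b i * ξ i =
      b n * (S n - s) + s * b 0 - ∑ i ∈ Finset.range n, (b (i + 1) - b i) * (S (i + 1) - s) := by
    intro n
    induction n with
    | zero => simp [hS]; ring
    | succ n ih =>
      rw [Finset.sum_range_succ, ih, Finset.sum_range_succ]
      have : S (n + 1) = S n + ξ n := Finset.sum_range_succ _ _
      rw [this]; ring
  have hS' : Tendsto (fun i => S (i + 1) - s) atTop (𝓝 0) := by
    have := ((tendsto_add_atTop_iff_nat 1).2 h).sub_const s
    rwa [sub_self] at this
  have ho : (fun i => (b (i + 1) - b i) * (S (i + 1) - s)) =o[atTop]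
      (fun i => b (i + 1) - b i) := by
    have := (Asymptotics.isBigO_refl (fun i => b (i + 1) - b i) atTop).mul_isLittleO
      ((Asymptotics.isLittleO_one_iff ℝ).2 hS')
    simpa using this
  have ht : Tendsto (fun n => ∑ i ∈ Finset.range n, (b (i + 1) - b i)) atTop atTop := by
    simp_rw [hsum]
    exact tendsto_atTop_add_const_right _ _ hbt
  have ho2 := ho.sum_range (fun i => sub_nonneg.2 (hb (Nat.le_succ i))) ht
  have hO : (fun n => ∑ i ∈ Finset.range n, (b (i + 1) - b i)) =O[atTop] b := by
    refine Asymptotics.IsBigO.of_bound 1 (Eventually.of_forall fun n => ?_)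
    rw [hsum, Real.norm_of_nonneg (sub_nonneg.2 (hb (Nat.zero_le n))),
      Real.norm_of_nonneg (hpos n).le]
    linarith
  have l1 := (ho2.trans_isBigO hO).tendsto_div_nhds_zero
  have l2 : Tendsto (fun n => s * b 0 / b n) atTop (𝓝 0) := hbt.const_div_atTop _
  have l3 : Tendsto (fun n => S n - s) atTop (𝓝 0) := by
    have := h.sub_const s
    rwa [sub_self] at this
  have := (l3.add l2).sub l1
  rw [add_zero, sub_zero] at this
  refine this.congr fun n => ?_
  rw [habel]
  have := (hpos n).ne'
  field_simp

theorem tendsto_rpow_succ_sub_rpow_div {p : ℝ} :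
    Tendsto (fun k : ℕ => (((k : ℝ) + 1) ^ p - (k : ℝ) ^ p) / (k : ℝ) ^ (p - 1)) atTop (𝓝 p) := by
  have hd : HasDerivAt (fun x : ℝ => (1 + x) ^ p) p 0 := by
    have h1 : HasDerivAt (fun x : ℝ => 1 + x) 1 0 := (hasDerivAt_id 0).const_add 1
    simpa using h1.rpow_const (p := p) (Or.inl (by norm_num))
  have h1 := hd.tendsto_slope_zero_right
  have h2 : Tendsto (fun k : ℕ => ((k : ℝ))⁻¹) atTop (𝓝[>] 0) :=
    tendsto_inv_atTop_nhdsGT_zero.comp tendsto_natCast_atTop_atTop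
  refine (h1.comp h2).congr' ?_
  filter_upwards [eventually_gt_atTop 0] with k hk
  have hk' : (0 : ℝ) < k := by exact_mod_cast hk
  have e1 : (1 + (k : ℝ)⁻¹) ^ p = ((k : ℝ) + 1) ^ p / (k : ℝ) ^ p := by
    rw [← Real.div_rpow (by positivity) hk'.le]
    congr 1
    field_simp
  have e2 : (k : ℝ) ^ p ≠ 0 := (Real.rpow_pos_of_pos hk' p).ne'
  simp only [Function.comp, smul_eq_mul, zero_add, add_zero, Real.one_rpow, inv_inv, e1]
  rw [Real.rpow_sub_one hk'.ne']
  field_simp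

/-- Averaging against the increments of `k ^ p`, which telescope and are asymptotic to `p * k ^ (p -
1)`. -/
theorem tendsto_sum_div_rpow {f : ℕ → ℝ} {p c : ℝ} (hp : 0 < p)
    (h : Tendsto (fun k : ℕ => f k / (k : ℝ) ^ (p - 1)) atTop (𝓝 c)) :
    Tendsto (fun n : ℕ => (∑ k ∈ Finset.range n, f k) / (n : ℝ) ^ p) atTop (𝓝 (c / p)) := by
  have hsum : ∀ n : ℕ, ∑ k ∈ Finset.range n, (((k : ℝ) + 1) ^ p - (k : ℝ) ^ p) = (n : ℝ) ^ p := by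
    intro n
    have := Finset.sum_range_sub (fun k : ℕ => (k : ℝ) ^ p) n
    simp only [Nat.cast_add, Nat.cast_one, Nat.cast_zero, Real.zero_rpow hp.ne', sub_zero] at this
    exact this
  have hg : ∀ k : ℕ, 0 < ((k : ℝ) + 1) ^ p - (k : ℝ) ^ p := fun k =>
    sub_pos.2 (Real.rpow_lt_rpow (by positivity) (by linarith) hp)
  have := tendsto_weighted_mean (f := f) hg (c := c / p) (by
    simp_rw [hsum]
    exact (tendsto_rpow_atTop hp).comp tendsto_natCast_atTop_atTop) (by
    refine (h.div (tendsto_rpow_succ_sub_rpow_div (p := p)) hp.ne').congr' ?_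
    filter_upwards [eventually_gt_atTop 0] with k hk
    have hk' : (0 : ℝ) < k := by exact_mod_cast hk
    have := (hg k).ne'
    have := (Real.rpow_pos_of_pos hk' (p - 1)).ne'
    simp only [Pi.div_apply]
    field_simp)
  simpa only [hsum] using this

/-- Monotonicity turns convergence of the series into a pointwise limit. On a block of length `k`,
about `m / K`, just before or after `m`, the sum is small by the Cauchy criterion, while `u` is
bounded on one side by `u m` and `c / i` hardly varies. -/
theorem tendsto_mul_of_antitone {u : ℕ → ℝ} {c l : ℝ} (hc : 0 < c) (hu : Antitone u)
    (hs : Tendsto (fun n => ∑ i ∈ Finset.range n, (u (i + 1) - c / ((i : ℝ) + 1))) atTop (𝓝 l)) :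
    Tendsto (fun m : ℕ => (m : ℝ) * u m) atTop (𝓝 c) := by
  rw [Metric.tendsto_atTop]
  intro ε hε
  -- With this `K`, and `k ≤ m / K`, both `m * (c / (m - k))` and `m * (c / (m + k))` are within `ε
  -- / 2` of `c`. The other `ε / 2` comes from the Cauchy bound `ε / (4 * K)` and `m < 2 * K * k`.
  obtain ⟨K, hK⟩ := exists_nat_gt (2 * c / ε + 2)
  have hK2 : (2 : ℝ) < K := lt_of_le_of_lt (by have : 0 ≤ 2 * c / ε := by positivity
                                               linarith) hK
  have hK2' : 2 < K := by exact_mod_cast hK2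
  have hKε : c < ε / 2 * (K - 2) := by
    have h1 : 2 * c / ε < K - 2 := by linarith
    rw [div_lt_iff₀ hε] at h1
    linarith
  obtain ⟨A, hA⟩ := Metric.cauchySeq_iff.1 hs.cauchySeq (ε / (4 * K)) (by positivity)
  refine ⟨max (2 * A + 2) K, fun m hm => ?_⟩
  have hmA : 2 * A + 2 ≤ m := (le_max_left _ _).trans hm
  have hmK : K ≤ m := (le_max_right _ _).trans hm
  set k := m / K with hk
  have hk1 : 1 ≤ k := (Nat.one_le_div_iff (by omega)).2 hmK
  have hkm : k * K ≤ m := Nat.div_mul_le_self m K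
  have hmk : m < (k + 1) * K := by
    have := Nat.lt_div_mul_add (a := m) (b := K) (by omega)
    rw [← hk] at this; linarith
  have hkm2 : 2 * k ≤ m := by nlinarith
  have hk1' : (1 : ℝ) ≤ k := by exact_mod_cast hk1
  have hkm' : (k : ℝ) * K ≤ m := by exact_mod_cast hkm
  have hmk' : (m : ℝ) < (k + 1) * K := by exact_mod_cast hmk
  have hm2k : (m : ℝ) < 2 * K * k := by nlinarith
  have hm0 : (0 : ℝ) < m := by exact_mod_cast (by omega : 0 < m)
  have key : ∀ a b, A ≤ a → a ≤ b →
      |∑ i ∈ Finset.Ico a b, (u (i + 1) - c / ((i : ℝ) + 1))| < ε / (4 * K) := by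
    intro a b ha hab
    rw [Finset.sum_Ico_eq_sub _ hab]
    have := hA b (ha.trans hab) a ha
    rwa [Real.dist_eq] at this
  have e1 : (k : ℝ) * (m * (ε / (4 * K))) / k ≤ m * (ε / (4 * K)) := by
    rw [mul_div_cancel_left₀ _ (by positivity)]
  have hmε : (m : ℝ) * (ε / (4 * K)) < k * (ε / 2) := by
    have : (0 : ℝ) < K := by linarith
    rw [mul_div_assoc', div_lt_iff₀ (by positivity)]
    nlinarith
  have up : (m : ℝ) * u m < c + ε := by
    have h1 := (abs_lt.1 (key (m - k) m (by omega) (by omega))).2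
    have h2 : ∑ i ∈ Finset.Ico (m - k) m, (u m - c / ((m : ℝ) - k)) ≤
        ∑ i ∈ Finset.Ico (m - k) m, (u (i + 1) - c / ((i : ℝ) + 1)) := by
      refine Finset.sum_le_sum fun i hi => ?_
      rw [Finset.mem_Ico] at hi
      have h3 : u m ≤ u (i + 1) := hu (by omega)
      have h4 : (m : ℝ) - k ≤ i + 1 := by
        have : m ≤ i + 1 + k := by omega
        have : (m : ℝ) ≤ i + 1 + k := by exact_mod_cast this
        linarith
      have h5 : (0 : ℝ) < m - k := by nlinarith
      have h6 : c / ((i : ℝ) + 1) ≤ c / ((m : ℝ) - k) := div_le_div_of_nonneg_left hc.le h5 h4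
      linarith
    rw [Finset.sum_const, Nat.card_Ico, Nat.sub_sub_self (by omega), nsmul_eq_mul] at h2
    have h3 : (k : ℝ) * (u m - c / (m - k)) < ε / (4 * K) := h2.trans_lt h1
    have h5 : (0 : ℝ) < m - k := by nlinarith
    have h4 : (m : ℝ) * (c / (m - k)) ≤ c + ε / 2 := by
      rw [mul_div_assoc', div_le_iff₀ h5]
      nlinarith
    have h6 : (k : ℝ) * (m * u m - m * (c / (m - k))) < k * (ε / 2) := by
      calc (k : ℝ) * (m * u m - m * (c / (m - k))) = m * (k * (u m - c / (m - k))) := by ring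
        _ < m * (ε / (4 * K)) := by gcongr
        _ < _ := hmε
    have h7 := lt_of_mul_lt_mul_left h6 (by positivity)
    linarith
  have lo : c - ε < (m : ℝ) * u m := by
    have h1 := (abs_lt.1 (key m (m + k) (by omega) (by omega))).1
    have h2 : ∑ i ∈ Finset.Ico m (m + k), (u (i + 1) - c / ((i : ℝ) + 1)) ≤
        ∑ i ∈ Finset.Ico m (m + k), (u m - c / ((m : ℝ) + k)) := by
      refine Finset.sum_le_sum fun i hi => ?_
      rw [Finset.mem_Ico] at hi
      have h3 : u (i + 1) ≤ u m := hu (by omega)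
      have h4 : (i : ℝ) + 1 ≤ m + k := by
        have : i + 1 ≤ m + k := by omega
        exact_mod_cast this
      have h6 : c / ((m : ℝ) + k) ≤ c / ((i : ℝ) + 1) :=
        div_le_div_of_nonneg_left hc.le (by positivity) h4
      linarith
    rw [Finset.sum_const, Nat.card_Ico, Nat.add_sub_cancel_left, nsmul_eq_mul] at h2
    have h3 : -(ε / (4 * K)) < (k : ℝ) * (u m - c / (m + k)) := h1.trans_le h2
    have h4 : c - ε / 2 ≤ (m : ℝ) * (c / (m + k)) := by
      rw [mul_div_assoc', le_div_iff₀ (by positivity)]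
      nlinarith
    have h6 : -(k * (ε / 2)) < (k : ℝ) * (m * u m - m * (c / (m + k))) := by
      calc -(k * (ε / 2)) < -(m * (ε / (4 * K))) := by linarith
        _ = m * -(ε / (4 * K)) := by ring
        _ < m * (k * (u m - c / (m + k))) := by gcongr
        _ = _ := by ring
    have h7 : -(ε / 2) < m * u m - m * (c / (m + k)) :=
      lt_of_mul_lt_mul_left (by rw [mul_neg]; exact h6) (by positivity : (0 : ℝ) ≤ k)
    linarith
  rw [Real.dist_eq, abs_lt]
  constructor <;> linarith

/-! ### Asymptotics of the rank and of the exponential of the threshold -/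

section rank

variable {r : ℕ → ℕ} {α : ℝ}

theorem tendsto_sum_rho (hsum : Summable fun m : ℕ =>
      |1 / (r (m + 1) : ℝ) - 1 / (α * ((m + 1 : ℕ) : ℝ))|) :
    Tendsto (fun n => ∑ i ∈ Finset.range n,
      (1 / (r (i + 1) : ℝ) - 1 / (α * ((i + 1 : ℕ) : ℝ)))) atTop (𝓝 (rho r α)) :=
  (summable_abs_iff.1 hsum).hasSum.tendsto_sum_nat

/-- The reciprocal of `r` is antitone, so the Tauberian lemma applies to it with `c = 1 / α`. -/
theorem tendsto_rank_div (hr : IsRankSequence r) (hα0 : 0 < α) (hsum : Summable fun m : ℕ =>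
      |1 / (r (m + 1) : ℝ) - 1 / (α * ((m + 1 : ℕ) : ℝ))|) :
    Tendsto (fun m : ℕ => (r m : ℝ) / m) atTop (𝓝 α) := by
  have h := tendsto_mul_of_antitone (u := fun m => 1 / (r m : ℝ)) (c := 1 / α) (l := rho r α)
    (by positivity) (fun a b hab => by
      have := hr.pos a
      have h2 := hr.monotone hab
      exact one_div_le_one_div_of_le (by positivity) (by exact_mod_cast h2)) (by
    refine (tendsto_sum_rho hsum).congr fun n => Finset.sum_congr rfl fun i _ => ?_
    rw [div_div]; push_cast; rfl)
  have h2 := h.inv₀ (by positivity)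
  rw [one_div, inv_inv] at h2
  refine h2.congr fun m => ?_
  rw [mul_one_div, inv_div]

/-- Each index with `δ_k = 0` raises the rank by one, so these terms of `∑ 1 / r k` add up to
`harmonic (r m) - 1`; the `1` is due to `r 0 = 1`. -/
theorem sum_delta_div (hr : IsRankSequence r) (α : ℝ) (m : ℕ) :
    ∑ k ∈ Finset.Icc 1 m, delta r k / (r k : ℝ) =
      ∑ i ∈ Finset.range m, (1 / (r (i + 1) : ℝ) - 1 / (α * ((i + 1 : ℕ) : ℝ))) +
        (harmonic m : ℝ) / α - harmonic (r m) + 1 := by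
  induction m with
  | zero => simp [hr.1, harmonic]
  | succ m ih =>
    have e : 1 / (α * ((m : ℝ) + 1)) = ((m : ℝ) + 1)⁻¹ / α := by rw [one_div, mul_inv]; ring
    rw [Finset.sum_Icc_succ_top (by omega), ih, Finset.sum_range_succ, harmonic_succ, delta,
      Nat.add_sub_cancel]
    rcases (show r (m + 1) = r m ∨ r (m + 1) = r m + 1 by have := hr.2 m; omega) with h | h
    · rw [if_pos h, h]
      push_cast
      rw [e]
      ring
    · rw [if_neg (by omega), h, harmonic_succ]
      push_cast
      rw [e]
      ring

theorem tendsto_rank_atTop (hr : IsRankSequence r) (hα0 : 0 < α) (hsum : Summable fun m : ℕ =>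
      |1 / (r (m + 1) : ℝ) - 1 / (α * ((m + 1 : ℕ) : ℝ))|) : Tendsto r atTop atTop := by
  have h := (tendsto_rank_div hr hα0 hsum).pos_mul_atTop hα0 tendsto_natCast_atTop_atTop
  rw [← tendsto_natCast_atTop_iff (R := ℝ)]
  refine h.congr' ?_
  filter_upwards [eventually_gt_atTop 0] with m hm
  have : (m : ℝ) ≠ 0 := by positivity
  field_simp

/-- Euler's constant enters twice, from the harmonic numbers at `m` and at `r m`; `log α` is the
limit of `log (r m / m)`. -/
theorem tendsto_sum_delta_div_sub_log (hr : IsRankSequence r) (hα0 : 0 < α)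
    (hsum : Summable fun m : ℕ => |1 / (r (m + 1) : ℝ) - 1 / (α * ((m + 1 : ℕ) : ℝ))|) :
    Tendsto (fun m : ℕ => ∑ k ∈ Finset.Icc 1 m, delta r k / (r k : ℝ) - (1 / α - 1) * Real.log m)
      atTop (𝓝 (rho r α + (1 / α - 1) * Real.eulerMascheroniConstant - Real.log α + 1)) := by
  have h1 := tendsto_sum_rho hsum
  have h2 := Real.tendsto_harmonic_sub_log
  have h3 := h2.comp (tendsto_rank_atTop hr hα0 hsum)
  have h4 := ((Real.continuousAt_log hα0.ne').tendsto.comp (tendsto_rank_div hr hα0 hsum))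
  have h5 := (((h1.add (h2.div_const α)).sub h3).sub h4).add_const 1
  have e : rho r α + (1 / α - 1) * Real.eulerMascheroniConstant - Real.log α + 1 =
    rho r α + Real.eulerMascheroniConstant / α - Real.eulerMascheroniConstant - Real.log α + 1 := by
    ring
  rw [e]
  refine h5.congr' ?_
  filter_upwards [eventually_gt_atTop 0] with m hm
  have hm' : (m : ℝ) ≠ 0 := by positivity
  have hrm : (r m : ℝ) ≠ 0 := by have := hr.pos m; positivity
  simp only [Function.comp]
  rw [sum_delta_div hr α, Real.log_div hrm hm']
  ring

/-- The constant `C` in `e^{Y_m} ∼ C m^{1/α - 1}`, on the event `Z = z`. -/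
noncomputable def expConst (r : ℕ → ℕ) (α z : ℝ) : ℝ :=
  Real.exp (rho r α + (1 / α - 1) * Real.eulerMascheroniConstant - Real.log α + 1 + z)

theorem tendsto_exp_div_rpow (hr : IsRankSequence r) (hα0 : 0 < α)
    (hsum : Summable fun m : ℕ => |1 / (r (m + 1) : ℝ) - 1 / (α * ((m + 1 : ℕ) : ℝ))|)
    {y Z : ℕ → ℝ} {z : ℝ} (hZ : Tendsto Z atTop (𝓝 z))
    (hy : ∀ m, y m = ∑ k ∈ Finset.Icc 1 m, delta r k / (r k : ℝ) + Z m) :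
    Tendsto (fun m : ℕ => Real.exp (y m) / (m : ℝ) ^ (1 / α - 1)) atTop (𝓝 (expConst r α z)) := by
  have h := Real.continuous_exp.continuousAt.tendsto.comp
    ((tendsto_sum_delta_div_sub_log hr hα0 hsum).add hZ)
  refine h.congr' ?_
  filter_upwards [eventually_gt_atTop 0] with m hm
  have hm' : (0 : ℝ) < m := by positivity
  rw [Real.rpow_def_of_pos hm', ← Real.exp_sub, hy]
  simp only [Function.comp]
  congr 1
  ring

theorem W_eq (r : ℕ → ℕ) (hα0 : 0 < α) (z : ℝ) : W r α z = (α * expConst r α z) ^ (-α) := by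
  have h : α * expConst r α z =
      Real.exp (rho r α + (1 / α - 1) * Real.eulerMascheroniConstant + 1 + z) := by
    rw [expConst]
    nth_rw 1 [← Real.exp_log hα0]
    rw [← Real.exp_add]
    congr 1
    ring
  rw [h, ← Real.exp_mul, W, ← Real.exp_add]
  congr 1
  field_simp
  ring

end rank

/-! ### From thresholds to the growth of the count: deterministic part -/

section growth

variable {m : ℕ → ℕ} {y : ℕ → ℝ}

/-- The weight turns the `i`-th term into `exp (y (m i))` times the increment of the count, minus
`1`. Thus `exp (y k)` is collected once, when the count leaves level `k`. -/
theorem sum_mul_eq (h0 : m 0 = 0) (hm : ∀ n, m (n + 1) = m n ∨ m (n + 1) = m n + 1) (n : ℕ) :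
    ∑ i ∈ Finset.range n, (((m i : ℝ) + 1) * Real.exp (y (m i))) *
      (((m (i + 1) : ℝ) - m i - Real.exp (-y (m i))) / ((m i : ℝ) + 1)) =
      ∑ k ∈ Finset.range (m n), Real.exp (y k) - n := by
  induction n with
  | zero => simp [h0]
  | succ n ih =>
    rw [Finset.sum_range_succ, ih]
    have hp : (m n : ℝ) + 1 ≠ 0 := by positivity
    have he : Real.exp (y (m n)) * Real.exp (-y (m n)) = 1 := by
      rw [← Real.exp_add, add_neg_cancel, Real.exp_zero]
    have e : (((m n : ℝ) + 1) * Real.exp (y (m n))) *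
      (((m (n + 1) : ℝ) - m n - Real.exp (-y (m n))) / ((m n : ℝ) + 1)) =
      Real.exp (y (m n)) * ((m (n + 1) : ℝ) - m n) - Real.exp (y (m n)) * Real.exp (-y (m n)) := by
      field_simp
    rw [e, he]
    rcases hm n with h | h
    · rw [h]; push_cast; ring
    · rw [h, Finset.sum_range_succ]; push_cast; ring

/-- If the count froze at `b`, the terms of the series would be eventually equal to a nonzero
constant. -/
theorem tendsto_atTop_of_sum_tendsto (hm : ∀ n, m (n + 1) = m n ∨ m (n + 1) = m n + 1) {s : ℝ}
    (hs : Tendsto (fun n => ∑ i ∈ Finset.range n,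
      ((m (i + 1) : ℝ) - m i - Real.exp (-y (m i))) / ((m i : ℝ) + 1)) atTop (𝓝 s)) :
    Tendsto m atTop atTop := by
  have hmono : Monotone m := monotone_nat_of_le_succ fun n => by have := hm n; omega
  refine tendsto_atTop_atTop_of_monotone hmono fun b => ?_
  induction b with
  | zero => exact ⟨0, Nat.zero_le _⟩
  | succ b ih =>
    obtain ⟨a, ha⟩ := ih
    by_contra! hcon
    have hconst : ∀ n, a ≤ n → m n = b := fun n hn => by
      have := hmono hn
      have := hcon n
      omega
    have hz : Tendsto (fun n => ((m (n + 1) : ℝ) - m n - Real.exp (-y (m n))) / ((m n : ℝ) + 1))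
        atTop (𝓝 0) := by
      have := ((tendsto_add_atTop_iff_nat 1).2 hs).sub hs
      rw [sub_self] at this
      refine this.congr fun n => ?_
      rw [Finset.sum_range_succ]; ring
    have hc : Tendsto (fun n => ((m (n + 1) : ℝ) - m n - Real.exp (-y (m n))) / ((m n : ℝ) + 1))
        atTop (𝓝 (-Real.exp (-y b) / ((b : ℝ) + 1))) := by
      refine tendsto_const_nhds.congr' ?_
      filter_upwards [eventually_ge_atTop a] with n hn
      rw [hconst n hn, hconst (n + 1) (by omega)]
      ring
    have h1 := tendsto_nhds_unique hz hc
    have h2 : 0 < Real.exp (-y b) / ((b : ℝ) + 1) := by positivity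
    rw [neg_div] at h1
    linarith

theorem tendsto_div_rpow_of_sum_tendsto (h0 : m 0 = 0)
    (hm : ∀ n, m (n + 1) = m n ∨ m (n + 1) = m n + 1) (hy : Monotone fun n => y (m n)) {s : ℝ}
    (hs : Tendsto (fun n => ∑ i ∈ Finset.range n,
      ((m (i + 1) : ℝ) - m i - Real.exp (-y (m i))) / ((m i : ℝ) + 1)) atTop (𝓝 s))
    {α C : ℝ} (hα0 : 0 < α)
    (hexp : Tendsto (fun k : ℕ => Real.exp (y k) / (k : ℝ) ^ (1 / α - 1)) atTop (𝓝 C)) :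
    Tendsto (fun n : ℕ => (n : ℝ) / (m n : ℝ) ^ (1 / α)) atTop (𝓝 (α * C)) := by
  have hmt := tendsto_atTop_of_sum_tendsto hm hs
  have hmono : Monotone m := monotone_nat_of_le_succ fun n => by have := hm n; omega
  have hb : Monotone fun n => ((m n : ℝ) + 1) * Real.exp (y (m n)) := by
    intro a b hab
    have h1 : (m a : ℝ) ≤ m b := by exact_mod_cast hmono hab
    have h2 : y (m a) ≤ y (m b) := hy hab
    dsimp only
    gcongr
  have hbt : Tendsto (fun n => ((m n : ℝ) + 1) * Real.exp (y (m n))) atTop atTop := by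
    have h1 : Tendsto (fun n => ((m n : ℝ) + 1)) atTop atTop :=
      tendsto_atTop_add_const_right _ _ (tendsto_natCast_atTop_atTop.comp hmt)
    have h2 := h1.atTop_mul_const (Real.exp_pos (y (m 0)))
    refine tendsto_atTop_mono (fun n => ?_) h2
    have h3 : y (m 0) ≤ y (m n) := hy (Nat.zero_le n)
    gcongr
  have hk := tendsto_kronecker hb (by positivity) hbt hs
  simp_rw [sum_mul_eq h0 hm] at hk
  have hS := (tendsto_sum_div_rpow (p := 1 / α) (by positivity) hexp).comp hmt
  have hB : Tendsto (fun n => ((m n : ℝ) + 1) * Real.exp (y (m n)) / (m n : ℝ) ^ (1 / α)) atTop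
      (𝓝 C) := by
    have h1 : Tendsto (fun k : ℕ => ((k : ℝ) + 1) / k * (Real.exp (y k) / (k : ℝ) ^ (1 / α - 1)))
        atTop (𝓝 (1 * C)) := by
      refine Tendsto.mul ?_ hexp
      have : Tendsto (fun k : ℕ => 1 + 1 / (k : ℝ)) atTop (𝓝 (1 + 0)) :=
        tendsto_one_div_atTop_nhds_zero_nat.const_add 1
      rw [add_zero] at this
      refine this.congr' ?_
      filter_upwards [eventually_gt_atTop 0] with k hk
      have : (k : ℝ) ≠ 0 := by positivity
      field_simp
    rw [one_mul] at h1
    refine (h1.comp hmt).congr' ?_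
    filter_upwards [hmt.eventually_gt_atTop 0] with n hn
    have h : (0 : ℝ) < m n := by exact_mod_cast hn
    have h' := (Real.rpow_pos_of_pos h (1 / α)).ne'
    simp only [Function.comp]
    rw [Real.rpow_sub_one h.ne']
    field_simp
  -- By `sum_mul_eq`, `n` is the sum of `exp (y k)` over `k < m n` minus the Kronecker sum, which is
  -- `o(1)` times a weight of order `(m n) ^ (1 / α)`.
  have := hS.sub (hk.mul hB)
  rw [zero_mul, sub_zero, one_div, div_inv_eq_mul, mul_comm C, ← one_div] at this
  refine this.congr' ?_
  filter_upwards [hmt.eventually_gt_atTop 0] with n hn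
  have h : (0 : ℝ) < m n := by exact_mod_cast hn
  have h' := (Real.rpow_pos_of_pos h (1 / α)).ne'
  have h2 : ((m n : ℝ) + 1) * Real.exp (y (m n)) ≠ 0 := by positivity
  simp only [Function.comp]
  field_simp
  ring

theorem tendsto_div_rpow_of_tendsto_inv {α D : ℝ} (hα0 : 0 < α) (hD : 0 < D)
    (h : Tendsto (fun n : ℕ => (n : ℝ) / (m n : ℝ) ^ (1 / α)) atTop (𝓝 D)) :
    Tendsto (fun n : ℕ => (m n : ℝ) / (n : ℝ) ^ α) atTop (𝓝 (D ^ (-α))) := by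
  refine (h.rpow_const (p := -α) (Or.inl hD.ne')).congr fun n => ?_
  rw [Real.div_rpow (by positivity) (by positivity), ← Real.rpow_mul (by positivity),
    Real.rpow_neg (by positivity)]
  have : 1 / α * -α = -1 := by field_simp
  rw [this, Real.rpow_neg_one]
  rw [div_eq_mul_inv, inv_inv, mul_comm, div_eq_mul_inv]

/-- Candidate `n + 1` faces the threshold of level `m n`, but the comparison is with `m (n + 1)`;
the ratio of consecutive counts tends to one. -/
theorem tendsto_exp_neg_div (hm : ∀ n, m (n + 1) = m n ∨ m (n + 1) = m n + 1)
    (hmt : Tendsto m atTop atTop) {α C : ℝ} (hα0 : 0 < α) (hC : 0 < C)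
    (hexp : Tendsto (fun k : ℕ => Real.exp (y k) / (k : ℝ) ^ (1 / α - 1)) atTop (𝓝 C))
    (h : Tendsto (fun n : ℕ => (n : ℝ) / (m n : ℝ) ^ (1 / α)) atTop (𝓝 (α * C))) :
    Tendsto (fun n : ℕ => Real.exp (-y (m n)) / (α * (m (n + 1) : ℝ) / ((n + 1 : ℕ) : ℝ))) atTop
      (𝓝 1) := by
  have hmt' : Tendsto (fun n => (m n : ℝ)) atTop atTop := tendsto_natCast_atTop_atTop.comp hmt
  have hq : Tendsto (fun n => (m (n + 1) : ℝ) / m n) atTop (𝓝 1) := by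
    have h1 : Tendsto (fun n => 1 + 1 / (m n : ℝ)) atTop (𝓝 (1 + 0)) :=
      (hmt'.const_div_atTop 1).const_add 1
    rw [add_zero] at h1
    refine tendsto_of_tendsto_of_tendsto_of_le_of_le' tendsto_const_nhds h1 ?_ ?_
    all_goals
      filter_upwards [hmt.eventually_gt_atTop 0] with n hn
      have hn' : (0 : ℝ) < m n := by exact_mod_cast hn
    · rw [le_div_iff₀ hn', one_mul]
      have := hm n
      exact_mod_cast (by omega : m n ≤ m (n + 1))
    · rw [div_le_iff₀ hn', add_mul, one_div_mul_cancel hn'.ne', one_mul]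
      have := hm n
      exact_mod_cast (by omega : m (n + 1) ≤ m n + 1)
  have h1 := (hexp.comp hmt).inv₀ hC.ne'
  have h2 := (tendsto_add_atTop_iff_nat 1).2 h
  have h3 := hq.rpow_const (p := 1 / α - 1) (Or.inl one_ne_zero)
  have h4 := (((h1.mul h2).mul h3).div_const α)
  have e : C⁻¹ * (α * C) * (1 : ℝ) ^ (1 / α - 1) / α = 1 := by
    rw [Real.one_rpow]; field_simp
  rw [e] at h4
  refine h4.congr' ?_
  filter_upwards [hmt.eventually_gt_atTop 0, ((tendsto_add_atTop_iff_nat 1).2 hmt).eventually_gt_atTop 0]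
    with n hn hn'
  have hn : (0 : ℝ) < m n := by exact_mod_cast hn
  have hn' : (0 : ℝ) < m (n + 1) := by exact_mod_cast hn'
  simp only [Function.comp]
  rw [Real.div_rpow hn'.le hn.le, Real.rpow_sub_one hn.ne', Real.rpow_sub_one hn'.ne', Real.exp_neg]
  have := (Real.rpow_pos_of_pos hn (1 / α)).ne'
  have := (Real.rpow_pos_of_pos hn' (1 / α)).ne'
  field_simp

end growth

/-! ### The exponential law and its lack of memory -/

section exponential

theorem expMeasure_Ioi {t : ℝ} (ht : 0 ≤ t) :
    expMeasure 1 (Set.Ioi t) = ENNReal.ofReal (Real.exp (-t)) := by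
  have h1 : (expMeasure 1).real (Set.Iic t) = 1 - Real.exp (-t) := by
    rw [← cdf_eq_real, cdf_expMeasure_eq one_pos, if_pos ht, one_mul]
  have h2 : (expMeasure 1).real (Set.Ioi t) = Real.exp (-t) := by
    rw [← Set.compl_Iic, probReal_compl_eq_one_sub measurableSet_Iic, h1]; ring
  rw [← h2, measureReal_def, ENNReal.ofReal_toReal (measure_ne_top _ _)]

theorem eq_expMeasure {ν : Measure ℝ} [IsProbabilityMeasure ν]
    (h : ∀ t, 0 ≤ t → ν (Set.Ioi t) = ENNReal.ofReal (Real.exp (-t))) : ν = expMeasure 1 := by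
  have key : ∀ (κ : Measure ℝ) [IsProbabilityMeasure κ],
      (∀ t, 0 ≤ t → κ (Set.Ioi t) = ENNReal.ofReal (Real.exp (-t))) →
      ∀ a, κ (Set.Ioi a) = ENNReal.ofReal (Real.exp (-(max a 0))) := by
    intro κ _ hκ a
    rcases le_total 0 a with ha | ha
    · rw [max_eq_left ha, hκ a ha]
    · rw [max_eq_right ha]
      refine le_antisymm (by simpa using prob_le_one) ?_
      rw [← hκ 0 le_rfl]
      exact measure_mono (Set.Ioi_subset_Ioi ha)
  refine Measure.ext_of_Iic _ _ fun a => ?_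
  rw [← Set.compl_Ioi, prob_compl_eq_one_sub measurableSet_Ioi,
    prob_compl_eq_one_sub measurableSet_Ioi, key ν h, key _ fun t => expMeasure_Ioi]

/-- Lack of memory: the normalised law of `x - s` on `s < x` has exponential tails, hence equals
`expMeasure 1`. -/
theorem expMeasure_Ioi_inter_preimage_sub {s : ℝ} (hs : 0 ≤ s) {B : Set ℝ} (hB : MeasurableSet B) :
    expMeasure 1 (Set.Ioi s ∩ (fun x => x - s) ⁻¹' B) =
      ENNReal.ofReal (Real.exp (-s)) * expMeasure 1 B := by
  have hm : Measurable fun x : ℝ => x - s := measurable_id.sub_const s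
  have happ : ∀ B : Set ℝ, MeasurableSet B →
      (ENNReal.ofReal (Real.exp s) • ((expMeasure 1).restrict (Set.Ioi s)).map fun x => x - s) B =
      ENNReal.ofReal (Real.exp s) * expMeasure 1 (Set.Ioi s ∩ (fun x => x - s) ⁻¹' B) := by
    intro B hB
    rw [Measure.smul_apply, Measure.map_apply hm hB, Measure.restrict_apply (hm hB), smul_eq_mul,
      Set.inter_comm]
  have hIoi : ∀ t, 0 ≤ t → Set.Ioi s ∩ (fun x => x - s) ⁻¹' Set.Ioi t = Set.Ioi (t + s) := by
    intro t ht
    ext x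
    simp only [Set.mem_inter_iff, Set.mem_Ioi, Set.mem_preimage]
    constructor
    · rintro ⟨_, h⟩; linarith
    · intro h; constructor <;> linarith
  have : IsProbabilityMeasure
      (ENNReal.ofReal (Real.exp s) • ((expMeasure 1).restrict (Set.Ioi s)).map fun x => x - s) := by
    constructor
    rw [happ _ MeasurableSet.univ, Set.preimage_univ, Set.inter_univ, expMeasure_Ioi hs,
      ← ENNReal.ofReal_mul (Real.exp_pos _).le, ← Real.exp_add]
    simp
  have heq := eq_expMeasure
    (ν := ENNReal.ofReal (Real.exp s) • ((expMeasure 1).restrict (Set.Ioi s)).map fun x => x - s)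
    (fun t ht => by
      rw [happ _ measurableSet_Ioi, hIoi t ht, expMeasure_Ioi (by linarith),
        ← ENNReal.ofReal_mul (Real.exp_pos _).le, ← Real.exp_add]
      congr 2; ring)
  nth_rw 2 [← heq]
  rw [happ _ hB, ← mul_assoc, ← ENNReal.ofReal_mul (Real.exp_pos _).le, ← Real.exp_add]
  simp

theorem expMeasure_eq_withDensity : expMeasure 1 =
    (volume.restrict (Set.Ioi 0)).withDensity fun x => ENNReal.ofReal (Real.exp (-x)) := by
  rw [← withDensity_indicator measurableSet_Ioi]
  refine withDensity_congr_ae ?_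
  have h0 : ∀ᵐ x : ℝ, x ≠ 0 := by simp [ae_iff]
  filter_upwards [h0] with x hx
  change exponentialPDF 1 x = _
  rw [exponentialPDF_eq]
  rcases lt_or_gt_of_ne hx with h | h
  · rw [if_neg (not_le.2 h), Set.indicator_of_notMem (by simpa using h.le), ENNReal.ofReal_zero]
  · rw [if_pos h.le, Set.indicator_of_mem (by simpa using h), one_mul, one_mul]

theorem integrable_expMeasure_iff {f : ℝ → ℝ} :
    Integrable f (expMeasure 1) ↔ IntegrableOn (fun x => Real.exp (-x) * f x) (Set.Ioi 0) := by
  rw [expMeasure_eq_withDensity, integrable_withDensity_iff_integrable_smul' (by fun_prop) (by simp)]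
  simp only [ENNReal.toReal_ofReal (Real.exp_pos _).le, smul_eq_mul]
  rfl

theorem integral_expMeasure (f : ℝ → ℝ) :
    ∫ x, f x ∂expMeasure 1 = ∫ x in Set.Ioi 0, Real.exp (-x) * f x := by
  rw [expMeasure_eq_withDensity,
    integral_withDensity_eq_integral_toReal_smul (by fun_prop) (by simp)]
  simp only [ENNReal.toReal_ofReal (Real.exp_pos _).le, smul_eq_mul]

theorem memLp_sub_one_expMeasure : MemLp (fun x : ℝ => x - 1) 2 (expMeasure 1) := by
  have h : MemLp (fun x : ℝ => x) 2 (expMeasure 1) := by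
    rw [memLp_two_iff_integrable_sq (by fun_prop), integrable_expMeasure_iff]
    have := Real.GammaIntegral_convergent (s := 3) (by norm_num)
    refine this.congr_fun (fun x hx => ?_) measurableSet_Ioi
    norm_num
  exact h.sub (memLp_const 1)

theorem integral_sub_one_expMeasure : ∫ x, (x - 1) ∂expMeasure 1 = 0 := by
  have h : MemLp (fun x : ℝ => x) 2 (expMeasure 1) := by
    have := memLp_sub_one_expMeasure.add (memLp_const (1 : ℝ))
    exact this.ae_eq (ae_of_all _ fun x => by simp)
  have h1 : ∫ x, x ∂expMeasure 1 = 1 := by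
    rw [integral_expMeasure, ← Real.Gamma_two, Real.Gamma_eq_integral (by norm_num)]
    refine setIntegral_congr_fun measurableSet_Ioi fun x hx => ?_
    norm_num
  rw [integral_sub (h.integrable (by norm_num)) (integrable_const _), h1]
  simp

theorem ae_pos_expMeasure : ∀ᵐ x ∂expMeasure 1, 0 < x := by
  have h : expMeasure 1 (Set.Ioi 0) = 1 := by rw [expMeasure_Ioi le_rfl]; simp
  exact (prob_compl_eq_zero_iff measurableSet_Ioi).2 h

instance nullSingletonClass_expMeasure_one : NullSingletonClass (expMeasure 1) := by
  rw [expMeasure_eq_withDensity]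
  infer_instance

/-- Lack of memory in all coordinates of `S` at once: the normalised image of the restricted measure
is recognised as the product measure by its values on boxes. -/
theorem infinitePi_expMeasure_shift (S : Finset ℕ) {s : ℝ} (hs : 0 ≤ s) {C : Set (ℕ → ℝ)}
    (hC : MeasurableSet C) :
    Measure.infinitePi (fun _ : ℕ => expMeasure 1)
      {u | (∀ i ∈ S, s < u i) ∧ (fun i => if i ∈ S then u i - s else u i) ∈ C} =
    ENNReal.ofReal (Real.exp (-s)) ^ S.card *
      Measure.infinitePi (fun _ : ℕ => expMeasure 1) C := by
  classical
  set π := Measure.infinitePi (fun _ : ℕ => expMeasure 1)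
  set σ : (ℕ → ℝ) → ℕ → ℝ := fun u i => if i ∈ S then u i - s else u i with hσ
  have hσm : Measurable σ := by
    refine measurable_pi_lambda _ fun i => ?_
    by_cases hi : i ∈ S
    · simp only [hσ, hi, if_true]; fun_prop
    · simp only [hσ, hi, if_false]; fun_prop
  have hD : MeasurableSet {u : ℕ → ℝ | ∀ i ∈ S, s < u i} := by
    have : {u : ℕ → ℝ | ∀ i ∈ S, s < u i} = ⋂ i ∈ S, (fun u => u i) ⁻¹' Set.Ioi s := by
      ext u; simp
    rw [this]
    exact S.measurableSet_biInter fun i _ => measurable_pi_apply i measurableSet_Ioi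
  have hc0 : ENNReal.ofReal (Real.exp (-s)) ≠ 0 := by simpa using Real.exp_pos _
  have hct : ENNReal.ofReal (Real.exp (-s)) ≠ ⊤ := ENNReal.ofReal_ne_top
  have heq : (ENNReal.ofReal (Real.exp (-s)) ^ S.card)⁻¹ •
      (π.restrict {u | ∀ i ∈ S, s < u i}).map σ = π := by
    refine Measure.eq_infinitePi _ fun F t ht => ?_
    -- Padding with `univ` allows the box to be indexed by `F ∪ S`, so the constraint on `S` merges
    -- into its sides.
    set t' : ℕ → Set ℝ := fun i => if i ∈ F then t i else Set.univ with ht'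
    have ht'm : ∀ i, MeasurableSet (t' i) := fun i => by
      simp only [ht']; split_ifs
      exacts [ht i, MeasurableSet.univ]
    have hFS : Set.pi (F : Set ℕ) t = Set.pi ((F ∪ S : Finset ℕ) : Set ℕ) t' := by
      ext u
      simp only [Set.mem_pi, Finset.mem_coe, Finset.mem_union, ht']
      constructor
      · intro h i _
        split_ifs with hi
        exacts [h i hi, trivial]
      · intro h i hi
        simpa [hi] using h i (Or.inl hi)
    have hprod : ∏ i ∈ F, expMeasure 1 (t i) = ∏ i ∈ F ∪ S, expMeasure 1 (t' i) := by
      rw [← Finset.prod_subset (Finset.subset_union_left (s₁ := F) (s₂ := S))]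
      · exact Finset.prod_congr rfl fun i hi => by simp [ht', hi]
      · intro i _ hi
        simp [ht', hi]
    have hpm : MeasurableSet (Set.pi (F : Set ℕ) t) :=
      MeasurableSet.pi F.countable_toSet fun i _ => ht i
    rw [Measure.smul_apply, Measure.map_apply hσm hpm, Measure.restrict_apply (hσm hpm), hprod, hFS]
    have hset : σ ⁻¹' Set.pi ((F ∪ S : Finset ℕ) : Set ℕ) t' ∩ {u | ∀ i ∈ S, s < u i} =
        Set.pi ((F ∪ S : Finset ℕ) : Set ℕ)
          (fun i => if i ∈ S then Set.Ioi s ∩ (fun x => x - s) ⁻¹' t' i else t' i) := by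
      ext u
      simp only [Set.mem_inter_iff, Set.mem_preimage, Set.mem_pi, Set.mem_ofPred_eq, hσ,
        Finset.mem_coe, Finset.mem_union]
      constructor
      · rintro ⟨h1, h2⟩ i hi
        have := h1 i hi
        split_ifs with hiS
        · rw [if_pos hiS] at this
          exact ⟨h2 i hiS, this⟩
        · rwa [if_neg hiS] at this
      · intro h
        refine ⟨fun i hi => ?_, fun i hi => ?_⟩
        · have := h i hi
          split_ifs with hiS
          · rw [if_pos hiS] at this
            exact this.2
          · rwa [if_neg hiS] at this
        · have := h i (Or.inr hi)
          rw [if_pos hi] at this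
          exact this.1
    have hm1 : ∀ i, MeasurableSet
        (if i ∈ S then Set.Ioi s ∩ (fun x => x - s) ⁻¹' t' i else t' i) := fun i => by
      split_ifs
      · exact measurableSet_Ioi.inter ((measurable_id.sub_const s) (ht'm i))
      · exact ht'm i
    rw [hset, Measure.infinitePi_pi _ fun i _ => hm1 i]
    have hterm : ∀ i, expMeasure 1
        (if i ∈ S then Set.Ioi s ∩ (fun x => x - s) ⁻¹' t' i else t' i) =
        (if i ∈ S then ENNReal.ofReal (Real.exp (-s)) else 1) * expMeasure 1 (t' i) := fun i => by
      split_ifs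
      · exact expMeasure_Ioi_inter_preimage_sub hs (ht'm i)
      · rw [one_mul]
    simp_rw [hterm]
    rw [Finset.prod_mul_distrib, Finset.prod_ite_mem, Finset.inter_eq_right.2
      Finset.subset_union_right, Finset.prod_const, smul_eq_mul, ← mul_assoc,
      ENNReal.inv_mul_cancel (pow_ne_zero _ hc0) (ENNReal.pow_ne_top hct), one_mul]
  have h1 := congrArg (fun κ => κ C) heq
  rw [Measure.smul_apply, Measure.map_apply hσm hC, Measure.restrict_apply (hσm hC),
    smul_eq_mul] at h1
  rw [← h1, ← mul_assoc, ENNReal.mul_inv_cancel (pow_ne_zero _ hc0) (ENNReal.pow_ne_top hct),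
    one_mul, Set.inter_comm]
  rfl

end exponential

/-! ### Martingale convergence, convergence in distribution, a conditional probability -/

section general

variable {Ω : Type*} {mΩ : MeasurableSpace Ω} {μ : Measure Ω}

/-- The differences are orthogonal, so the variances add up to at most `C`; with `|s| ≤ 1 + s²` this
bounds the martingale in L¹, and the convergence theorem applies. -/
theorem ae_exists_tendsto_sum_of_condExp_eq_zero [IsProbabilityMeasure μ] {𝓕 : Filtration ℕ mΩ}
    {ξ : ℕ → Ω → ℝ} (hadp : ∀ n, StronglyMeasurable[𝓕 (n + 1)] (ξ n))
    (hL2 : ∀ n, MemLp (ξ n) 2 μ) (hce : ∀ n, μ[ξ n | 𝓕 n] =ᵐ[μ] 0) {C : ℝ}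
    (hC : ∀ n, ∑ i ∈ Finset.range n, ∫ ω, ξ i ω ^ 2 ∂μ ≤ C) :
    ∀ᵐ ω ∂μ, ∃ s, Tendsto (fun n => ∑ i ∈ Finset.range n, ξ i ω) atTop (𝓝 s) := by
  set S : ℕ → Ω → ℝ := fun n ω => ∑ i ∈ Finset.range n, ξ i ω with hS
  have hsucc : ∀ n, S (n + 1) = S n + ξ n := fun n => by
    ext ω; simp [hS, Finset.sum_range_succ]
  have hSm : ∀ n, StronglyMeasurable[𝓕 n] (S n) := fun n => by
    refine Finset.stronglyMeasurable_fun_sum _ fun i hi => ?_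
    exact (hadp i).mono (𝓕.mono (by rw [Finset.mem_range] at hi; omega))
  have hSL : ∀ n, MemLp (S n) 2 μ := fun n => memLp_finsetSum _ fun i _ => hL2 i
  have hSξ : ∀ n, ∫ ω, S n ω * ξ n ω ∂μ = 0 := fun n => by
    have hint : Integrable (S n * ξ n) μ := (hSL n).integrable_mul (hL2 n)
    have h1 := condExp_mul_of_stronglyMeasurable_left (hSm n) hint
      ((hL2 n).integrable (by norm_num))
    have h2 : μ[S n * ξ n | 𝓕 n] =ᵐ[μ] 0 := by
      filter_upwards [h1, hce n] with ω h1 h2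
      rw [h1, Pi.mul_apply, h2]; simp
    have h3 := integral_condExp (𝓕.le n) (f := S n * ξ n) (μ := μ)
    rw [integral_congr_ae h2] at h3
    simpa using h3.symm
  have hsq : ∀ n, ∫ ω, S n ω ^ 2 ∂μ = ∑ i ∈ Finset.range n, ∫ ω, ξ i ω ^ 2 ∂μ := fun n => by
    induction n with
    | zero => simp [hS]
    | succ n ih =>
      rw [Finset.sum_range_succ, ← ih]
      have e : ∀ ω, S (n + 1) ω ^ 2 = S n ω ^ 2 + 2 * (S n ω * ξ n ω) + ξ n ω ^ 2 := fun ω => by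
        rw [hsucc, Pi.add_apply]; ring
      simp_rw [e]
      have i1 : Integrable (fun ω => S n ω ^ 2) μ := (hSL n).integrable_sq
      have i2 : Integrable (fun ω => 2 * (S n ω * ξ n ω)) μ :=
        ((hSL n).integrable_mul (hL2 n)).const_mul 2
      have i3 : Integrable (fun ω => ξ n ω ^ 2) μ := (hL2 n).integrable_sq
      rw [integral_add (by exact i1.add i2) i3, integral_add i1 i2, integral_const_mul, hSξ]
      ring
  have hmart : Martingale S 𝓕 μ := by
    refine martingale_of_condExp_sub_eq_zero_nat hSm (fun n => (hSL n).integrable (by norm_num))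
      fun n => ?_
    have : S (n + 1) - S n = ξ n := by rw [hsucc]; simp
    rw [this]
    exact hce n
  have hbdd : ∀ n, eLpNorm (S n) 1 μ ≤ ((1 + C).toNNReal : ENNReal) := fun n => by
    have hi : Integrable (S n) μ := (hSL n).integrable (by norm_num)
    rw [eLpNorm_one_eq_lintegral_enorm, ← ofReal_integral_norm_eq_lintegral_enorm hi]
    refine ENNReal.ofReal_le_ofReal ?_
    calc ∫ ω, ‖S n ω‖ ∂μ ≤ ∫ ω, (1 + S n ω ^ 2) ∂μ := by
          refine integral_mono hi.norm ((integrable_const _).add (hSL n).integrable_sq) fun ω => ?_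
          change ‖S n ω‖ ≤ 1 + S n ω ^ 2
          rw [Real.norm_eq_abs, ← sq_abs]
          nlinarith [sq_nonneg (|S n ω| - 1), abs_nonneg (S n ω)]
      _ = 1 + ∫ ω, S n ω ^ 2 ∂μ := by
          rw [integral_add (integrable_const _) (hSL n).integrable_sq]; simp
      _ ≤ 1 + C := by rw [hsq]; linarith [hC n]
  exact hmart.submartingale.exists_ae_tendsto_of_bdd hbdd

/-- Differences of tails control the half-open intervals, a π-system containing arbitrarily small
neighbourhoods of each point. Since the tails converge at every `t`, continuity of the limit law
plays no role. -/
theorem tendstoInDistribution_of_Ioi {Ω' : Type*} {mΩ' : MeasurableSpace Ω'} {μ' : Measure Ω'}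
    [IsProbabilityMeasure μ] [IsProbabilityMeasure μ'] {V : ℕ → Ω → ℝ} {G : Ω' → ℝ}
    (hV : ∀ n, AEMeasurable (V n) μ) (hG : AEMeasurable G μ')
    (h : ∀ t, Tendsto (fun n => μ.real {ω | t < V n ω}) atTop (𝓝 (μ'.real {ω | t < G ω}))) :
    TendstoInDistribution V atTop G (fun _ => μ) μ' := by
  refine ⟨hV, hG, ?_⟩
  have hpi : IsPiSystem {S : Set ℝ | ∃ i j : ℝ, id i < id j ∧ Set.Ioc (id i) (id j) = S} :=
    isPiSystem_Ioc id id
  have hreal : ∀ (t : ℝ), Tendsto (fun n => (μ.map (V n)).real (Set.Ioi t)) atTop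
      (𝓝 ((μ'.map G).real (Set.Ioi t))) := fun t => by
    simp_rw [fun n => map_measureReal_apply_of_aemeasurable (hV n) (measurableSet_Ioi (a := t)),
      map_measureReal_apply_of_aemeasurable hG (measurableSet_Ioi (a := t))]
    exact h t
  have : IsProbabilityMeasure (μ'.map G) := Measure.isProbabilityMeasure_map hG
  have : ∀ n, IsProbabilityMeasure (μ.map (V n)) := fun n => Measure.isProbabilityMeasure_map (hV n)
  refine hpi.tendsto_probabilityMeasure_of_tendsto_of_mem ?_ ?_ ?_
  · rintro _ ⟨a, b, _, rfl⟩
    exact measurableSet_Ioc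
  · intro u hu x hx
    obtain ⟨l, v, hlv, hsub⟩ := mem_nhds_iff_exists_Ioo_subset.1 (hu.mem_nhds hx)
    obtain ⟨c, hc1, hc2⟩ := exists_between hlv.2
    refine ⟨Set.Ioc l c, ⟨l, c, hlv.1.trans hc1, rfl⟩, Ioc_mem_nhds hlv.1 hc1, fun y hy => ?_⟩
    exact hsub ⟨hy.1, hy.2.trans_lt hc2⟩
  · rintro _ ⟨a, b, hab, rfl⟩
    have hd : ∀ (κ : Measure ℝ) [IsProbabilityMeasure κ], a < b →
        κ.real (Set.Ioc a b) = κ.real (Set.Ioi a) - κ.real (Set.Ioi b) := fun κ _ hab => by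
      rw [← measureReal_sdiff (Set.Ioi_subset_Ioi hab.le) measurableSet_Ioi, Set.Ioi_sdiff_Ioi]
    rw [← NNReal.tendsto_coe]
    change Tendsto (fun n => (μ.map (V n)).real (Set.Ioc a b)) atTop
      (𝓝 ((μ'.map G).real (Set.Ioc a b)))
    rw [hd _ hab]
    refine ((hreal a).sub (hreal b)).congr fun n => ?_
    exact (hd _ hab).symm

end general

theorem condExp_indicator_lt_of_indep {Ω : Type*} {m mΩ : MeasurableSpace Ω} {μ : Measure Ω}
    [IsProbabilityMeasure μ] (hm : m ≤ mΩ) {X T : Ω → ℝ} (hX : Measurable X) (hlaw : HasLaw X (expMeasure 1) μ)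
    (hindep : Indep m (MeasurableSpace.comap X inferInstance) μ) (hT : Measurable[m] T)
    (hT0 : ∀ᵐ ω ∂μ, 0 ≤ T ω) :
    μ[Set.indicator {ω | T ω < X ω} (fun _ => (1 : ℝ)) | m] =ᵐ[μ] fun ω => Real.exp (-T ω) := by
  have hTm : Measurable T := hT.mono hm le_rfl
  have hem : Measurable fun ω => Real.exp (-T ω) := Real.measurable_exp.comp hTm.neg
  have hlt : MeasurableSet {ω | T ω < X ω} := measurableSet_lt hTm hX
  have hb : ∀ᵐ ω ∂μ, ‖Real.exp (-T ω)‖ ≤ 1 := by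
    filter_upwards [hT0] with ω h
    rw [Real.norm_of_nonneg (Real.exp_pos _).le, Real.exp_le_one_iff]
    linarith
  have hie : Integrable (fun ω => Real.exp (-T ω)) μ :=
    Integrable.of_bound hem.aestronglyMeasurable 1 hb
  refine (ae_eq_condExp_of_forall_setIntegral_eq hm ((integrable_const _).indicator hlt)
    (fun s _ _ => hie.integrableOn) (fun s hs _ => ?_) ?_).symm
  · have hs' := hm _ hs
    rw [integral_indicator hlt, setIntegral_const, smul_eq_mul, mul_one]
    -- The event `s` travels with `T` as a coordinate: the pair is independent of `X`, and Fubini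
    -- leaves the exponential tail at `T ω`.
    set g : Ω → ℝ × ℝ := fun ω => (Set.indicator s (fun _ => (1 : ℝ)) ω, T ω) with hg
    have hgm : Measurable[m] g := by
      refine Measurable.prodMk ?_ hT
      exact (measurable_const.indicator hs)
    have hgm' : Measurable g := hgm.mono hm le_rfl
    have hind : IndepFun g X μ := by
      rw [IndepFun_iff_Indep]
      exact indep_of_indep_of_le_left hindep hgm.comap_le
    have hprod := (indepFun_iff_map_prod_eq_prod_map_map hgm'.aemeasurable hX.aemeasurable).1 hind
    have hA : MeasurableSet {p : (ℝ × ℝ) × ℝ | p.1.1 = 1 ∧ p.1.2 < p.2} :=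
      (measurableSet_eq_fun (f := fun p : (ℝ × ℝ) × ℝ => p.1.1) (by fun_prop) measurable_const).inter
        (measurableSet_lt (f := fun p : (ℝ × ℝ) × ℝ => p.1.2) (g := fun p => p.2) (by fun_prop)
          (by fun_prop))
    have hset : {ω | T ω < X ω} ∩ s =
        (fun ω => (g ω, X ω)) ⁻¹' {p : (ℝ × ℝ) × ℝ | p.1.1 = 1 ∧ p.1.2 < p.2} := by
      ext ω
      by_cases h : ω ∈ s <;> simp [hg, h]
    have h1 : μ ({ω | T ω < X ω} ∩ s) = ∫⁻ ω in s, ENNReal.ofReal (Real.exp (-T ω)) ∂μ := by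
      rw [hset, ← Measure.map_apply (hgm'.prodMk hX) hA, hprod, Measure.prod_apply hA,
        lintegral_map (measurable_measure_prodMk_left hA) hgm', hlaw.map_eq,
        ← lintegral_indicator hs']
      refine lintegral_congr_ae ?_
      filter_upwards [hT0] with ω h0
      by_cases h : ω ∈ s
      · rw [Set.indicator_of_mem h, ← expMeasure_Ioi h0]
        congr 1
        ext y
        simp [hg, h]
      · rw [Set.indicator_of_notMem h]
        convert measure_empty (μ := expMeasure 1)
        ext y
        simp [hg, h]
    rw [integral_eq_lintegral_of_nonneg_ae (ae_of_all _ fun ω => (Real.exp_pos _).le)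
      hem.aestronglyMeasurable, ← h1, measureReal_def, Measure.restrict_apply' hs']
  · exact (hT.neg.exp.stronglyMeasurable).aestronglyMeasurable

/-! ### Measurability of the history -/

section measurability

variable {Ω : Type*} {m : MeasurableSpace Ω} {X : ℕ → Ω → ℝ}

theorem measurable_kthLargest {A : Finset ℕ} (h : ∀ i ∈ A, Measurable (X i)) {k : ℕ} (hk : 1 ≤ k) :
    Measurable fun ω => kthLargest (fun i => X i ω) A k := by
  rcases le_or_gt k A.card with hkA | hkA
  · refine measurable_of_Ioi fun c => ?_
    have : (fun ω => kthLargest (fun i => X i ω) A k) ⁻¹' Set.Ioi c =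
        {ω | k ≤ ∑ i ∈ A, if c < X i ω then 1 else 0} := by
      ext ω
      rw [Set.mem_ofPred_eq, ← Finset.card_filter]
      exact kthLargest_iff (fun a => c < a) (fun a b => lt_of_lt_of_le) _ A hk hkA
    rw [this]
    refine measurableSet_le measurable_const (Finset.measurable_fun_sum _ fun i hi => ?_)
    exact Measurable.ite (measurableSet_lt measurable_const (h i hi)) measurable_const
      measurable_const
  · simp only [kthLargest_eq_zero _ A hkA]
    exact measurable_const

variable {r : ℕ → ℕ}

theorem measurable_thr_of_hired (hr : IsRankSequence r) {n : ℕ}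
    (h : ∀ k, 1 ≤ k → k ≤ n → Measurable (X k))
    (hh : @Measurable Ω (Finset ℕ) m ⊤ fun ω => hired r (fun i => X i ω) n) :
    Measurable fun ω => thr r (fun i => X i ω) n := by
  let _ : MeasurableSpace (Finset ℕ) := ⊤
  have : MeasurableSingletonClass (Finset ℕ) := ⟨fun _ => trivial⟩
  -- Intersecting with `Finset.Icc 1 n` changes nothing at the accepted set, but makes the function
  -- measurable in `ω` for every fixed finite set, using `X 1, …, X n` only.
  have hf : Measurable fun p : Ω × Finset ℕ =>
      kthLargest (fun i => X i p.1) (p.2 ∩ Finset.Icc 1 n) (r p.2.card) := by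
    refine measurable_from_prod_countable_left fun A => ?_
    have hA : ∀ i ∈ A ∩ Finset.Icc 1 n, Measurable (X i) := fun i hi => by
      have := Finset.mem_Icc.1 (Finset.mem_inter.1 hi).2
      exact h i this.1 this.2
    exact measurable_kthLargest hA (hr.pos A.card)
  have := hf.comp (measurable_id.prodMk hh)
  convert this using 2 with ω
  change _ = kthLargest _ (hired r _ n ∩ Finset.Icc 1 n) _
  rw [Finset.inter_eq_left.2 (hired_subset_Icc r _ n)]
  rfl

theorem measurable_hired (hr : IsRankSequence r) {n : ℕ}
    (h : ∀ k, 1 ≤ k → k ≤ n → Measurable (X k)) :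
    @Measurable Ω (Finset ℕ) m ⊤ fun ω => hired r (fun i => X i ω) n := by
  let _ : MeasurableSpace (Finset ℕ) := ⊤
  induction n with
  | zero => exact measurable_const
  | succ n ih =>
    have hn := ih fun k h1 h2 => h k h1 (by omega)
    have ht := measurable_thr_of_hired hr (fun k h1 h2 => h k h1 (by omega)) hn
    have hi : Measurable fun A : Finset ℕ => insert (n + 1) A := fun _ _ => trivial
    exact Measurable.ite (measurableSet_lt ht (h (n + 1) (by omega) le_rfl)) (hi.comp hn) hn

theorem measurable_thr (hr : IsRankSequence r) {n : ℕ}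
    (h : ∀ k, 1 ≤ k → k ≤ n → Measurable (X k)) :
    Measurable fun ω => thr r (fun i => X i ω) n :=
  measurable_thr_of_hired hr h (measurable_hired hr h)

theorem measurable_M (hr : IsRankSequence r) {n : ℕ}
    (h : ∀ k, 1 ≤ k → k ≤ n → Measurable (X k)) :
    Measurable fun ω => M r (fun i => X i ω) n := by
  let _ : MeasurableSpace (Finset ℕ) := ⊤
  have hc : Measurable fun A : Finset ℕ => A.card := fun _ _ => trivial
  exact hc.comp (measurable_hired hr h)

theorem measurable_above (hr : IsRankSequence r) {n : ℕ}
    (h : ∀ k, 1 ≤ k → k ≤ n + 1 → Measurable (X k)) (S : Finset ℕ) :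
    MeasurableSet {ω | above r (fun i => X i ω) n = S} := by
  have hh := measurable_hired (X := X) hr h
  have ht := measurable_thr (n := n) hr fun k h1 h2 => h k h1 (by omega)
  -- For a fixed accepted set `A`, equality with `S` amounts to finitely many conditions, as no
  -- other index can lie in either set.
  have : {ω | above r (fun i => X i ω) n = S} =
      ⋃ A ∈ (Finset.Icc 1 (n + 1)).powerset, {ω | hired r (fun i => X i ω) (n + 1) = A} ∩
        ⋂ i ∈ Finset.range (n + 2) ∪ S,
          {ω | (i ∈ A ∧ thr r (fun i => X i ω) n < X i ω) ↔ i ∈ S} := by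
    ext ω
    simp only [Set.mem_ofPred_eq, Set.mem_iUnion, Set.mem_inter_iff, Set.mem_iInter, exists_prop]
    constructor
    · intro hS
      refine ⟨_, Finset.mem_powerset.2 (hired_subset_Icc r _ _), rfl, fun i _ => ?_⟩
      rw [← hS, above, Finset.mem_filter]
    · rintro ⟨A, hA, hAe, hi⟩
      ext i
      rw [above, Finset.mem_filter, hAe]
      by_cases hir : i ∈ Finset.range (n + 2) ∪ S
      · exact hi i hir
      · simp only [Finset.mem_union, not_or] at hir
        simp only [hir.2, iff_false, not_and]
        intro hiA
        have := Finset.mem_Icc.1 (Finset.mem_powerset.1 hA hiA)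
        exact absurd (Finset.mem_range.2 (by omega)) hir.1
  rw [this]
  refine Finset.measurableSet_biUnion _ fun A hA => MeasurableSet.inter
    (hh (t := {A}) trivial) ?_
  refine Finset.measurableSet_biInter _ fun i _ => ?_
  by_cases hiA : i ∈ A
  · have hi := Finset.mem_Icc.1 (Finset.mem_powerset.1 hA hiA)
    have hlt := measurableSet_lt ht (h i hi.1 hi.2)
    by_cases hiS : i ∈ S
    · simpa [hiA, hiS] using hlt
    · have := hlt.compl
      simp only [hiA, hiS, true_and, iff_false]
      exact this
  · simp [hiA]

theorem measurable_Y (hr : IsRankSequence r) (h : ∀ k, 1 ≤ k → Measurable (X k)) (j : ℕ) :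
    Measurable fun ω => Y r (fun i => X i ω) j := by
  have hM : ∀ n, Measurable fun ω => M r (fun i => X i ω) n := fun n =>
    measurable_M hr fun k h1 _ => h k h1
  have hN : Measurable fun ω => N r (fun i => X i ω) j := by
    refine measurable_to_countable' fun n => ?_
    -- The second set is the case of a level that is never reached, where `sInf ∅ = 0`.
    have : (fun ω => N r (fun i => X i ω) j) ⁻¹' {n} =
        ({ω | j ≤ M r (fun i => X i ω) n} ∩ ⋂ k ∈ Finset.range n, {ω | M r (fun i => X i ω) k < j}) ∪
        ({_ω | n = 0} ∩ ⋂ k, {ω | M r (fun i => X i ω) k < j}) := by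
      ext ω
      simp only [Set.mem_preimage, Set.mem_singleton_iff, Set.mem_union, Set.mem_inter_iff,
        Set.mem_iInter, Set.mem_ofPred_eq, Finset.mem_range]
      constructor
      · intro hn
        by_cases hex : ∃ k, j ≤ M r (fun i => X i ω) k
        · obtain ⟨k, hk⟩ := hex
          left
          rw [← hn]
          exact ⟨le_M_N hk, fun i hi => not_le.1 fun hle => absurd (N_le hle) (not_le.2 hi)⟩
        · push Not at hex
          right
          refine ⟨?_, hex⟩
          rw [← hn, N]
          have : {n | j ≤ M r (fun i => X i ω) n} = ∅ := by
            ext k; simpa using hex k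
          rw [this, Nat.sInf_empty]
      · rintro (⟨h1, h2⟩ | ⟨h1, h2⟩)
        · refine le_antisymm (N_le h1) (not_lt.1 fun hlt => ?_)
          exact absurd (h2 _ hlt) (not_lt.2 (le_M_N h1))
        · have : {n | j ≤ M r (fun i => X i ω) n} = ∅ := by
            ext k; simpa using h2 k
          rw [N, this, Nat.sInf_empty, h1]
    rw [this]
    refine MeasurableSet.union (MeasurableSet.inter (measurableSet_le measurable_const (hM n)) ?_)
      (MeasurableSet.inter (MeasurableSet.const _) ?_)
    · exact Finset.measurableSet_biInter _ fun k _ => measurableSet_lt (hM k) measurable_const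
    · exact MeasurableSet.iInter fun k => measurableSet_lt (hM k) measurable_const
  have hf : Measurable fun p : Ω × ℕ => thr r (fun i => X i p.1) p.2 :=
    measurable_from_prod_countable_left fun n => measurable_thr hr fun k h1 _ => h k h1
  exact hf.comp (measurable_id.prodMk hN)

theorem measurable_E (hr : IsRankSequence r) (h : ∀ k, 1 ≤ k → Measurable (X k)) (j : ℕ) :
    Measurable fun ω => E r (fun i => X i ω) j :=
  ((measurable_Y hr h j).sub (measurable_Y hr h (j - 1))).const_mul _

end measurability

/-! ### The filtration of the candidates -/

section filtration

variable {Ω : Type*} {mΩ : MeasurableSpace Ω} {X : ℕ → Ω → ℝ}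

/-- The information of the first `n` candidates. -/
def pastFiltration (X : ℕ → Ω → ℝ) (hX : ∀ n, 1 ≤ n → Measurable (X n)) : Filtration ℕ mΩ where
  seq n := ⨆ k ∈ Finset.Ico 1 (n + 1), MeasurableSpace.comap (X k) inferInstance
  mono' a b hab := by
    refine biSup_mono fun k hk => ?_
    rw [Finset.mem_Ico] at hk ⊢
    omega
  le' n := iSup₂_le fun k hk => (hX k (Finset.mem_Ico.1 hk).1).comap_le

theorem measurable_pastFiltration (hX : ∀ n, 1 ≤ n → Measurable (X n)) {n k : ℕ} (h1 : 1 ≤ k)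
    (hk : k ≤ n) : Measurable[pastFiltration X hX n] (X k) := by
  have h : MeasurableSpace.comap (X k) inferInstance ≤ pastFiltration X hX n :=
    le_iSup₂_of_le (f := fun k (_ : k ∈ Finset.Ico 1 (n + 1)) =>
      MeasurableSpace.comap (X k) inferInstance) k (Finset.mem_Ico.2 (by omega)) le_rfl
  exact (comap_measurable (X k)).mono h le_rfl

theorem indep_pastFiltration {μ : Measure Ω} (hX : ∀ n, 1 ≤ n → Measurable (X n))
    (hXindep : iIndepFun (fun n : {n : ℕ // 1 ≤ n} => X n) μ) (n : ℕ) :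
    Indep (pastFiltration X hX n) (MeasurableSpace.comap (X (n + 1)) inferInstance) μ := by
  have h := indep_iSup_of_disjoint (ι := {n : ℕ // 1 ≤ n})
    (m := fun i => MeasurableSpace.comap (X i) inferInstance)
    (S := {i : {n : ℕ // 1 ≤ n} | (i : ℕ) ≤ n}) (T := {⟨n + 1, by omega⟩})
    (fun i => (hX i i.2).comap_le) hXindep.iIndep (by
      rw [Set.disjoint_singleton_right]
      simp)
  refine indep_of_indep_of_le_left (indep_of_indep_of_le_right h ?_) ?_
  · simp
  · refine iSup₂_le fun k hk => ?_
    rw [Finset.mem_Ico] at hk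
    exact le_iSup₂_of_le (f := fun (i : {n : ℕ // 1 ≤ n}) (_ : i ∈ {i : {n : ℕ // 1 ≤ n} | (i : ℕ) ≤ n}) =>
      MeasurableSpace.comap (X i) inferInstance) ⟨k, hk.1⟩ (by
        change k ≤ n; omega) le_rfl

end filtration

theorem ae_pos {Ω : Type*} {mΩ : MeasurableSpace Ω} {μ : Measure Ω} {X : ℕ → Ω → ℝ}
    (hXlaw : ∀ n, 1 ≤ n → HasLaw (X n) (expMeasure 1) μ) :
    ∀ᵐ ω ∂μ, ∀ i, 1 ≤ i → 0 < X i ω := by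
  rw [ae_all_iff]
  intro i
  by_cases hi : 1 ≤ i
  · filter_upwards [((hXlaw i hi).ae_iff (p := fun x => 0 < x)
      (measurableSet_setOfPred.1 measurableSet_Ioi)).2 ae_pos_expMeasure] with ω h _
    exact h
  · exact ae_of_all _ fun ω h => absurd h hi

/-! ### Acceptance probabilities and the growth martingale -/

section model

variable {Ω : Type*} {mΩ : MeasurableSpace Ω} {μ : Measure Ω} [IsProbabilityMeasure μ]
  {X : ℕ → Ω → ℝ} {r : ℕ → ℕ}

theorem ae_inj (hX : ∀ n, 1 ≤ n → Measurable (X n))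
    (hXindep : iIndepFun (fun n : {n : ℕ // 1 ≤ n} => X n) μ)
    (hXlaw : ∀ n, 1 ≤ n → HasLaw (X n) (expMeasure 1) μ) :
    ∀ᵐ ω ∂μ, ∀ i j, 1 ≤ i → 1 ≤ j → X i ω = X j ω → i = j := by
  simp only [ae_all_iff]
  intro i j hi hj
  by_cases hij : i = j
  · exact ae_of_all _ fun _ _ => hij
  have hind : IndepFun (X i) (X j) μ :=
    hXindep.indepFun (i := ⟨i, hi⟩) (j := ⟨j, hj⟩) fun h => hij (congrArg Subtype.val h)
  have hprod := (indepFun_iff_map_prod_eq_prod_map_map (hX i hi).aemeasurable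
    (hX j hj).aemeasurable).1 hind
  have hD : MeasurableSet {p : ℝ × ℝ | p.1 = p.2} :=
    measurableSet_eq_fun measurable_fst measurable_snd
  have h0 : μ {ω | X i ω = X j ω} = 0 := by
    have : {ω | X i ω = X j ω} = (fun ω => (X i ω, X j ω)) ⁻¹' {p : ℝ × ℝ | p.1 = p.2} := rfl
    rw [this, ← Measure.map_apply ((hX i hi).prodMk (hX j hj)) hD, hprod, Measure.prod_apply hD,
      (hXlaw i hi).map_eq, (hXlaw j hj).map_eq]
    simp only [lintegral_eq_zero_iff (measurable_measure_prodMk_left hD)]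
    refine ae_of_all _ fun x => ?_
    have : Prod.mk x ⁻¹' {p : ℝ × ℝ | p.1 = p.2} = {x} := by ext y; simp [eq_comm]
    simp only [this, measure_singleton, Pi.zero_apply]
  have h1 : ∀ᵐ ω ∂μ, ¬ X i ω = X j ω := by
    rw [ae_iff]; simpa using h0
  filter_upwards [h1] with ω h h'
  exact absurd h' h

/-- The case `k < n` is for runs of rejections, where a threshold from time `k` is faced by later
candidates. -/
theorem condExp_indicator_lt_thr (hr : IsRankSequence r) (hX : ∀ n, 1 ≤ n → Measurable (X n))
    (hXindep : iIndepFun (fun n : {n : ℕ // 1 ≤ n} => X n) μ)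
    (hXlaw : ∀ n, 1 ≤ n → HasLaw (X n) (expMeasure 1) μ) {k n : ℕ} (hkn : k ≤ n) :
    μ[Set.indicator {ω | thr r (fun i => X i ω) k < X (n + 1) ω} (fun _ => (1 : ℝ)) |
      pastFiltration X hX n] =ᵐ[μ] fun ω => Real.exp (-thr r (fun i => X i ω) k) := by
  refine condExp_indicator_lt_of_indep ((pastFiltration X hX).le n) (hX _ (by omega))
    (hXlaw _ (by omega)) (indep_pastFiltration hX hXindep n) ?_ ?_
  · exact measurable_thr hr fun i h1 h2 => measurable_pastFiltration hX h1 (h2.trans hkn)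
  · filter_upwards [ae_pos hXlaw] with ω h
    exact thr_nonneg hr h k

theorem P_succ_ae_eq (hr : IsRankSequence r) (hX : ∀ n, 1 ≤ n → Measurable (X n))
    (hXindep : iIndepFun (fun n : {n : ℕ // 1 ≤ n} => X n) μ)
    (hXlaw : ∀ n, 1 ≤ n → HasLaw (X n) (expMeasure 1) μ) (n : ℕ) :
    P μ r X (n + 1) =ᵐ[μ] fun ω => Real.exp (-thr r (fun i => X i ω) n) := by
  have h := condExp_indicator_lt_thr hr hX hXindep hXlaw (le_refl n)
  have hset : {ω | thr r (fun i => X i ω) n < X (n + 1) ω} =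
      {ω | n + 1 ∈ hired r (fun k => X k ω) (n + 1)} := by
    ext ω
    exact (mem_hired_succ_iff r (fun k => X k ω) n).symm
  rw [hset] at h
  exact h

theorem condExp_mul_indicator_sub (hr : IsRankSequence r) (hX : ∀ n, 1 ≤ n → Measurable (X n))
    (hXindep : iIndepFun (fun n : {n : ℕ // 1 ≤ n} => X n) μ)
    (hXlaw : ∀ n, 1 ≤ n → HasLaw (X n) (expMeasure 1) μ) {k n : ℕ} (hkn : k ≤ n) {H : Ω → ℝ}
    (hH : Measurable[pastFiltration X hX n] H) {c : ℝ} (hc : ∀ᵐ ω ∂μ, ‖H ω‖ ≤ c) :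
    μ[fun ω => H ω * (Set.indicator {ω | thr r (fun i => X i ω) k < X (n + 1) ω}
      (fun _ => (1 : ℝ)) ω - Real.exp (-thr r (fun i => X i ω) k)) | pastFiltration X hX n]
      =ᵐ[μ] 0 := by
  have ht : Measurable[pastFiltration X hX n] fun ω => thr r (fun i => X i ω) k :=
    measurable_thr hr fun i h1 h2 => measurable_pastFiltration hX h1 (h2.trans hkn)
  have hle := (pastFiltration X hX).le n
  have hem : Measurable[pastFiltration X hX n] fun ω => Real.exp (-thr r (fun i => X i ω) k) :=
    Real.measurable_exp.comp ht.neg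
  have hlt : MeasurableSet {ω | thr r (fun i => X i ω) k < X (n + 1) ω} :=
    measurableSet_lt (ht.mono hle le_rfl) (hX _ (by omega))
  have hie : Integrable (fun ω => Real.exp (-thr r (fun i => X i ω) k)) μ := by
    refine Integrable.of_bound (hem.mono hle le_rfl).aestronglyMeasurable 1 ?_
    filter_upwards [ae_pos hXlaw] with ω h
    rw [Real.norm_of_nonneg (Real.exp_pos _).le, Real.exp_le_one_iff]
    linarith [thr_nonneg hr h k]
  have hii : Integrable (Set.indicator {ω | thr r (fun i => X i ω) k < X (n + 1) ω}
      (fun _ => (1 : ℝ))) μ := (integrable_const _).indicator hlt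
  have h1 := condExp_stronglyMeasurable_mul_of_bound hle hH.stronglyMeasurable (hii.sub hie) c hc
  have h2 := condExp_sub hii hie (pastFiltration X hX n)
  have h3 := condExp_indicator_lt_thr hr hX hXindep hXlaw hkn
  have h4 := condExp_of_stronglyMeasurable hle hem.stronglyMeasurable hie
  refine h1.trans ?_
  filter_upwards [h2, h3] with ω h2 h3
  rw [Pi.mul_apply, h2, Pi.sub_apply, h3, h4]
  simp

/-- The martingale differences whose sum drives the growth of the number of accepted candidates. -/
noncomputable def hireDiff (r : ℕ → ℕ) (x : ℕ → ℝ) (n : ℕ) : ℝ :=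
  ((M r x (n + 1) : ℝ) - M r x n - Real.exp (-Y r x (M r x n))) / ((M r x n : ℝ) + 1)

theorem hireDiff_eq (r : ℕ → ℕ) (X : ℕ → Ω → ℝ) (n : ℕ) (ω : Ω) :
    hireDiff r (fun i => X i ω) n = ((M r (fun i => X i ω) n : ℝ) + 1)⁻¹ *
      (Set.indicator {ω | thr r (fun i => X i ω) n < X (n + 1) ω} (fun _ => (1 : ℝ)) ω -
        Real.exp (-thr r (fun i => X i ω) n)) := by
  rw [hireDiff, M_succ_eq, Y_M, div_eq_inv_mul]
  congr 2
  by_cases h : thr r (fun i => X i ω) n < X (n + 1) ω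
  · simp [h]
  · simp [h]

/-- Dividing by `M_n + 1` makes the variances summable: up to a mean-zero term, a square costs at
most `2 / (k + 1)²` when the count leaves level `k`, and nothing at a rejection. -/
theorem ae_exists_tendsto_sum_hireDiff (hr : IsRankSequence r)
    (hX : ∀ n, 1 ≤ n → Measurable (X n))
    (hXindep : iIndepFun (fun n : {n : ℕ // 1 ≤ n} => X n) μ)
    (hXlaw : ∀ n, 1 ≤ n → HasLaw (X n) (expMeasure 1) μ) :
    ∀ᵐ ω ∂μ, ∃ s, Tendsto (fun n => ∑ i ∈ Finset.range n, hireDiff r (fun i => X i ω) i) atTop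
      (𝓝 s) := by
  have hMm : ∀ n, Measurable[pastFiltration X hX n] fun ω => (M r (fun i => X i ω) n : ℝ) :=
    fun n => (measurable_from_top (f := fun n : ℕ => (n : ℝ))).comp
      (measurable_M hr fun i h1 h2 => measurable_pastFiltration hX h1 h2)
  have htm : ∀ n, Measurable[pastFiltration X hX n] fun ω => thr r (fun i => X i ω) n :=
    fun n => measurable_thr hr fun i h1 h2 => measurable_pastFiltration hX h1 h2
  have hle : ∀ n, pastFiltration X hX n ≤ mΩ := (pastFiltration X hX).le
  have hmono : ∀ n, pastFiltration X hX n ≤ pastFiltration X hX (n + 1) :=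
    fun n => (pastFiltration X hX).mono (Nat.le_succ n)
  have hdm : ∀ n, Measurable[pastFiltration X hX (n + 1)]
      fun ω => hireDiff r (fun i => X i ω) n := fun n => by
    simp only [hireDiff, Y_M]
    have h1 := (hMm n).mono (hmono n) le_rfl
    have h2 := (htm n).mono (hmono n) le_rfl
    have h3 := Real.measurable_exp.comp h2.neg
    exact Measurable.div (((hMm (n + 1)).sub h1).sub h3) (h1.add_const 1)
  -- With `v = 1 / (M_n + 1)` and acceptance probability `p`, the square is `v² (1 - p)²` or `v²
  -- p²`. Adding `v²` times the centred indicator, of mean zero, leaves at most `2 v²` at an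
  -- acceptance and at most `0` otherwise, so the bound telescopes.
  have hpt : ∀ n ω, (∀ i, 1 ≤ i → 0 < X i ω) → |hireDiff r (fun i => X i ω) n| ≤ 1 ∧
      hireDiff r (fun i => X i ω) n ^ 2 ≤
        2 * ((∑ k ∈ Finset.range (M r (fun i => X i ω) (n + 1)), 1 / ((k : ℝ) + 1) ^ 2) -
          ∑ k ∈ Finset.range (M r (fun i => X i ω) n), 1 / ((k : ℝ) + 1) ^ 2) -
        (((M r (fun i => X i ω) n : ℝ) + 1)⁻¹) ^ 2 *
          (Set.indicator {ω | thr r (fun i => X i ω) n < X (n + 1) ω} (fun _ => (1 : ℝ)) ω -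
          Real.exp (-thr r (fun i => X i ω) n)) := by
    intro n ω h
    have ht := thr_nonneg hr h n
    set p := Real.exp (-thr r (fun i => X i ω) n) with hp
    have hp0 : 0 < p := Real.exp_pos _
    have hp1 : p ≤ 1 := by rw [hp, Real.exp_le_one_iff]; linarith
    rw [hireDiff_eq, ← hp]
    set v := ((M r (fun i => X i ω) n : ℝ) + 1)⁻¹ with hv
    have hv0 : 0 < v := by positivity
    have hv1 : v ≤ 1 := inv_le_one_of_one_le₀ (by linarith [Nat.cast_nonneg (α := ℝ) (M r (fun i => X i ω) n)])
    by_cases hlt : thr r (fun i => X i ω) n < X (n + 1) ω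
    · rw [M_succ_of_lt hlt, Finset.sum_range_succ, Set.indicator_of_mem (by exact hlt)]
      have e : 1 / ((M r (fun i => X i ω) n : ℝ) + 1) ^ 2 = v ^ 2 := by rw [hv]; field_simp
      rw [e]
      have hv2 : 0 < v ^ 2 := by positivity
      constructor
      · rw [abs_le]; constructor <;> nlinarith
      · have : (v * (1 - p)) ^ 2 = v ^ 2 * (1 - p) ^ 2 := by ring
        rw [this]
        have : v ^ 2 * (1 - p) ^ 2 ≤ v ^ 2 * (1 + p) :=
          mul_le_mul_of_nonneg_left (by nlinarith) hv2.le
        nlinarith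
    · rw [M_succ_of_le (not_lt.1 hlt), Set.indicator_of_notMem (by exact hlt)]
      have hv2 : 0 < v ^ 2 := by positivity
      constructor
      · rw [abs_le]; constructor <;> nlinarith
      · have : (v * (0 - p)) ^ 2 = v ^ 2 * p ^ 2 := by ring
        rw [this]
        have : v ^ 2 * p ^ 2 ≤ v ^ 2 * p := mul_le_mul_of_nonneg_left (by nlinarith) hv2.le
        nlinarith
  have hsumm : Summable fun k : ℕ => 1 / ((k : ℝ) + 1) ^ 2 := by
    have := (summable_nat_add_iff 1).2 (Real.summable_one_div_nat_pow.2 one_lt_two)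
    refine this.congr fun k => by push_cast; rfl
  set g : ℕ → ℝ := fun m => ∑ k ∈ Finset.range m, 1 / ((k : ℝ) + 1) ^ 2 with hg
  have hg0 : ∀ m, 0 ≤ g m := fun m => Finset.sum_nonneg fun k _ => by positivity
  have hgle : ∀ m, g m ≤ ∑' k : ℕ, 1 / ((k : ℝ) + 1) ^ 2 := fun m =>
    hsumm.sum_le_tsum _ fun k _ => by positivity
  have hgi : ∀ n, Integrable (fun ω => g (M r (fun i => X i ω) n)) μ := fun n => by
    refine Integrable.of_bound (C := ∑' k : ℕ, 1 / ((k : ℝ) + 1) ^ 2) ?_ (ae_of_all _ fun ω => ?_)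
    · exact ((measurable_from_top (f := g)).comp
        (measurable_M hr fun i h1 _ => hX i h1)).aestronglyMeasurable
    · rw [Real.norm_of_nonneg (hg0 _)]
      exact hgle _
  have hvb : ∀ n (p : ℕ), ∀ᵐ ω ∂μ, ‖((M r (fun i => X i ω) n : ℝ) + 1)⁻¹ ^ p‖ ≤ 1 := fun n p =>
    ae_of_all _ fun ω => by
      rw [norm_pow, Real.norm_of_nonneg (by positivity)]
      refine pow_le_one₀ (by positivity) (inv_le_one_of_one_le₀ ?_)
      linarith [Nat.cast_nonneg (α := ℝ) (M r (fun i => X i ω) n)]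
  have hvm : ∀ n (p : ℕ), Measurable[pastFiltration X hX n]
      fun ω => ((M r (fun i => X i ω) n : ℝ) + 1)⁻¹ ^ p := fun n p =>
    (((hMm n).add_const 1).inv).pow_const p
  refine ae_exists_tendsto_sum_of_condExp_eq_zero (𝓕 := pastFiltration X hX) (μ := μ)
    (ξ := fun n ω => hireDiff r (fun i => X i ω) n) (C := 2 * ∑' k : ℕ, 1 / ((k : ℝ) + 1) ^ 2)
    (fun n => (hdm n).stronglyMeasurable) (fun n => ?_) (fun n => ?_) (fun n => ?_)
  · refine MemLp.of_bound ((hdm n).mono (hle _) le_rfl).aestronglyMeasurable 1 ?_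
    filter_upwards [ae_pos hXlaw] with ω h
    exact (hpt n ω h).1
  · have := condExp_mul_indicator_sub hr hX hXindep hXlaw (le_refl n) (hvm n 1) (hvb n 1)
    simp only [pow_one] at this
    simp only [hireDiff_eq]
    exact this
  · have hstep : ∀ n, ∫ ω, hireDiff r (fun i => X i ω) n ^ 2 ∂μ ≤
        2 * (∫ ω, g (M r (fun i => X i ω) (n + 1)) ∂μ - ∫ ω, g (M r (fun i => X i ω) n) ∂μ) := by
      intro n
      have h0 := condExp_mul_indicator_sub hr hX hXindep hXlaw (le_refl n) (hvm n 2) (hvb n 2)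
      have h1 := integral_condExp (hle n) (μ := μ) (f := fun ω =>
        ((M r (fun i => X i ω) n : ℝ) + 1)⁻¹ ^ 2 *
        (Set.indicator {ω | thr r (fun i => X i ω) n < X (n + 1) ω} (fun _ => (1 : ℝ)) ω -
          Real.exp (-thr r (fun i => X i ω) n)))
      rw [integral_congr_ae h0] at h1
      simp only [Pi.zero_apply, integral_zero] at h1
      have hDi : Integrable (fun ω => ((M r (fun i => X i ω) n : ℝ) + 1)⁻¹ ^ 2 *
          (Set.indicator {ω | thr r (fun i => X i ω) n < X (n + 1) ω} (fun _ => (1 : ℝ)) ω -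
            Real.exp (-thr r (fun i => X i ω) n))) μ := by
        have e : ∀ ω, ((M r (fun i => X i ω) n : ℝ) + 1)⁻¹ ^ 2 *
          (Set.indicator {ω | thr r (fun i => X i ω) n < X (n + 1) ω} (fun _ => (1 : ℝ)) ω -
            Real.exp (-thr r (fun i => X i ω) n)) =
            ((M r (fun i => X i ω) n : ℝ) + 1)⁻¹ * hireDiff r (fun i => X i ω) n := fun ω => by
          rw [hireDiff_eq]; ring
        simp_rw [e]
        refine Integrable.of_bound (C := 1) ?_ ?_
        · have h1 := (hvm n 1).mono (hle n) le_rfl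
          simp only [pow_one] at h1
          exact (h1.mul ((hdm n).mono (hle _) le_rfl)).aestronglyMeasurable
        · filter_upwards [ae_pos hXlaw, hvb n 1] with ω h h'
          rw [pow_one] at h'
          rw [norm_mul]
          exact mul_le_one₀ h' (norm_nonneg _) (hpt n ω h).1
      have hgd := ((hgi (n + 1)).sub (hgi n)).const_mul 2
      calc ∫ ω, hireDiff r (fun i => X i ω) n ^ 2 ∂μ
          ≤ ∫ ω, (2 * (g (M r (fun i => X i ω) (n + 1)) - g (M r (fun i => X i ω) n)) -
            ((M r (fun i => X i ω) n : ℝ) + 1)⁻¹ ^ 2 *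
          (Set.indicator {ω | thr r (fun i => X i ω) n < X (n + 1) ω} (fun _ => (1 : ℝ)) ω -
            Real.exp (-thr r (fun i => X i ω) n))) ∂μ := by
            refine integral_mono_of_nonneg (ae_of_all _ fun ω => sq_nonneg _) (hgd.sub hDi) ?_
            filter_upwards [ae_pos hXlaw] with ω h
            exact (hpt n ω h).2
        _ = _ := by
            rw [integral_sub (by exact hgd) hDi, ← h1, sub_zero, integral_const_mul,
              integral_sub (hgi _) (hgi _)]
    calc ∑ i ∈ Finset.range n, ∫ ω, hireDiff r (fun j => X j ω) i ^ 2 ∂μ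
        ≤ ∑ i ∈ Finset.range n, 2 * (∫ ω, g (M r (fun j => X j ω) (i + 1)) ∂μ -
          ∫ ω, g (M r (fun j => X j ω) i) ∂μ) := Finset.sum_le_sum fun i _ => hstep i
      _ = 2 * (∫ ω, g (M r (fun j => X j ω) n) ∂μ - ∫ ω, g (M r (fun j => X j ω) 0) ∂μ) := by
          rw [← Finset.mul_sum, Finset.sum_range_sub fun i => ∫ ω, g (M r (fun j => X j ω) i) ∂μ]
      _ ≤ 2 * ∑' k : ℕ, 1 / ((k : ℝ) + 1) ^ 2 := by
          have h1 : 0 ≤ ∫ ω, g (M r (fun j => X j ω) 0) ∂μ := integral_nonneg fun ω => hg0 _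
          have h2 : ∫ ω, g (M r (fun j => X j ω) n) ∂μ ≤ ∫ _ω, ∑' k : ℕ, 1 / ((k : ℝ) + 1) ^ 2 ∂μ :=
            integral_mono (hgi n) (integrable_const _) fun ω => hgle _
          rw [integral_const] at h2
          rw [probReal_univ, one_smul] at h2
          linarith

theorem integral_one_sub_exp_pow (hr : IsRankSequence r) (hX : ∀ n, 1 ≤ n → Measurable (X n))
    (hXindep : iIndepFun (fun n : {n : ℕ // 1 ≤ n} => X n) μ)
    (hXlaw : ∀ n, 1 ≤ n → HasLaw (X n) (expMeasure 1) μ) (n j : ℕ) :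
    μ.real {ω | M r (fun i => X i ω) (n + j) = M r (fun i => X i ω) n} =
      ∫ ω, (1 - Real.exp (-thr r (fun i => X i ω) n)) ^ j ∂μ := by
  have hle : ∀ n, pastFiltration X hX n ≤ mΩ := (pastFiltration X hX).le
  have htm : ∀ l, Measurable[pastFiltration X hX (n + l)] fun ω => thr r (fun i => X i ω) n :=
    fun l => measurable_thr hr fun i h1 h2 => measurable_pastFiltration hX h1 (by omega)
  have hqm : ∀ l k : ℕ, Measurable[pastFiltration X hX (n + l)]
      fun ω => (1 - Real.exp (-thr r (fun i => X i ω) n)) ^ k := fun l k =>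
    (measurable_const.sub (Real.measurable_exp.comp (htm l).neg)).pow_const k
  have hMm : ∀ l, MeasurableSet[pastFiltration X hX (n + l)]
      {ω | M r (fun i => X i ω) (n + l) = M r (fun i => X i ω) n} := fun l =>
    measurableSet_eq_fun
      (measurable_M hr fun i h1 h2 => measurable_pastFiltration hX h1 h2)
      (measurable_M hr fun i h1 h2 => measurable_pastFiltration hX h1 (by omega))
  have hqb : ∀ᵐ ω ∂μ, ∀ k : ℕ, ‖(1 - Real.exp (-thr r (fun i => X i ω) n)) ^ k‖ ≤ 1 := by
    filter_upwards [ae_pos hXlaw] with ω h k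
    have ht := thr_nonneg hr h n
    have h1 : Real.exp (-thr r (fun i => X i ω) n) ≤ 1 := by rw [Real.exp_le_one_iff]; linarith
    have h2 := Real.exp_pos (-thr r (fun i => X i ω) n)
    rw [norm_pow, Real.norm_of_nonneg (by linarith)]
    exact pow_le_one₀ (by linarith) (by linarith)
  have hHb : ∀ l k : ℕ, ∀ᵐ ω ∂μ, ‖Set.indicator
      {ω | M r (fun i => X i ω) (n + l) = M r (fun i => X i ω) n}
      (fun ω => (1 - Real.exp (-thr r (fun i => X i ω) n)) ^ k) ω‖ ≤ 1 := fun l k => by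
    filter_upwards [hqb] with ω h
    exact (norm_indicator_le_norm_self _ _).trans (h k)
  have hHm : ∀ l k : ℕ, Measurable[pastFiltration X hX (n + l)] (Set.indicator
      {ω | M r (fun i => X i ω) (n + l) = M r (fun i => X i ω) n}
      (fun ω => (1 - Real.exp (-thr r (fun i => X i ω) n)) ^ k)) := fun l k =>
    (hqm l k).indicator (hMm l)
  have hHi : ∀ l k : ℕ, Integrable (Set.indicator
      {ω | M r (fun i => X i ω) (n + l) = M r (fun i => X i ω) n}
      (fun ω => (1 - Real.exp (-thr r (fun i => X i ω) n)) ^ k)) μ := fun l k =>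
    Integrable.of_bound ((hHm l k).mono (hle _) le_rfl).aestronglyMeasurable 1 (hHb l k)
  -- The exponent `k` is kept free for the induction: conditioning on the past of the last candidate
  -- trades one rejection for one factor `1 - exp (-thr)`.
  have key : ∀ l k : ℕ, ∫ ω, Set.indicator
      {ω | M r (fun i => X i ω) (n + l) = M r (fun i => X i ω) n}
      (fun ω => (1 - Real.exp (-thr r (fun i => X i ω) n)) ^ k) ω ∂μ =
      ∫ ω, (1 - Real.exp (-thr r (fun i => X i ω) n)) ^ (k + l) ∂μ := by
    intro l
    induction l with
    | zero => intro k; simp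
    | succ l ih =>
      intro k
      have h0 := condExp_mul_indicator_sub hr hX hXindep hXlaw (Nat.le_add_right n l) (hHm l k)
        (hHb l k)
      have h1 := integral_condExp (hle (n + l)) (μ := μ) (f := fun ω =>
        Set.indicator {ω | M r (fun i => X i ω) (n + l) = M r (fun i => X i ω) n}
          (fun ω => (1 - Real.exp (-thr r (fun i => X i ω) n)) ^ k) ω *
        (Set.indicator {ω | thr r (fun i => X i ω) n < X (n + l + 1) ω} (fun _ => (1 : ℝ)) ω -
          Real.exp (-thr r (fun i => X i ω) n)))
      rw [integral_congr_ae h0] at h1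
      simp only [Pi.zero_apply, integral_zero] at h1
      have e : ∀ ω, Set.indicator {ω | M r (fun i => X i ω) (n + l) = M r (fun i => X i ω) n}
          (fun ω => (1 - Real.exp (-thr r (fun i => X i ω) n)) ^ k) ω *
        (Set.indicator {ω | thr r (fun i => X i ω) n < X (n + l + 1) ω} (fun _ => (1 : ℝ)) ω -
          Real.exp (-thr r (fun i => X i ω) n)) =
          Set.indicator {ω | M r (fun i => X i ω) (n + l) = M r (fun i => X i ω) n}
          (fun ω => (1 - Real.exp (-thr r (fun i => X i ω) n)) ^ (k + 1)) ω -
          Set.indicator {ω | M r (fun i => X i ω) (n + (l + 1)) = M r (fun i => X i ω) n}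
          (fun ω => (1 - Real.exp (-thr r (fun i => X i ω) n)) ^ k) ω := by
        intro ω
        have hiff := M_add_eq_iff r (fun i => X i ω) n (l + 1)
        rw [Finset.range_add_one, Finset.forall_mem_insert, ← M_add_eq_iff r (fun i => X i ω)] at hiff
        simp only [Set.indicator_apply, Set.mem_ofPred_eq, hiff]
        by_cases h1 : M r (fun i => X i ω) (n + l) = M r (fun i => X i ω) n
        · by_cases h2 : X (n + l + 1) ω ≤ thr r (fun i => X i ω) n
          · simp only [h1, h2, and_self, if_true, not_lt.2 h2, if_false]
            ring
          · simp only [h1, h2, and_true, if_true, not_le.1 h2, if_false]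
            ring
        · simp [h1]
      simp_rw [e] at h1
      rw [integral_sub (hHi l (k + 1)) (hHi (l + 1) k), ih (k + 1)] at h1
      have e2 : k + 1 + l = k + (l + 1) := by ring
      rw [e2] at h1
      linarith
  have := key j 0
  rw [zero_add] at this
  rw [← this]
  simp only [pow_zero]
  rw [integral_indicator (hle _ _ (hMm j))]
  simp

end model

/-! ### Shifting the values above the threshold: deterministic part -/

/-- The values are positive, candidate `n + 1` is accepted, `S` is the set of the accepted values
above the threshold at that time, and the property `G` holds. -/
def AcceptedAbove (r : ℕ → ℕ) (n : ℕ) (S : Finset ℕ) (G : (ℕ → ℝ) → Prop) (x : ℕ → ℝ) : Prop :=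
  (∀ i, 1 ≤ i → 0 < x i) ∧ thr r x n < x (n + 1) ∧ above r x n = S ∧ G x

section deterministic

variable {r : ℕ → ℕ} {n : ℕ} {S : Finset ℕ} {G : (ℕ → ℝ) → Prop}

theorem AcceptedAbove.of_eq_off (hr : IsRankSequence r)
    (hG : ∀ x x', (∀ k ≤ n, hired r x k = hired r x' k ∧ thr r x k = thr r x' k) → G x → G x')
    {x x' : ℕ → ℝ} (h : AcceptedAbove r n S G x) (hx' : ∀ i, 1 ≤ i → 0 < x' i)
    (hoff : ∀ i, 1 ≤ i → i ∉ S → x' i = x i) (hS : ∀ i ∈ S, thr r x n < x' i) :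
    AcceptedAbove r n S G x' ∧ thr r x' n = thr r x n := by
  obtain ⟨h1, h2, h3, h4⟩ := h
  subst h3
  obtain ⟨k1, k2, k3⟩ := above_eq_of_eq_off hr h1 hx' h2 hoff hS
  exact ⟨⟨hx', k2, k3, hG x x' k1 h4⟩, (k1 n le_rfl).2.symm⟩

theorem AcceptedAbove.lt_of_mem {x : ℕ → ℝ} (h : AcceptedAbove r n S G x) {i : ℕ} (hi : i ∈ S) :
    thr r x n < x i := by
  obtain ⟨_, _, h3, _⟩ := h
  subst h3
  exact (Finset.mem_filter.1 hi).2

theorem AcceptedAbove.congr (hr : IsRankSequence r)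
    (hG : ∀ x x', (∀ k ≤ n, hired r x k = hired r x' k ∧ thr r x k = thr r x' k) → G x → G x')
    {x x' : ℕ → ℝ} (hxx : ∀ i, 1 ≤ i → x i = x' i) (h : AcceptedAbove r n S G x) :
    AcceptedAbove r n S G x' := by
  refine (h.of_eq_off hr hG (fun i hi => hxx i hi ▸ h.1 i hi) (fun i hi _ => (hxx i hi).symm)
    fun i hi => ?_).1
  have h1 : 1 ≤ i := by
    obtain ⟨_, _, h3, _⟩ := h
    rw [← h3, above, Finset.mem_filter] at hi
    exact one_le_of_mem_hired hi.1
  rw [← hxx i h1]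
  exact h.lt_of_mem hi

/-- The shift keeps the values in `S` above the unchanged threshold, so neither the history nor `S`
changes. This matches the domain of the shift with the event that all excesses are larger than `s`.
-/
theorem acceptedAbove_sub_iff (hr : IsRankSequence r)
    (hG : ∀ x x', (∀ k ≤ n, hired r x k = hired r x' k ∧ thr r x k = thr r x' k) → G x → G x')
    {s : ℝ} (hs : 0 ≤ s) {x z : ℕ → ℝ} (hz : ∀ i, 1 ≤ i → z i = if i ∈ S then x i - s else x i) :
    ((∀ i ∈ S, s < x i) ∧ AcceptedAbove r n S G z) ↔
      (AcceptedAbove r n S G x ∧ ∀ i ∈ S, thr r x n + s < x i) := by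
  have h1S : ∀ {y}, AcceptedAbove r n S G y → ∀ i ∈ S, 1 ≤ i := fun h i hi => by
    obtain ⟨_, _, h3, _⟩ := h
    rw [← h3, above, Finset.mem_filter] at hi
    exact one_le_of_mem_hired hi.1
  have hzS : ∀ i, 1 ≤ i → i ∈ S → z i = x i - s := fun i h hi => by rw [hz i h, if_pos hi]
  have hzn : ∀ i, 1 ≤ i → i ∉ S → z i = x i := fun i h hi => by rw [hz i h, if_neg hi]
  constructor
  · rintro ⟨_, h⟩
    have hlt : ∀ i ∈ S, thr r z n + s < x i := fun i hi => by
      have := h.lt_of_mem hi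
      rw [hzS i (h1S h i hi) hi] at this
      linarith
    obtain ⟨k1, k2⟩ := h.of_eq_off hr hG (x' := x) (fun i hi => by
      have := h.1 i hi
      by_cases hiS : i ∈ S
      · rw [hzS i hi hiS] at this; linarith
      · rwa [hzn i hi hiS] at this) (fun i hi hiS => (hzn i hi hiS).symm)
      (fun i hi => by linarith [hlt i hi])
    exact ⟨k1, fun i hi => by rw [k2]; exact hlt i hi⟩
  · rintro ⟨h, hlt⟩
    have h0 := thr_nonneg hr h.1 n
    refine ⟨fun i hi => by linarith [hlt i hi], ?_⟩
    refine (h.of_eq_off hr hG (x' := z) (fun i hi => ?_) hzn fun i hi => ?_).1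
    · by_cases hiS : i ∈ S
      · rw [hzS i hi hiS]; linarith [hlt i hiS]
      · rw [hzn i hi hiS]; exact h.1 i hi
    · rw [hzS i (h1S h i hi) hi]; linarith [hlt i hi]

end deterministic

/-! ### Independence and law of the jumps -/

section model

variable {Ω : Type*} {mΩ : MeasurableSpace Ω} {μ : Measure Ω}
  {X : ℕ → Ω → ℝ} {r : ℕ → ℕ}

theorem map_succ_eq_infinitePi (hX : ∀ n, 1 ≤ n → Measurable (X n))
    (hXindep : iIndepFun (fun n : {n : ℕ // 1 ≤ n} => X n) μ)
    (hXlaw : ∀ n, 1 ≤ n → HasLaw (X n) (expMeasure 1) μ) :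
    μ.map (fun ω (j : ℕ) => X (j + 1) ω) = Measure.infinitePi fun _ : ℕ => expMeasure 1 := by
  have h := hXindep.precomp (g := fun j : ℕ => (⟨j + 1, by omega⟩ : {n : ℕ // 1 ≤ n}))
    fun a b hab => by simpa using hab
  rw [h.map_fun_eq_infinitePi_map fun j => hX (j + 1) (by omega)]
  congr 1
  funext j
  exact (hXlaw (j + 1) (by omega)).map_eq

theorem measure_eq_tsum_inter {ι : Type*} [Countable ι] {A : ι → Set Ω}
    (hd : Pairwise (Function.onFun Disjoint A)) (hA : ∀ p, MeasurableSet (A p))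
    (hcov : ∀ᵐ ω ∂μ, ∃ p, ω ∈ A p) {B : Set Ω} (hB : MeasurableSet B) :
    μ B = ∑' p, μ (B ∩ A p) := by
  rw [← measure_iUnion (fun p q hpq => (hd hpq).mono Set.inter_subset_right Set.inter_subset_right)
    fun p => hB.inter (hA p), ← Set.inter_iUnion]
  refine (measure_inter_conull ?_).symm
  refine measure_mono_null (fun ω h => ?_) (ae_iff.1 hcov)
  simpa using h

/-- The memoryless shift transferred to `X`: for given history and high set `S`, the smallest excess
is larger than `s` with probability `e^{-s #S}`. -/
theorem measure_acceptedAbove_shift (hr : IsRankSequence r)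
    (hX : ∀ n, 1 ≤ n → Measurable (X n))
    (hXindep : iIndepFun (fun n : {n : ℕ // 1 ≤ n} => X n) μ)
    (hXlaw : ∀ n, 1 ≤ n → HasLaw (X n) (expMeasure 1) μ) {n : ℕ} {S : Finset ℕ}
    {G : (ℕ → ℝ) → Prop}
    (hG : ∀ x x', (∀ k ≤ n, hired r x k = hired r x' k ∧ thr r x k = thr r x' k) → G x → G x')
    (hGm : MeasurableSet {u : ℕ → ℝ | G fun i => u (i - 1)}) {s : ℝ} (hs : 0 ≤ s) :
    μ {ω | AcceptedAbove r n S G (fun i => X i ω) ∧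
        ∀ i ∈ S, thr r (fun i => X i ω) n + s < X i ω} =
      ENNReal.ofReal (Real.exp (-s)) ^ S.card *
        μ {ω | AcceptedAbove r n S G fun i => X i ω} := by
  by_cases hS0 : 0 ∈ S
  · have h0 : ∀ x, ¬ AcceptedAbove r n S G x := fun x hx => by
      obtain ⟨_, _, h3, _⟩ := hx
      rw [← h3, above, Finset.mem_filter] at hS0
      exact absurd (one_le_of_mem_hired hS0.1) (by norm_num)
    simp [h0]
  have h1S : ∀ i ∈ S, 1 ≤ i := fun i hi => Nat.one_le_iff_ne_zero.2 fun h => hS0 (h ▸ hi)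
  have hm : ∀ k, 1 ≤ k → Measurable fun u : ℕ → ℝ => u (k - 1) := fun k _ =>
    measurable_pi_apply (k - 1)
  have htm : Measurable fun u : ℕ → ℝ => thr r (fun i => u (i - 1)) n :=
    measurable_thr (X := fun i (u : ℕ → ℝ) => u (i - 1)) hr fun k h1 _ => hm k h1
  have hCm : MeasurableSet {u : ℕ → ℝ | AcceptedAbove r n S G fun i => u (i - 1)} := by
    have hpos : MeasurableSet {u : ℕ → ℝ | ∀ i, 1 ≤ i → 0 < u (i - 1)} := by
      simp only [Set.ofPred_forall]
      exact MeasurableSet.iInter fun i => MeasurableSet.iInter fun hi =>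
        measurableSet_lt measurable_const (hm i hi)
    refine hpos.inter (MeasurableSet.inter ?_ (MeasurableSet.inter ?_ hGm))
    · exact measurableSet_lt htm (hm (n + 1) (by omega))
    · exact measurable_above (X := fun i (u : ℕ → ℝ) => u (i - 1)) hr (fun k h1 _ => hm k h1) S
  have hCm' : MeasurableSet {u : ℕ → ℝ | AcceptedAbove r n S G (fun i => u (i - 1)) ∧
      ∀ i ∈ S, thr r (fun i => u (i - 1)) n + s < u (i - 1)} := by
    refine hCm.inter ?_
    have : {u : ℕ → ℝ | ∀ i ∈ S, thr r (fun i => u (i - 1)) n + s < u (i - 1)} =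
        ⋂ i ∈ S, {u : ℕ → ℝ | thr r (fun i => u (i - 1)) n + s < u (i - 1)} := by ext; simp
    refine (congrArg MeasurableSet this).mpr (S.measurableSet_biInter fun i hi => ?_)
    exact
      measurableSet_lt (htm.add_const s) (hm i (h1S i hi))
  have hUm : Measurable fun ω (j : ℕ) => X (j + 1) ω :=
    measurable_pi_lambda _ fun j => hX (j + 1) (by omega)
  -- No law is prescribed for `X 0`, so the product space carries `X 1, X 2, …` and index `i` reads
  -- coordinate `i - 1`. At `i = 0` this is a wrong value, which is never used.
  have hagree : ∀ ω i, 1 ≤ i → X i ω = X (i - 1 + 1) ω := fun ω i hi => by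
    rw [Nat.sub_add_cancel hi]
  have hshift := infinitePi_expMeasure_shift (S.image (· - 1)) hs hCm
  have hcard : (S.image (· - 1)).card = S.card := Finset.card_image_of_injOn fun a ha b hb hab => by
    have := h1S a ha
    have := h1S b hb
    omega
  have hset : {u : ℕ → ℝ | (∀ i ∈ S.image (· - 1), s < u i) ∧
      (fun i => if i ∈ S.image (· - 1) then u i - s else u i) ∈
        {u : ℕ → ℝ | AcceptedAbove r n S G fun i => u (i - 1)}} =
      {u : ℕ → ℝ | AcceptedAbove r n S G (fun i => u (i - 1)) ∧
        ∀ i ∈ S, thr r (fun i => u (i - 1)) n + s < u (i - 1)} := by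
    ext u
    have := acceptedAbove_sub_iff (n := n) (S := S) hr hG hs (x := fun i => u (i - 1))
      (z := fun i => if i - 1 ∈ S.image (· - 1) then u (i - 1) - s else u (i - 1)) (fun i hi => by
        have : i - 1 ∈ S.image (· - 1) ↔ i ∈ S := by
          rw [Finset.mem_image]
          constructor
          · rintro ⟨a, ha, hai⟩
            have := h1S a ha
            have : a = i := by omega
            exact this ▸ ha
          · exact fun h => ⟨i, h, rfl⟩
        simp only [this])
    simp only [Set.mem_ofPred_eq, Finset.forall_mem_image]
    exact this
  rw [hset, hcard, ← map_succ_eq_infinitePi hX hXindep hXlaw, Measure.map_apply hUm hCm',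
    Measure.map_apply hUm hCm] at hshift
  have e1 : {ω | AcceptedAbove r n S G fun i => X i ω} = (fun ω (j : ℕ) => X (j + 1) ω) ⁻¹'
      {u : ℕ → ℝ | AcceptedAbove r n S G fun i => u (i - 1)} := by
    ext ω
    exact ⟨fun h => h.congr hr hG (hagree ω), fun h => AcceptedAbove.congr hr hG
      (fun i hi => (hagree ω i hi).symm) h⟩
  have e2 : {ω | AcceptedAbove r n S G (fun i => X i ω) ∧
        ∀ i ∈ S, thr r (fun i => X i ω) n + s < X i ω} = (fun ω (j : ℕ) => X (j + 1) ω) ⁻¹'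
      {u : ℕ → ℝ | AcceptedAbove r n S G (fun i => u (i - 1)) ∧
        ∀ i ∈ S, thr r (fun i => u (i - 1)) n + s < u (i - 1)} := by
    ext ω
    have ht : thr r (fun i => X i ω) n = thr r (fun i => X (i - 1 + 1) ω) n :=
      (hired_congr (hagree ω) n).2
    refine and_congr ?_ ?_
    · exact ⟨fun h => h.congr hr hG (hagree ω), fun h => AcceptedAbove.congr hr hG
        (fun i hi => (hagree ω i hi).symm) h⟩
    · refine forall₂_congr fun i hi => ?_
      rw [ht, hagree ω i (h1S i hi)]
  rw [e1, e2]
  exact hshift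

variable [IsProbabilityMeasure μ]

theorem ae_tendsto_M_atTop (hr : IsRankSequence r) (hX : ∀ n, 1 ≤ n → Measurable (X n))
    (hXindep : iIndepFun (fun n : {n : ℕ // 1 ≤ n} => X n) μ)
    (hXlaw : ∀ n, 1 ≤ n → HasLaw (X n) (expMeasure 1) μ) :
    ∀ᵐ ω ∂μ, Tendsto (M r fun i => X i ω) atTop atTop := by
  filter_upwards [ae_exists_tendsto_sum_hireDiff hr hX hXindep hXlaw] with ω ⟨s, hs⟩
  exact tendsto_atTop_of_sum_tendsto (y := Y r fun i => X i ω)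
    (fun n => by rw [M_succ_eq]; split_ifs <;> omega) hs

theorem exists_M_eq_and_lt {x : ℕ → ℝ} (h : Tendsto (M r x) atTop atTop) (m : ℕ) :
    ∃ n, M r x n = m ∧ thr r x n < x (n + 1) := by
  have hex : ∃ n, m + 1 ≤ M r x n := (h.eventually_ge_atTop (m + 1)).exists
  have h1 := Nat.find_spec hex
  have h0 : Nat.find hex ≠ 0 := fun h0 => by
    rw [h0] at h1
    simp [M, hired] at h1
  obtain ⟨n, hn⟩ := Nat.exists_eq_succ_of_ne_zero h0
  have h2 := Nat.find_min hex (m := n) (by omega)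
  rw [hn, Nat.succ_eq_add_one, M_succ_eq] at h1
  refine ⟨n, ?_⟩
  split_ifs at h1 with hlt
  · exact ⟨by omega, hlt⟩
  · omega

theorem measurableSet_forall_lt_E {Ω : Type*} [MeasurableSpace Ω] {X : ℕ → Ω → ℝ}
    (hr : IsRankSequence r) (hX : ∀ n, 1 ≤ n → Measurable (X n)) (F : Finset ℕ) (τ : ℕ → ℝ) :
    MeasurableSet {ω | ∀ k ∈ F, τ k < E r (fun i => X i ω) k} := by
  have : {ω | ∀ k ∈ F, τ k < E r (fun i => X i ω) k} =
      ⋂ k ∈ F, {ω | τ k < E r (fun i => X i ω) k} := by ext; simp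
  rw [this]
  exact F.measurableSet_biInter fun k _ => measurableSet_lt measurable_const (measurable_E hr hX k)

/-- Splitting according to the time of acceptance number `m + 1` and the set of high values makes
both random objects constant, so the shift applies piece by piece with the same factor. -/
theorem measure_forall_lt_E_and_lt_E_succ (hr : IsRankSequence r)
    (hX : ∀ n, 1 ≤ n → Measurable (X n))
    (hXindep : iIndepFun (fun n : {n : ℕ // 1 ≤ n} => X n) μ)
    (hXlaw : ∀ n, 1 ≤ n → HasLaw (X n) (expMeasure 1) μ) {m : ℕ} (hrm : r (m + 1) = r m)
    {F : Finset ℕ} (hF : ∀ k ∈ F, k ≤ m) (τ : ℕ → ℝ) {t : ℝ} (ht : 0 ≤ t) :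
    μ {ω | (∀ k ∈ F, τ k < E r (fun i => X i ω) k) ∧ t < E r (fun i => X i ω) (m + 1)} =
      ENNReal.ofReal (Real.exp (-t)) * μ {ω | ∀ k ∈ F, τ k < E r (fun i => X i ω) k} := by
  have hr0 : (0 : ℝ) < r m := by exact_mod_cast hr.pos m
  set A : ℕ × Finset ℕ → Set Ω := fun p => {ω | thr r (fun i => X i ω) p.1 < X (p.1 + 1) ω ∧
    above r (fun i => X i ω) p.1 = p.2 ∧ M r (fun i => X i ω) p.1 = m} with hA
  have hAm : ∀ p, MeasurableSet (A p) := fun p => by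
    refine MeasurableSet.inter ?_ (MeasurableSet.inter ?_ ?_)
    · exact measurableSet_lt (measurable_thr hr fun k h1 _ => hX k h1) (hX _ (by omega))
    · exact measurable_above hr (fun k h1 _ => hX k h1) p.2
    · exact measurableSet_eq_fun (measurable_M hr fun k h1 _ => hX k h1) measurable_const
  have hlt : ∀ n n' ω, n < n' → thr r (fun i => X i ω) n < X (n + 1) ω →
      M r (fun i => X i ω) n = m → M r (fun i => X i ω) n' = m → False := by
    intro n n' ω hnn h1 h2 h3
    have h4 := M_mono r (fun i => X i ω) (Nat.succ_le_of_lt hnn)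
    rw [Nat.succ_eq_add_one, M_succ_of_lt h1] at h4
    omega
  have hAd : Pairwise (Function.onFun Disjoint A) := by
    rintro ⟨n, S⟩ ⟨n', S'⟩ hne
    refine Set.disjoint_left.2 ?_
    rintro ω ⟨h1, h2, h3⟩ ⟨h1', h2', h3'⟩
    simp only at h1 h2 h3 h1' h2' h3'
    rcases lt_trichotomy n n' with h | h | h
    · exact hlt n n' ω h h1 h3 h3'
    · subst h
      exact hne (by rw [← h2, ← h2'])
    · exact hlt n' n ω h h1' h3' h3
  have hcov : ∀ᵐ ω ∂μ, ∃ p, ω ∈ A p := by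
    filter_upwards [ae_tendsto_M_atTop hr hX hXindep hXlaw] with ω h
    obtain ⟨n, h1, h2⟩ := exists_M_eq_and_lt h m
    exact ⟨(n, above r (fun i => X i ω) n), h2, rfl, h1⟩
  have hQm := measurableSet_forall_lt_E hr hX F τ
  have hBm : MeasurableSet {ω | (∀ k ∈ F, τ k < E r (fun i => X i ω) k) ∧
      t < E r (fun i => X i ω) (m + 1)} :=
    hQm.inter (measurableSet_lt measurable_const (measurable_E hr hX _))
  rw [measure_eq_tsum_inter hAd hAm hcov hBm, measure_eq_tsum_inter hAd hAm hcov hQm,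
    ← ENNReal.tsum_mul_left]
  refine tsum_congr fun ⟨n, S⟩ => ?_
  -- All indices in `F` are at most `m`, so on `M r x n = m` this is a property of the history up to
  -- `n`, as the shift requires.
  set G : (ℕ → ℝ) → Prop := fun x => M r x n = m ∧ ∀ k ∈ F, τ k < E r x k with hGdef
  have hG : ∀ x x', (∀ k ≤ n, hired r x k = hired r x' k ∧ thr r x k = thr r x' k) →
      G x → G x' := by
    rintro x x' h ⟨h1, h2⟩
    refine ⟨by rw [← h1, M, M, (h n le_rfl).1], fun k hk => ?_⟩
    have hY : ∀ j ≤ m, Y r x j = Y r x' j := fun j hj =>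
      Y_congr_of_hired (fun k hk => (h k hk).1) (fun k hk => (h k hk).2) (h1 ▸ hj)
    have := h2 k hk
    have := hF k hk
    rwa [E, ← hY k (by omega), ← hY (k - 1) (by omega), ← E]
  have hGm : MeasurableSet {u : ℕ → ℝ | G fun i => u (i - 1)} := by
    have hm : ∀ k, 1 ≤ k → Measurable fun u : ℕ → ℝ => u (k - 1) := fun k _ =>
      measurable_pi_apply (k - 1)
    refine MeasurableSet.inter ?_ (measurableSet_forall_lt_E (X := fun i (u : ℕ → ℝ) => u (i - 1)) hr hm F τ)
    exact measurableSet_eq_fun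
      (measurable_M (X := fun i (u : ℕ → ℝ) => u (i - 1)) hr fun k h1 _ => hm k h1) measurable_const
  by_cases hS : S.card = r m
  · have hshift := measure_acceptedAbove_shift hr hX hXindep hXlaw (S := S) hG hGm
      (s := t / r m) (by positivity)
    rw [hS, ← ENNReal.ofReal_pow (Real.exp_pos _).le, ← Real.exp_nat_mul] at hshift
    -- The `r m` coordinates, each shifted by `t / r m`, together cost `e^{-t}` whatever the piece.
    have e : (r m : ℝ) * -(t / r m) = -t := by field_simp
    rw [e] at hshift
    have e1 : ({ω | ∀ k ∈ F, τ k < E r (fun i => X i ω) k} ∩ A (n, S) : Set Ω) =ᵐ[μ]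
        {ω | AcceptedAbove r n S G fun i => X i ω} := by
      filter_upwards [ae_pos hXlaw] with ω hpos
      refine propext ⟨?_, ?_⟩
      · rintro ⟨h1, h2, h3, h4⟩
        exact ⟨hpos, h2, h3, h4, h1⟩
      · rintro ⟨_, h2, h3, h4, h1⟩
        exact ⟨h1, h2, h3, h4⟩
    have e2 : ({ω | (∀ k ∈ F, τ k < E r (fun i => X i ω) k) ∧ t < E r (fun i => X i ω) (m + 1)} ∩
        A (n, S) : Set Ω) =ᵐ[μ] {ω | AcceptedAbove r n S G (fun i => X i ω) ∧
          ∀ i ∈ S, thr r (fun i => X i ω) n + t / r m < X i ω} := by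
      filter_upwards [ae_pos hXlaw, ae_inj hX hXindep hXlaw] with ω hpos hinj
      have key : thr r (fun i => X i ω) n < X (n + 1) ω → above r (fun i => X i ω) n = S →
          M r (fun i => X i ω) n = m → (t < E r (fun i => X i ω) (m + 1) ↔
            ∀ i ∈ S, thr r (fun i => X i ω) n + t / r m < X i ω) := by
        intro h1 h2 h3
        have hY1 : Y r (fun i => X i ω) (m + 1) = thr r (fun i => X i ω) (n + 1) := by
          rw [← Y_M, M_succ_of_lt h1, h3]
        have hY0 : Y r (fun i => X i ω) m = thr r (fun i => X i ω) n := by rw [← Y_M, h3]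
        rw [E, Nat.add_sub_cancel, hY1, hY0, hrm, ← h2, ← lt_thr_succ_iff hr hpos hinj h1
          (by rw [h3]; exact hrm) (le_add_of_nonneg_right (by positivity)), ← div_lt_iff₀' hr0,
          lt_sub_iff_add_lt']
      refine propext ⟨?_, ?_⟩
      · rintro ⟨⟨h1, h5⟩, h2, h3, h4⟩
        exact ⟨⟨hpos, h2, h3, h4, h1⟩, (key h2 h3 h4).1 h5⟩
      · rintro ⟨⟨_, h2, h3, h4, h1⟩, h5⟩
        exact ⟨⟨h1, (key h2 h3 h4).2 h5⟩, h2, h3, h4⟩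
    rw [measure_congr e1, measure_congr e2]
    exact hshift
  · have h0 : μ (A (n, S)) = 0 := by
      have : ∀ᵐ ω ∂μ, ω ∉ A (n, S) := by
        filter_upwards [ae_pos hXlaw, ae_inj hX hXindep hXlaw] with ω hpos hinj
        rintro ⟨h1, h2, h3⟩
        refine hS ?_
        simp only at h1 h2 h3
        rw [← h2, card_above hr hpos hinj h1, h3]
      simpa [ae_iff] using this
    rw [measure_mono_null Set.inter_subset_right h0, measure_mono_null Set.inter_subset_right h0,
      mul_zero]

theorem hasLaw_E (hr : IsRankSequence r) (hX : ∀ n, 1 ≤ n → Measurable (X n))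
    (hXindep : iIndepFun (fun n : {n : ℕ // 1 ≤ n} => X n) μ)
    (hXlaw : ∀ n, 1 ≤ n → HasLaw (X n) (expMeasure 1) μ) {k : ℕ} (hk : 1 ≤ k)
    (hrk : r k = r (k - 1)) :
    HasLaw (fun ω => E r (fun i => X i ω) k) (expMeasure 1) μ := by
  obtain ⟨m, rfl⟩ := Nat.exists_eq_add_of_le' hk
  have hm := measurable_E hr hX (m + 1)
  have := Measure.isProbabilityMeasure_map (μ := μ) hm.aemeasurable
  refine ⟨hm.aemeasurable, eq_expMeasure fun t ht => ?_⟩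
  rw [Measure.map_apply hm measurableSet_Ioi]
  have := measure_forall_lt_E_and_lt_E_succ hr hX hXindep hXlaw hrk (F := ∅) (by simp)
    (fun _ => 0) ht
  simpa [Set.preimage, Set.Ioi] using this

/-- Induction on the largest index, which splits off as the newest jump. Negative levels, outside
the scope of the shift, are exceeded almost surely. -/
theorem measure_forall_lt_E (hr : IsRankSequence r) (hX : ∀ n, 1 ≤ n → Measurable (X n))
    (hXindep : iIndepFun (fun n : {n : ℕ // 1 ≤ n} => X n) μ)
    (hXlaw : ∀ n, 1 ≤ n → HasLaw (X n) (expMeasure 1) μ) (τ : ℕ → ℝ) (F : Finset ℕ) :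
    (∀ k ∈ F, 1 ≤ k ∧ r k = r (k - 1)) → μ {ω | ∀ k ∈ F, τ k < E r (fun i => X i ω) k} =
      ∏ k ∈ F, μ {ω | τ k < E r (fun i => X i ω) k} := by
  induction F using Finset.induction_on_max with
  | empty => simp
  | insert a s hmax ih =>
    intro hF
    have ha := hF a (Finset.mem_insert_self _ _)
    have ih' := ih fun k hk => hF k (Finset.mem_insert_of_mem hk)
    rw [Finset.prod_insert fun h => lt_irrefl _ (hmax a h), ← ih']
    have hlaw := hasLaw_E hr hX hXindep hXlaw ha.1 ha.2
    have hset : {ω | ∀ k ∈ insert a s, τ k < E r (fun i => X i ω) k} =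
        {ω | (∀ k ∈ s, τ k < E r (fun i => X i ω) k) ∧ τ a < E r (fun i => X i ω) a} := by
      ext ω
      simp only [Set.mem_ofPred_eq, Finset.forall_mem_insert]
      exact and_comm
    have hone : μ {ω | τ a < E r (fun i => X i ω) a} = expMeasure 1 (Set.Ioi (τ a)) := by
      exact hlaw.measure_eq (p := fun y => τ a < y) measurableSet_Ioi
    rw [hset]
    rcases le_or_gt 0 (τ a) with h0 | h0
    · obtain ⟨m, rfl⟩ := Nat.exists_eq_add_of_le' ha.1
      rw [hone, expMeasure_Ioi h0]
      exact measure_forall_lt_E_and_lt_E_succ hr hX hXindep hXlaw ha.2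
        (fun k hk => by have := hmax k hk; omega) τ h0
    · have hae : ∀ᵐ ω ∂μ, τ a < E r (fun i => X i ω) a := by
        filter_upwards [(hlaw.ae_iff (p := fun y => 0 < y)
          (measurableSet_setOfPred.1 measurableSet_Ioi)).2 ae_pos_expMeasure] with ω h
        exact h0.trans h
      have h1 : μ {ω | τ a < E r (fun i => X i ω) a} = 1 := (measure_congr (eventuallyEq_univ.2 hae)).trans measure_univ
      rw [h1, one_mul]
      refine measure_congr ?_
      filter_upwards [hae] with ω h
      exact propext ⟨fun h' => h'.1, fun h' => ⟨h', h⟩⟩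

theorem iIndepFun_E (hr : IsRankSequence r) (hX : ∀ n, 1 ≤ n → Measurable (X n))
    (hXindep : iIndepFun (fun n : {n : ℕ // 1 ≤ n} => X n) μ)
    (hXlaw : ∀ n, 1 ≤ n → HasLaw (X n) (expMeasure 1) μ) :
    iIndepFun (fun (k : {k : ℕ // 1 ≤ k ∧ r k = r (k - 1)}) (ω : Ω) =>
      E r (fun n => X n ω) k) μ := by
  rw [iIndepFun_iff_iIndep]
  refine iIndepSets.iIndep (fun k => (measurable_E hr hX k).comap_le)
    (fun k => {s | ∃ t ∈ Set.range (Set.Ioi : ℝ → Set ℝ), (fun ω => E r (fun n => X n ω) k) ⁻¹' t = s})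
    (fun k => isPiSystem_Ioi.comap _) (fun k => ?_) ?_
  · rw [BorelSpace.measurable_eq (α := ℝ), borel_eq_generateFrom_Ioi,
      MeasurableSpace.comap_generateFrom]
    rfl
  · rw [iIndepSets_iff]
    intro s f hf
    have hτ : ∀ k : {k : ℕ // 1 ≤ k ∧ r k = r (k - 1)}, ∃ t : ℝ, k ∈ s →
        f k = {ω | t < E r (fun n => X n ω) k} := fun k => by
      by_cases hk : k ∈ s
      · obtain ⟨_, ⟨t, rfl⟩, ht⟩ := hf k hk
        exact ⟨t, fun _ => ht.symm⟩
      · exact ⟨0, fun h => absurd h hk⟩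
    choose τ hτ using hτ
    set τ' : ℕ → ℝ := Function.extend Subtype.val τ 0
    have hτ' : ∀ k : {k : ℕ // 1 ≤ k ∧ r k = r (k - 1)}, τ' k = τ k := fun k =>
      Subtype.val_injective.extend_apply τ 0 k
    have h := measure_forall_lt_E hr hX hXindep hXlaw τ' (s.map (Function.Embedding.subtype _))
      (fun k hk => by
        obtain ⟨j, _, rfl⟩ := Finset.mem_map.1 hk
        exact j.2)
    rw [Finset.prod_map] at h
    have e1 : (⋂ i ∈ s, f i) =
        {ω | ∀ k ∈ s.map (Function.Embedding.subtype _), τ' k < E r (fun i => X i ω) k} := by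
      ext ω
      simp only [Set.mem_iInter, Set.mem_ofPred_eq, Finset.forall_mem_map]
      refine forall₂_congr fun k hk => ?_
      rw [hτ k hk]
      simp [hτ']
    rw [e1, h]
    refine Finset.prod_congr rfl fun k hk => ?_
    rw [hτ k hk]
    simp [hτ']

end model

/-! ### Almost sure asymptotics along a path -/

section paths

variable {r : ℕ → ℕ} {x : ℕ → ℝ}

/-- The `k`-th term of the series `Z`. -/
noncomputable def noise (r : ℕ → ℕ) (x : ℕ → ℝ) (k : ℕ) : ℝ :=
  delta r k / (r k : ℝ) * (E r x k - 1)

theorem Y_succ_eq (hr : IsRankSequence r) (hx : ∀ i, 1 ≤ i → 0 < x i)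
    (hinj : ∀ i j, 1 ≤ i → 1 ≤ j → x i = x j → i = j) (hM : Tendsto (M r x) atTop atTop) {m : ℕ}
    (hrm : r (m + 1) = r m + 1) : Y r x (m + 1) = Y r x m := by
  obtain ⟨n, rfl, h2⟩ := exists_M_eq_and_lt hM m
  rw [← M_succ_of_lt h2, Y_M, Y_M]
  exact thr_succ_eq hr hx hinj h2 hrm

/-- At a jump the increment is `E_k / r k`, split into its mean and the centred term; without a jump
both sides stay constant. -/
theorem Y_eq_sum (hr : IsRankSequence r) (hx : ∀ i, 1 ≤ i → 0 < x i)
    (hinj : ∀ i j, 1 ≤ i → 1 ≤ j → x i = x j → i = j) (hM : Tendsto (M r x) atTop atTop) (m : ℕ) :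
    Y r x m = ∑ k ∈ Finset.Icc 1 m, delta r k / (r k : ℝ) + ∑ k ∈ Finset.Icc 1 m, noise r x k := by
  induction m with
  | zero => simp [Y_zero hr]
  | succ m ih =>
    rw [Finset.sum_Icc_succ_top (by omega), Finset.sum_Icc_succ_top (by omega)]
    have hr0 : (0 : ℝ) < r (m + 1) := by exact_mod_cast hr.pos (m + 1)
    have hstep : Y r x (m + 1) - Y r x m = delta r (m + 1) / (r (m + 1) : ℝ) + noise r x (m + 1) := by
      rw [noise, E, Nat.add_sub_cancel]
      by_cases h : r (m + 1) = r m
      · simp only [delta, Nat.add_sub_cancel, if_pos h]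
        field_simp
        ring
      · rw [Y_succ_eq hr hx hinj hM (by have := hr.2 m; omega)]
        simp [delta, h]
    linarith

theorem W_pos (r : ℕ → ℕ) (α z : ℝ) : 0 < W r α z := by
  rw [W]; positivity

variable {α z : ℝ}

theorem tendsto_M_div_rpow_and_exp_neg_thr (hr : IsRankSequence r) (hx : ∀ i, 1 ≤ i → 0 < x i)
    (hinj : ∀ i j, 1 ≤ i → 1 ≤ j → x i = x j → i = j) (hα0 : 0 < α)
    (hsum : Summable fun m : ℕ => |1 / (r (m + 1) : ℝ) - 1 / (α * ((m + 1 : ℕ) : ℝ))|)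
    (hZ : Tendsto (fun m => ∑ k ∈ Finset.Icc 1 m, noise r x k) atTop (𝓝 z))
    (hs : ∃ s, Tendsto (fun n => ∑ i ∈ Finset.range n, hireDiff r x i) atTop (𝓝 s)) :
    Tendsto (fun n : ℕ => (M r x n : ℝ) / (n : ℝ) ^ α) atTop (𝓝 (W r α z)) ∧
    Tendsto (fun n : ℕ => Real.exp (-thr r x n) / (α * (M r x (n + 1) : ℝ) / ((n + 1 : ℕ) : ℝ)))
      atTop (𝓝 1) := by
  obtain ⟨s, hs⟩ := hs
  have hm : ∀ n, M r x (n + 1) = M r x n ∨ M r x (n + 1) = M r x n + 1 := fun n => by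
    rw [M_succ_eq]; split_ifs <;> omega
  have hM : Tendsto (M r x) atTop atTop := tendsto_atTop_of_sum_tendsto (y := Y r x) hm hs
  have hC : 0 < expConst r α z := by rw [expConst]; positivity
  have hexp := tendsto_exp_div_rpow hr hα0 hsum hZ (Y_eq_sum hr hx hinj hM)
  have hD := tendsto_div_rpow_of_sum_tendsto (by simp [M, hired]) hm
    (by simpa only [Y_M] using thr_mono hr hx) hs hα0 hexp
  refine ⟨?_, ?_⟩
  · rw [W_eq r hα0]
    exact tendsto_div_rpow_of_tendsto_inv hα0 (by positivity) hD
  · simpa only [Y_M] using tendsto_exp_neg_div hm hM hα0 hC hexp hD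

theorem tendsto_mul_div_div (hα0 : 0 < α)
    (hM : Tendsto (fun n : ℕ => (M r x n : ℝ) / (n : ℝ) ^ α) atTop (𝓝 (W r α z))) :
    Tendsto (fun n : ℕ => (α * (M r x n : ℝ) / (n : ℝ)) / (α * W r α z * (n : ℝ) ^ (α - 1)))
      atTop (𝓝 1) := by
  have hW := W_pos r α z
  have h := hM.div_const (W r α z)
  rw [div_self hW.ne'] at h
  refine h.congr' ?_
  filter_upwards [eventually_gt_atTop 0] with n hn
  have hn' : (0 : ℝ) < n := by positivity
  rw [Real.rpow_sub hn', Real.rpow_one]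
  field_simp

theorem tendsto_exp_neg_thr_mul_rpow (hα0 : 0 < α)
    (hM : Tendsto (fun n : ℕ => (M r x n : ℝ) / (n : ℝ) ^ α) atTop (𝓝 (W r α z)))
    (hP : Tendsto (fun n : ℕ => Real.exp (-thr r x n) /
      (α * (M r x (n + 1) : ℝ) / ((n + 1 : ℕ) : ℝ))) atTop (𝓝 1)) :
    Tendsto (fun n : ℕ => Real.exp (-thr r x n) * ((n + 1 : ℕ) : ℝ) ^ (1 - α)) atTop
      (𝓝 (α * W r α z)) := by
  have hW := W_pos r α z
  have h := hP.mul ((tendsto_add_atTop_iff_nat 1).2 (tendsto_mul_div_div hα0 hM))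
  have h' := h.mul_const (α * W r α z)
  rw [one_mul, one_mul] at h'
  refine h'.congr' ?_
  -- The positive limit makes the count eventually nonzero, so that it can be cancelled.
  filter_upwards [((tendsto_add_atTop_iff_nat 1).2 hM).eventually_const_lt hW] with n hn
  have hn' : (0 : ℝ) < ((n + 1 : ℕ) : ℝ) := by positivity
  have hMpos : (0 : ℝ) < M r x (n + 1) := by
    rcases (Nat.cast_nonneg (α := ℝ) (M r x (n + 1))).eq_or_lt with h0 | h0
    · rw [← h0, zero_div] at hn; exact absurd hn (lt_irrefl _)
    · exact h0
  have e : ((n + 1 : ℕ) : ℝ) ^ (1 - α) = (((n + 1 : ℕ) : ℝ) ^ (α - 1))⁻¹ := by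
    rw [← Real.rpow_neg hn'.le]; congr 1; ring
  have hp : 0 < ((n + 1 : ℕ) : ℝ) ^ (α - 1) := by positivity
  rw [e]
  generalize ((n + 1 : ℕ) : ℝ) ^ (α - 1) = p at hp
  field_simp

end paths

/-! ### Long runs of rejections -/

section asymptotics

/-- Squeezed by `exp (-c / (1 - c)) ≤ 1 - c ≤ exp (-c)` for `c < 1`. -/
theorem tendsto_one_sub_pow {c : ℕ → ℝ} {j : ℕ → ℕ} {l : ℝ}
    (hc : Tendsto c atTop (𝓝 0)) (h : Tendsto (fun n => (j n : ℝ) * c n) atTop (𝓝 l)) :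
    Tendsto (fun n => (1 - c n) ^ j n) atTop (𝓝 (Real.exp (-l))) := by
  have h1 : Tendsto (fun n => Real.exp (-((j n : ℝ) * c n))) atTop (𝓝 (Real.exp (-l))) :=
    (Real.continuous_exp.tendsto _).comp h.neg
  have h2 : Tendsto (fun n => Real.exp (-((j n : ℝ) * c n / (1 - c n)))) atTop
      (𝓝 (Real.exp (-l))) := by
    have h3 : Tendsto (fun n => (j n : ℝ) * c n / (1 - c n)) atTop (𝓝 (l / (1 - 0))) :=
      h.div (hc.const_sub 1) (by norm_num)
    rw [sub_zero, div_one] at h3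
    exact (Real.continuous_exp.tendsto _).comp h3.neg
  have hlt := hc.eventually_lt_const one_pos
  refine tendsto_of_tendsto_of_tendsto_of_le_of_le' h2 h1 ?_ ?_
  · filter_upwards [hlt] with n hn
    have h4 : 0 < 1 - c n := by linarith
    rw [mul_div_assoc, ← mul_neg, Real.exp_nat_mul]
    refine pow_le_pow_left₀ (Real.exp_pos _).le ?_ _
    rw [Real.exp_neg]
    refine inv_le_of_inv_le₀ h4 (le_trans (le_of_eq ?_) (Real.add_one_le_exp _))
    field_simp
    ring
  · filter_upwards [hlt] with n hn
    rw [← mul_neg, Real.exp_nat_mul]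
    exact pow_le_pow_left₀ (by linarith) (by linarith [Real.add_one_le_exp (-c n)]) _

variable {α t : ℝ}

/-- `L_n > t n^{1 - α}` if and only if `L_n ≥ gap α t n`. -/
noncomputable def gap (α t : ℝ) (n : ℕ) : ℕ := ⌊t * (n : ℝ) ^ (1 - α)⌋₊ + 1

theorem tendsto_gap_div_rpow (hα1 : α < 1) (ht : 0 ≤ t) :
    Tendsto (fun n : ℕ => (gap α t n : ℝ) / (n : ℝ) ^ (1 - α)) atTop (𝓝 t) := by
  have hp : Tendsto (fun n : ℕ => (n : ℝ) ^ (1 - α)) atTop atTop :=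
    (tendsto_rpow_atTop (by linarith)).comp tendsto_natCast_atTop_atTop
  have h := ((tendsto_nat_floor_mul_div_atTop ht).comp hp).add (hp.const_div_atTop 1)
  rw [add_zero] at h
  refine h.congr fun n => ?_
  simp only [Function.comp, gap]
  push_cast
  ring

theorem tendsto_gap_div (hα0 : 0 < α) (hα1 : α < 1) (ht : 0 ≤ t) :
    Tendsto (fun n : ℕ => (gap α t n : ℝ) / (n : ℝ)) atTop (𝓝 0) := by
  have h : Tendsto (fun n : ℕ => (n : ℝ) ^ (-α)) atTop (𝓝 0) :=
    (tendsto_rpow_neg_atTop hα0).comp tendsto_natCast_atTop_atTop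
  have h2 := (tendsto_gap_div_rpow hα1 ht).mul h
  rw [mul_zero] at h2
  refine h2.congr' ?_
  filter_upwards [eventually_gt_atTop 0] with n hn
  have hn' : (0 : ℝ) < n := by positivity
  rw [show 1 - α = 1 + -α by ring, Real.rpow_add hn', Real.rpow_one]
  field_simp

theorem eventually_gap_le (hα0 : 0 < α) (hα1 : α < 1) (ht : 0 ≤ t) :
    ∀ᶠ n : ℕ in atTop, gap α t n ≤ n := by
  filter_upwards [(tendsto_gap_div hα0 hα1 ht).eventually_lt_const one_pos, eventually_gt_atTop 0]
    with n h hn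
  have hn' : (0 : ℝ) < n := by positivity
  rw [div_lt_one hn'] at h
  exact_mod_cast h.le

/-- The gap is `o(n)`, so evaluating `c` at `n - gap α t n` instead of `n` does not affect the
limit. -/
theorem tendsto_one_sub_pow_gap (hα0 : 0 < α) (hα1 : α < 1) (ht : 0 ≤ t) {c : ℕ → ℝ} {w : ℝ}
    (hc : Tendsto (fun n : ℕ => c n * ((n + 1 : ℕ) : ℝ) ^ (1 - α)) atTop (𝓝 w)) :
    Tendsto (fun n => (1 - c (n - gap α t n)) ^ gap α t n) atTop (𝓝 (Real.exp (-(t * w)))) := by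
  have hfrac : Tendsto (fun n : ℕ => ((n - gap α t n + 1 : ℕ) : ℝ) / (n : ℝ)) atTop (𝓝 1) := by
    have h := ((tendsto_gap_div hα0 hα1 ht).const_sub 1).add
      (tendsto_natCast_atTop_atTop.const_div_atTop (1 : ℝ))
    rw [sub_zero, add_zero] at h
    refine h.congr' ?_
    filter_upwards [eventually_gap_le hα0 hα1 ht, eventually_gt_atTop 0] with n hg hn
    have hn' : (0 : ℝ) < n := by positivity
    rw [Nat.cast_add, Nat.cast_sub hg]
    field_simp
    push_cast
    ring
  have htop : Tendsto (fun n : ℕ => n - gap α t n) atTop atTop := by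
    have h := hfrac.pos_mul_atTop one_pos tendsto_natCast_atTop_atTop
    have h2 : Tendsto (fun n : ℕ => ((n - gap α t n + 1 : ℕ) : ℝ)) atTop atTop := by
      refine h.congr' ?_
      filter_upwards [eventually_gt_atTop 0] with n hn
      have hn' : (0 : ℝ) < n := by positivity
      field_simp
    refine tendsto_atTop.2 fun b => ?_
    filter_upwards [(tendsto_natCast_atTop_iff.1 h2).eventually_ge_atTop (b + 1)] with n h
    omega
  have hpow : Tendsto (fun n : ℕ => ((n : ℝ) / ((n - gap α t n + 1 : ℕ) : ℝ)) ^ (1 - α)) atTop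
      (𝓝 1) := by
    have h := (hfrac.inv₀ one_ne_zero).rpow_const (p := 1 - α) (Or.inl (by norm_num))
    rw [inv_one, Real.one_rpow] at h
    simpa only [inv_div] using h
  have hjc : Tendsto (fun n => (gap α t n : ℝ) * c (n - gap α t n)) atTop (𝓝 (t * w)) := by
    have h := ((tendsto_gap_div_rpow hα1 ht).mul hpow).mul (hc.comp htop)
    rw [mul_one] at h
    refine h.congr' ?_
    filter_upwards [eventually_gt_atTop 0] with n hn
    have hn' : (0 : ℝ) < n := by positivity
    have hk : (0 : ℝ) < ((n - gap α t n + 1 : ℕ) : ℝ) := by positivity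
    simp only [Function.comp]
    rw [Real.div_rpow hn'.le hk.le]
    have h1 : 0 < (n : ℝ) ^ (1 - α) := by positivity
    have h2 : 0 < ((n - gap α t n + 1 : ℕ) : ℝ) ^ (1 - α) := by positivity
    field_simp
  have hc' : Tendsto c atTop (𝓝 0) := by
    have hp : Tendsto (fun n : ℕ => ((n + 1 : ℕ) : ℝ) ^ (1 - α)) atTop atTop :=
      (tendsto_rpow_atTop (by linarith)).comp
        (tendsto_natCast_atTop_atTop.comp (tendsto_add_atTop_nat 1))
    refine (hc.div_atTop hp).congr fun n => ?_
    have : 0 < ((n + 1 : ℕ) : ℝ) ^ (1 - α) := by positivity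
    field_simp
  exact tendsto_one_sub_pow (hc'.comp htop) hjc

theorem lt_L_div_iff (r : ℕ → ℕ) (x : ℕ → ℝ) (ht : 0 ≤ t) {n : ℕ} (hn : 0 < n)
    (hg : gap α t n ≤ n) :
    t < L r x n / (n : ℝ) ^ (1 - α) ↔ M r x n = M r x (n - gap α t n) := by
  have hn' : (0 : ℝ) < n := by positivity
  have hL : L r x n = ((n - N r x (M r x n) : ℕ) : ℝ) := by
    rw [L, Nat.cast_sub (N_le le_rfl)]
  rw [← L_ge_iff r x hg, lt_div_iff₀ (by positivity), hL, Nat.cast_le, gap, Nat.succ_le_iff,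
    Nat.floor_lt (by positivity)]

theorem L_nonneg (r : ℕ → ℕ) (x : ℕ → ℝ) (n : ℕ) : 0 ≤ L r x n := by
  rw [L, sub_nonneg, Nat.cast_le]
  exact N_le le_rfl

end asymptotics

/-! ### Convergence of the series `Z` -/

section noise

variable {Ω : Type*} {mΩ : MeasurableSpace Ω} {μ : Measure Ω} {X : ℕ → Ω → ℝ} {r : ℕ → ℕ} {α : ℝ}

/-- The `σ`-algebras generated by the `E_k` with `δ_k = 1` and `k ≤ n`. -/
noncomputable def jumpFiltration (r : ℕ → ℕ) (hr : IsRankSequence r) (X : ℕ → Ω → ℝ)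
    (hX : ∀ n, 1 ≤ n → Measurable (X n)) : Filtration ℕ mΩ where
  seq n := ⨆ k ∈ {k : {k : ℕ // 1 ≤ k ∧ r k = r (k - 1)} | (k : ℕ) ≤ n},
    MeasurableSpace.comap (fun ω => E r (fun i => X i ω) k) inferInstance
  mono' _ _ hab := biSup_mono fun _ hk => le_trans hk hab
  le' _ := iSup₂_le fun k _ => (measurable_E hr hX k).comap_le

theorem noise_of_ne {x : ℕ → ℝ} {k : ℕ} (h : r k ≠ r (k - 1)) : noise r x k = 0 := by
  simp [noise, delta, h]

theorem noise_of_eq {x : ℕ → ℝ} {k : ℕ} (h : r k = r (k - 1)) :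
    noise r x k = 1 / (r k : ℝ) * (E r x k - 1) := by
  simp [noise, delta, h]

theorem measurable_noise (hr : IsRankSequence r) (hX : ∀ n, 1 ≤ n → Measurable (X n)) (k : ℕ) :
    Measurable fun ω => noise r (fun i => X i ω) k :=
  ((measurable_E hr hX k).sub_const 1).const_mul _

theorem stronglyMeasurable_noise (hr : IsRankSequence r) (hX : ∀ n, 1 ≤ n → Measurable (X n))
    (n : ℕ) : StronglyMeasurable[jumpFiltration r hr X hX (n + 1)]
      fun ω => noise r (fun i => X i ω) (n + 1) := by
  by_cases h : r (n + 1) = r (n + 1 - 1)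
  · have hle : MeasurableSpace.comap (fun ω => E r (fun i => X i ω) (n + 1)) inferInstance ≤
        jumpFiltration r hr X hX (n + 1) :=
      le_iSup₂_of_le (f := fun (k : {k : ℕ // 1 ≤ k ∧ r k = r (k - 1)})
        (_ : k ∈ {k : {k : ℕ // 1 ≤ k ∧ r k = r (k - 1)} | (k : ℕ) ≤ n + 1}) =>
          MeasurableSpace.comap (fun ω => E r (fun i => X i ω) k) inferInstance)
        ⟨n + 1, by omega, h⟩ (le_refl (n + 1)) le_rfl
    have hE : Measurable[jumpFiltration r hr X hX (n + 1)] fun ω => E r (fun i => X i ω) (n + 1) :=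
      (comap_measurable _).mono hle le_rfl
    exact ((hE.sub_const 1).const_mul _).stronglyMeasurable
  · simp only [noise_of_ne h]
    exact stronglyMeasurable_const

variable [IsProbabilityMeasure μ]

theorem memLp_noise (hr : IsRankSequence r) (hX : ∀ n, 1 ≤ n → Measurable (X n))
    (hXindep : iIndepFun (fun n : {n : ℕ // 1 ≤ n} => X n) μ)
    (hXlaw : ∀ n, 1 ≤ n → HasLaw (X n) (expMeasure 1) μ) (n : ℕ) :
    MemLp (fun ω => noise r (fun i => X i ω) (n + 1)) 2 μ := by
  by_cases h : r (n + 1) = r (n + 1 - 1)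
  · have hlaw := hasLaw_E hr hX hXindep hXlaw (by omega) h
    simp only [noise_of_eq h]
    refine MemLp.const_mul ?_ _
    have := memLp_sub_one_expMeasure
    rw [← hlaw.map_eq] at this
    exact this.comp_of_map hlaw.aemeasurable
  · simp only [noise_of_ne h]
    exact MemLp.zero'

theorem integral_noise (hr : IsRankSequence r) (hX : ∀ n, 1 ≤ n → Measurable (X n))
    (hXindep : iIndepFun (fun n : {n : ℕ // 1 ≤ n} => X n) μ)
    (hXlaw : ∀ n, 1 ≤ n → HasLaw (X n) (expMeasure 1) μ) (n : ℕ) :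
    ∫ ω, noise r (fun i => X i ω) (n + 1) ∂μ = 0 := by
  by_cases h : r (n + 1) = r (n + 1 - 1)
  · have hlaw := hasLaw_E hr hX hXindep hXlaw (by omega) h
    have := hlaw.integral_comp (f := fun x : ℝ => x - 1) (by fun_prop)
    simp only [noise_of_eq h, integral_const_mul]
    rw [show ∫ ω, (E r (fun i => X i ω) (n + 1) - 1) ∂μ = 0 from
      this.trans integral_sub_one_expMeasure, mul_zero]
  · simp [noise_of_ne h]

theorem integral_noise_sq_le (hr : IsRankSequence r) (hX : ∀ n, 1 ≤ n → Measurable (X n))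
    (hXindep : iIndepFun (fun n : {n : ℕ // 1 ≤ n} => X n) μ)
    (hXlaw : ∀ n, 1 ≤ n → HasLaw (X n) (expMeasure 1) μ) (n : ℕ) :
    ∫ ω, noise r (fun i => X i ω) (n + 1) ^ 2 ∂μ ≤
      1 / (r (n + 1) : ℝ) ^ 2 * ∫ x, (x - 1) ^ 2 ∂expMeasure 1 := by
  by_cases h : r (n + 1) = r (n + 1 - 1)
  · have hlaw := hasLaw_E hr hX hXindep hXlaw (by omega) h
    have := hlaw.integral_comp (f := fun x : ℝ => (x - 1) ^ 2) (by fun_prop)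
    simp only [noise_of_eq h, mul_pow, integral_const_mul, div_pow, one_pow]
    exact le_of_eq (congrArg _ this)
  · simp only [noise_of_ne h]
    have : 0 ≤ ∫ x : ℝ, (x - 1) ^ 2 ∂expMeasure 1 := integral_nonneg fun x => sq_nonneg _
    simp only [ne_eq, OfNat.ofNat_ne_zero, not_false_eq_true, zero_pow, integral_zero]
    positivity

/-- A jump term is centred and independent of the earlier jumps; the other terms vanish. -/
theorem condExp_noise (hr : IsRankSequence r) (hX : ∀ n, 1 ≤ n → Measurable (X n))
    (hXindep : iIndepFun (fun n : {n : ℕ // 1 ≤ n} => X n) μ)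
    (hXlaw : ∀ n, 1 ≤ n → HasLaw (X n) (expMeasure 1) μ) (n : ℕ) :
    μ[fun ω => noise r (fun i => X i ω) (n + 1) | jumpFiltration r hr X hX n] =ᵐ[μ] 0 := by
  by_cases h : r (n + 1) = r (n + 1 - 1)
  · have hind := indep_iSup_of_disjoint (ι := {k : ℕ // 1 ≤ k ∧ r k = r (k - 1)})
      (m := fun k => MeasurableSpace.comap (fun ω => E r (fun i => X i ω) k) inferInstance)
      (S := {⟨n + 1, by omega, h⟩}) (T := {k | (k : ℕ) ≤ n})
      (fun k => (measurable_E hr hX k).comap_le) (iIndepFun_E hr hX hXindep hXlaw).iIndep (by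
        rw [Set.disjoint_singleton_left]
        simp)
    rw [iSup_singleton] at hind
    have hm : StronglyMeasurable[MeasurableSpace.comap (fun ω => E r (fun i => X i ω) (n + 1))
        inferInstance] fun ω => noise r (fun i => X i ω) (n + 1) :=
      (((comap_measurable _).sub_const 1).const_mul _).stronglyMeasurable
    refine (condExp_indep_eq (measurable_E hr hX (n + 1)).comap_le
      ((jumpFiltration r hr X hX).le n) hm hind).trans ?_
    rw [integral_noise hr hX hXindep hXlaw n]
    rfl
  · simp only [noise_of_ne h]
    exact Eventually.of_forall fun ω => by rw [condExp_fun_zero]; rfl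

/-- The limit of `r m / m` gives `1 / r m = O(1 / m)`. -/
theorem summable_one_div_sq (hr : IsRankSequence r) (hα0 : 0 < α)
    (hsum : Summable fun m : ℕ => |1 / (r (m + 1) : ℝ) - 1 / (α * ((m + 1 : ℕ) : ℝ))|) :
    Summable fun m : ℕ => 1 / (r (m + 1) : ℝ) ^ 2 := by
  have h := ((tendsto_rank_div hr hα0 hsum).inv₀ hα0.ne').pow 2
  have hO : (fun m : ℕ => 1 / (r m : ℝ) ^ 2) =O[atTop] fun m : ℕ => 1 / (m : ℝ) ^ 2 := by
    refine (Asymptotics.IsBigO.of_bound' ?_).trans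
      ((Asymptotics.isBigO_refl (fun m : ℕ => 1 / (m : ℝ) ^ 2) atTop).const_mul_left
        (α⁻¹ ^ 2 + 1))
    filter_upwards [h.eventually_le_const (lt_add_one _), eventually_gt_atTop 0] with m hm hm0
    have hm0' : (0 : ℝ) < m := by positivity
    have hrm : (0 : ℝ) < r m := by exact_mod_cast hr.pos m
    rw [Real.norm_of_nonneg (by positivity), Real.norm_of_nonneg (by positivity)]
    have e : 1 / (r m : ℝ) ^ 2 = ((r m : ℝ) / m)⁻¹ ^ 2 * (1 / (m : ℝ) ^ 2) := by field_simp
    rw [e]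
    gcongr
  exact (summable_nat_add_iff 1).2 (summable_of_isBigO_nat
    (Real.summable_one_div_nat_pow.2 one_lt_two) hO)

theorem ae_exists_tendsto_sum_noise (hr : IsRankSequence r) (hX : ∀ n, 1 ≤ n → Measurable (X n))
    (hXindep : iIndepFun (fun n : {n : ℕ // 1 ≤ n} => X n) μ)
    (hXlaw : ∀ n, 1 ≤ n → HasLaw (X n) (expMeasure 1) μ) (hα0 : 0 < α)
    (hsum : Summable fun m : ℕ => |1 / (r (m + 1) : ℝ) - 1 / (α * ((m + 1 : ℕ) : ℝ))|) :
    ∀ᵐ ω ∂μ, ∃ z, Tendsto (fun m => ∑ k ∈ Finset.Icc 1 m, noise r (fun i => X i ω) k) atTop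
      (𝓝 z) := by
  have hV : 0 ≤ ∫ x : ℝ, (x - 1) ^ 2 ∂expMeasure 1 := integral_nonneg fun x => sq_nonneg _
  have hs := (summable_one_div_sq hr hα0 hsum).mul_right (∫ x : ℝ, (x - 1) ^ 2 ∂expMeasure 1)
  have h := ae_exists_tendsto_sum_of_condExp_eq_zero (stronglyMeasurable_noise hr hX)
    (memLp_noise hr hX hXindep hXlaw) (condExp_noise hr hX hXindep hXlaw) fun n =>
      (Finset.sum_le_sum fun i _ => integral_noise_sq_le hr hX hXindep hXlaw i).trans
        (hs.sum_le_tsum (Finset.range n) fun i _ => by positivity)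
  filter_upwards [h] with ω ⟨z, hz⟩
  refine ⟨z, hz.congr fun m => ?_⟩
  induction m with
  | zero => simp
  | succ m ih => rw [Finset.sum_range_succ, Finset.sum_Icc_succ_top (by omega), ih]

end noise

/-! ### The limit law of the time since the last acceptance -/

section limits

variable {Ω : Type*} {mΩ : MeasurableSpace Ω} {μ : Measure Ω}
  {X : ℕ → Ω → ℝ} {r : ℕ → ℕ} {α : ℝ} {Z : Ω → ℝ}

theorem expMeasure_Ioi_max (t : ℝ) :
    expMeasure 1 (Set.Ioi t) = ENNReal.ofReal (Real.exp (-max t 0)) := by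
  rcases le_or_gt 0 t with ht | ht
  · rw [max_eq_left ht, expMeasure_Ioi ht]
  · rw [max_eq_right ht.le, neg_zero, Real.exp_zero, ENNReal.ofReal_one]
    refine le_antisymm prob_le_one ?_
    calc (1 : ENNReal) = expMeasure 1 (Set.Ioi 0) := by rw [expMeasure_Ioi le_rfl]; simp
      _ ≤ _ := measure_mono (Set.Ioi_subset_Ioi ht.le)

theorem measurable_W (r : ℕ → ℕ) (α : ℝ) (hZ : Measurable Z) : Measurable fun ω => W r α (Z ω) := by
  unfold W
  fun_prop

/-- Integrating out the exponential coordinate; the maximum with `0` covers negative `t`. -/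
theorem prod_real_lt (hZ : Measurable Z) (hα0 : 0 < α) (t : ℝ) :
    (μ.prod (expMeasure 1)).real {p : Ω × ℝ | t < α⁻¹ * (W r α (Z p.1))⁻¹ * p.2} =
      ∫ ω, Real.exp (-max (t * (α * W r α (Z ω))) 0) ∂μ := by
  have hW := measurable_W r α hZ
  have hm : MeasurableSet {p : Ω × ℝ | t < α⁻¹ * (W r α (Z p.1))⁻¹ * p.2} :=
    measurableSet_lt measurable_const
      (((hW.comp measurable_fst).inv.const_mul _).mul measurable_snd)
  rw [measureReal_def, Measure.prod_apply hm, integral_eq_lintegral_of_nonneg_ae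
    (ae_of_all _ fun ω => (Real.exp_pos _).le)
    (by fun_prop : Measurable fun ω => Real.exp (-max (t * (α * W r α (Z ω))) 0)).aestronglyMeasurable]
  congr 1
  refine lintegral_congr fun ω => ?_
  rw [← expMeasure_Ioi_max]
  congr 1
  ext y
  have h := W_pos r α (Z ω)
  simp only [Set.mem_preimage, Set.mem_ofPred_eq, Set.mem_Ioi]
  rw [← mul_inv, inv_mul_eq_div, lt_div_iff₀ (by positivity)]

theorem measurable_L (hr : IsRankSequence r) (hX : ∀ n, 1 ≤ n → Measurable (X n)) (n : ℕ) :
    Measurable fun ω => L r (fun i => X i ω) n := by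
  have hM : ∀ n, Measurable fun ω => M r (fun i => X i ω) n := fun n =>
    measurable_M hr fun k h1 _ => hX k h1
  have hN : Measurable fun ω => n - N r (fun i => X i ω) (M r (fun i => X i ω) n) := by
    refine measurable_of_Ici fun j => ?_
    rcases le_or_gt j n with hj | hj
    · have : (fun ω => n - N r (fun i => X i ω) (M r (fun i => X i ω) n)) ⁻¹' Set.Ici j =
          {ω | M r (fun i => X i ω) n = M r (fun i => X i ω) (n - j)} := by
        ext ω
        rw [Set.mem_ofPred_eq, ← L_ge_iff r _ hj, L, ← Nat.cast_sub (N_le le_rfl), Nat.cast_le]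
        rfl
      rw [this]
      exact measurableSet_eq_fun (hM n) (hM (n - j))
    · convert MeasurableSet.empty
      ext ω
      simp only [Set.mem_preimage, Set.mem_Ici, Set.mem_empty_iff_false, iff_false]
      omega
  have e : (fun ω => L r (fun i => X i ω) n) = fun ω =>
      ((n - N r (fun i => X i ω) (M r (fun i => X i ω) n) : ℕ) : ℝ) := by
    funext ω
    rw [L, Nat.cast_sub (N_le le_rfl)]
  rw [e]
  exact (measurable_from_top (f := fun n : ℕ => (n : ℝ))).comp hN

variable [IsProbabilityMeasure μ]

/-- For `t ≥ 0` the tail is the mean of `(1 - exp (-thr))` to the power `gap`, with the threshold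
taken `gap` steps earlier. The integrand is at most one and converges to `exp (-t α W)`, whose mean
is the tail of the mixture on the product space. -/
theorem tendstoInDistribution_L (hr : IsRankSequence r) (hX : ∀ n, 1 ≤ n → Measurable (X n))
    (hXindep : iIndepFun (fun n : {n : ℕ // 1 ≤ n} => X n) μ)
    (hXlaw : ∀ n, 1 ≤ n → HasLaw (X n) (expMeasure 1) μ) (hα0 : 0 < α) (hα1 : α < 1)
    (hZ : Measurable Z)
    (h : ∀ᵐ ω ∂μ, Tendsto (fun n : ℕ => Real.exp (-thr r (fun i => X i ω) n) *
      ((n + 1 : ℕ) : ℝ) ^ (1 - α)) atTop (𝓝 (α * W r α (Z ω)))) :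
    TendstoInDistribution
      (fun (n : ℕ) (ω : Ω) => L r (fun k => X k ω) n / (n : ℝ) ^ (1 - α)) atTop
      (fun p : Ω × ℝ => α⁻¹ * (W r α (Z p.1))⁻¹ * p.2) (fun _ => μ) (μ.prod (expMeasure 1)) := by
  have hW := measurable_W r α hZ
  refine tendstoInDistribution_of_Ioi (fun n => ((measurable_L hr hX n).div_const _).aemeasurable)
    (((hW.comp measurable_fst).inv.const_mul _).mul measurable_snd).aemeasurable fun t => ?_
  rw [prod_real_lt hZ hα0]
  rcases lt_or_ge t 0 with ht | ht
  · have e1 : ∀ ω, max (t * (α * W r α (Z ω))) 0 = 0 := fun ω => by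
      have := W_pos r α (Z ω)
      exact max_eq_right (mul_nonpos_of_nonpos_of_nonneg ht.le (by positivity))
    have e2 : ∀ n : ℕ, {ω | t < L r (fun k => X k ω) n / (n : ℝ) ^ (1 - α)} = Set.univ := fun n => by
      refine Set.eq_univ_of_forall fun ω => ht.trans_le ?_
      exact div_nonneg (L_nonneg _ _ _) (by positivity)
    simp [e1, e2]
  have e1 : ∀ ω, max (t * (α * W r α (Z ω))) 0 = t * (α * W r α (Z ω)) := fun ω => by
    have := W_pos r α (Z ω)
    exact max_eq_left (by positivity)
  simp only [e1]
  have hlim : Tendsto (fun n => ∫ ω, (1 - Real.exp (-thr r (fun i => X i ω) (n - gap α t n))) ^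
      gap α t n ∂μ) atTop (𝓝 (∫ ω, Real.exp (-(t * (α * W r α (Z ω)))) ∂μ)) := by
    refine tendsto_integral_of_dominated_convergence (fun _ => 1) (fun n => ?_)
      (integrable_const _) (fun n => ?_) ?_
    · have := measurable_thr (n := n - gap α t n) hr fun k h1 _ => hX k h1
      exact ((this.neg.exp.const_sub 1).pow_const _).aestronglyMeasurable
    · filter_upwards [ae_pos hXlaw] with ω hpos
      have h0 := thr_nonneg hr hpos (n - gap α t n)
      have h1 : Real.exp (-thr r (fun i => X i ω) (n - gap α t n)) ≤ 1 := by
        rw [Real.exp_le_one_iff]; linarith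
      have h2 := Real.exp_pos (-thr r (fun i => X i ω) (n - gap α t n))
      rw [Real.norm_of_nonneg (pow_nonneg (by linarith) _)]
      exact pow_le_one₀ (by linarith) (by linarith)
    · filter_upwards [h] with ω hω
      exact tendsto_one_sub_pow_gap hα0 hα1 ht hω
  refine hlim.congr' ?_
  filter_upwards [eventually_gap_le hα0 hα1 ht, eventually_gt_atTop 0] with n hg hn
  rw [← integral_one_sub_exp_pow hr hX hXindep hXlaw, Nat.sub_add_cancel hg]
  congr 1
  ext ω
  exact (lt_L_div_iff r _ ht hn hg).symm

end limits

end Hiring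

theorem mainTheorem11 {Ω : Type*} [MeasurableSpace Ω] (μ : Measure Ω) [IsProbabilityMeasure μ]
    (X : ℕ → Ω → ℝ)
    (hXmeas : ∀ n, 1 ≤ n → Measurable (X n))
    (hXindep : iIndepFun (fun n : {n : ℕ // 1 ≤ n} => X n) μ)
    (hXlaw : ∀ n, 1 ≤ n → HasLaw (X n) (expMeasure 1) μ)
    (r : ℕ → ℕ) (hr : Hiring.IsRankSequence r)
    (α : ℝ) (hα0 : 0 < α) (hα1 : α < 1)
    (hsum : Summable fun m : ℕ => |1 / (r (m + 1) : ℝ) - 1 / (α * ((m + 1 : ℕ) : ℝ))|) :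
    -- the variables `E_k` with `δ_k = 1` are i.i.d. `Exp(1)`
    iIndepFun (fun (k : {k : ℕ // 1 ≤ k ∧ r k = r (k - 1)}) (ω : Ω) =>
      Hiring.E r (fun n => X n ω) k) μ ∧
    (∀ k : ℕ, 1 ≤ k → r k = r (k - 1) →
      HasLaw (fun ω => Hiring.E r (fun n => X n ω) k) (expMeasure 1) μ) ∧
    -- the random variable `Z = ∑_{k ≥ 1} δ_k / r(k) (E_k - 1)`, which determines `W`
    ∃ Z : Ω → ℝ, Measurable Z ∧
      (∀ᵐ ω ∂μ, Tendsto (fun m : ℕ => ∑ k ∈ Finset.Icc 1 m,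
        Hiring.delta r k / (r k : ℝ) * (Hiring.E r (fun n => X n ω) k - 1)) atTop (𝓝 (Z ω))) ∧
      (∀ᵐ ω ∂μ, Tendsto (fun n : ℕ => (Hiring.M r (fun k => X k ω) n : ℝ) / (n : ℝ) ^ α)
        atTop (𝓝 (Hiring.W r α (Z ω)))) ∧
      -- `P_n ∼ α M_n / n ∼ α W n^{α - 1}` almost surely
      (∀ᵐ ω ∂μ,
        Tendsto (fun n : ℕ => Hiring.P μ r X n ω /
          (α * (Hiring.M r (fun k => X k ω) n : ℝ) / (n : ℝ))) atTop (𝓝 1) ∧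
        Tendsto (fun n : ℕ => (α * (Hiring.M r (fun k => X k ω) n : ℝ) / (n : ℝ)) /
          (α * Hiring.W r α (Z ω) * (n : ℝ) ^ (α - 1))) atTop (𝓝 1)) ∧
      -- `L_n / n^{1 - α} → α⁻¹ W⁻¹ E` in distribution, with `E ∼ Exp(1)` independent of `W`:
      -- the limit lives on the product of `(Ω, μ)` and `(ℝ, Exp(1))`
      TendstoInDistribution
        (fun (n : ℕ) (ω : Ω) => Hiring.L r (fun k => X k ω) n / (n : ℝ) ^ (1 - α)) atTop
        (fun p : Ω × ℝ => α⁻¹ * (Hiring.W r α (Z p.1))⁻¹ * p.2)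
        (fun _ => μ) (μ.prod (expMeasure 1)) := by
  -- A measurable version of the almost sure limit, defined on all of `Ω`.
  obtain ⟨Z, hZm, hZ⟩ : ∃ Z : Ω → ℝ, Measurable Z ∧ ∀ᵐ ω ∂μ, Tendsto (fun m : ℕ =>
      ∑ k ∈ Finset.Icc 1 m, Hiring.noise r (fun n => X n ω) k) atTop (𝓝 (Z ω)) := by
    obtain ⟨Z, hZm, hZ⟩ := exists_stronglyMeasurable_limit_of_tendsto_ae (fun m =>
      (Finset.measurable_fun_sum (Finset.Icc 1 m) fun k _ =>
        Hiring.measurable_noise hr hXmeas k).aestronglyMeasurable)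
      (Hiring.ae_exists_tendsto_sum_noise hr hXmeas hXindep hXlaw hα0 hsum)
    exact ⟨Z, hZm.measurable, hZ⟩
  have hlim : ∀ᵐ ω ∂μ, Tendsto (fun n : ℕ => (Hiring.M r (fun k => X k ω) n : ℝ) / (n : ℝ) ^ α)
      atTop (𝓝 (Hiring.W r α (Z ω))) ∧
      Tendsto (fun n : ℕ => Real.exp (-Hiring.thr r (fun k => X k ω) n) /
        (α * (Hiring.M r (fun k => X k ω) (n + 1) : ℝ) / ((n + 1 : ℕ) : ℝ))) atTop (𝓝 1) := by
    filter_upwards [hZ, Hiring.ae_pos hXlaw, Hiring.ae_inj hXmeas hXindep hXlaw,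
      Hiring.ae_exists_tendsto_sum_hireDiff hr hXmeas hXindep hXlaw] with ω h1 h2 h3 h4
    exact Hiring.tendsto_M_div_rpow_and_exp_neg_thr hr h2 h3 hα0 hsum h1 h4
  refine ⟨Hiring.iIndepFun_E hr hXmeas hXindep hXlaw,
    fun k h1 h2 => Hiring.hasLaw_E hr hXmeas hXindep hXlaw h1 h2, Z, hZm, hZ,
    hlim.mono fun ω h => h.1, ?_, ?_⟩
  · filter_upwards [hlim, ae_all_iff.2 (Hiring.P_succ_ae_eq hr hXmeas hXindep hXlaw)]
      with ω ⟨h1, h2⟩ h3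
    refine ⟨?_, Hiring.tendsto_mul_div_div hα0 h1⟩
    -- The threshold after `n` candidates decides on candidate `n + 1`, hence the shift of index.
    rw [← tendsto_add_atTop_iff_nat 1]
    exact h2.congr fun n => by rw [h3]
  · refine Hiring.tendstoInDistribution_L hr hXmeas hXindep hXlaw hα0 hα1 hZm ?_
    filter_upwards [hlim] with ω h
    exact Hiring.tendsto_exp_neg_thr_mul_rpow hα0 h.1 h.2
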